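/- **Setting.** For every security parameter $\ell$ fix a cyclic group $\mathbb G_\ell=\langle g\rangle$ of prime order $p$ with polynomial-time group law and fixed-length encoding, a hash function $H:\{0,1\}^*\to\{0,1\}^\ell$ modelled as a random oracle, and an authenticated encryption scheme AE with $\ell$-bit keys for messages of a fixed length mlen. PPT means non-uniform: polynomial-size probabilistic circuits (with access to $H$ in the unobservability experiment). There are $n$ journalists, who use a bulletin board and a pigeonhole run by one communication server that follows its protocol. A key pair is $(x,g^x)$ with $x$ uniform. Each journalist has a medium-term key, a key for each of her queries, and cover keys. The $n_s$-th message ($n_s\ge 0$) from key $\mathsf{sk}_A$ to key $\mathsf{pk}_B$ is padded to length mlen, encrypted with AE under $H(\text{`key'}\|k'\|\mathsf{pk}_A\|n_s)$, and posted to mailbox $H(\text{`addr'}\|k'\|\mathsf{pk}_A\|n_s)$, where $k'=\mathrm{DH}(\mathsf{sk}_A,\mathsf{pk}_B)$ (PH.SendRaw). A receiver who awaits messages for this pair of keys, and has received the previous ones, downloads the message at the first moment at or after its posting at which she is online, provided that the pigeonhole still holds it (it deletes messages after a fixed lifetime). While online, each journalist runs PH.Cover. After independent exponential delays of rate $\lambda_k>0$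 she uploads fresh cover keys. After the first upload, independently for every other journalist $i$ and after independent exponential delays of rate $\lambda_c>0$, she sends to $i$ the first message of her queue for $i$, or a fixed dummy message if the queue is empty. Dummy messages go from her current cover key to $i$'s medium-term key. Queued messages go either by the same two keys or by the two keys of the conversation (querier's query key and owner's medium-term key, in either direction); the theorem is claimed for both conventions. PH.HiddenSend puts a message into the queue. Query replies are sent directly by PH.SendRaw. **Adversary.** The adversary controls the communication server, as an observer of everything the server sees: all public keys, the time of each upload of a cover key, and for each message its address, its ciphertext (hence its length), and its times of posting and retrieval. She also knows the private keys of all journalists other than a sender $S$ and a receiver $R\ne S$. If Tor's anonymity is broken, she moreover sees who uploads each cover key and the sender and receiver of each message. **Theorem.** Assume that the decisional Diffie–Hellman assumption holds in $(\mathbb G_\ell)$, and that AE is polynomial-time and secure (IND-CPA and INT-CTXT). For every $\ell$ fix an arbitrary activity of the journalists (online sessions, numbers of queries, query replies, calls of PH.HiddenSend, awaited pairs of keys), and a further call of PH.HiddenSend by $S$ with a message for $R$. Assume that $R$ awaits all conversation messages and all cover messages of $S$, and that after any moment at which $S$ is online $R$ is online within the lifetime of messages. Then this message is unobservable: for every PPT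 adversary as above, who reads a polynomial-length prefix of her view with time stamps rounded to a precision of her choice, $$\bigl|\Pr[\mathcal A=1\mid \text{the further call is made}]-\Pr[\mathcal A=1\mid \text{it is not made}]\bigr|$$ is negligible in $\ell$. This holds whether or not Tor's anonymity is broken. -/

import Mathlib

open MeasureTheory ProbabilityTheory Filter

noncomputable section

namespace Pigeonhole

/-! ### Bit strings -/

/-- Bit strings of length `n`. -/
abbrev Bits (n : ℕ) : Type := Fin n → Bool

/-- The `w` low-order bits of `k`. -/
def natBits (w k : ℕ) : List Bool := (List.range w).map fun i => k.testBit i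

/-- Cut off, or fill up with zeros, to length `n`. -/
def toBits (n : ℕ) (l : List Bool) : Bits n := fun i => l.getD i false

/-- Messages that fit, after padding, into `L` bits. -/
abbrev Message (L : ℕ) : Type := {m : List Bool // m.length < L}

/-- Padding to the fixed length `L`: a single one, followed by zeros. -/
def pad {L : ℕ} (m : Message L) : Bits L := toBits L (m.1 ++ [true])

/-! ### Non-uniform probabilistic polynomial time: polynomial-size oracle circuits

A circuit works on a growing list of wires: first the input bits, then the random coins, then the
bits that its gates append one after the other. A wire that does not exist (yet) reads as zero. -/

/-- An oracle answers the `t`-th call (counted from zero) on a query by a bit string. -/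
abbrev Oracle : Type := ℕ → List Bool → List Bool

/-- The absent oracle. -/
def noOracle : Oracle := fun _ _ => []

inductive Gate
  /-- append a constant -/
  | const (b : Bool)
  /-- append the negated conjunction of two wires -/
  | nand (i j : ℕ)
  /-- query the oracle on the listed wires and append the first `out` bits of its answer -/
  | oracle (args : List ℕ) (out : ℕ)

def Gate.cost : Gate → ℕ
  | .const _ => 1
  | .nand _ _ => 1
  | .oracle args out => 1 + args.length + out

structure Circuit where
  /-- number of input bits that are read -/
  inputs : ℕ
  /-- number of random coins -/
  coins : ℕ
  gates : List Gate
  /-- the wires that form the output -/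
  outputs : List ℕ

/-- The wires computed so far and the answers the oracle gave so far. -/
structure RunState where
  wires : List Bool
  answers : List (List Bool)

def RunState.wire (s : RunState) (i : ℕ) : Bool := s.wires.getD i false

def Gate.step (O : Oracle) (s : RunState) : Gate → RunState
  | .const b => ⟨s.wires ++ [b], s.answers⟩
  | .nand i j => ⟨s.wires ++ [!(s.wire i && s.wire j)], s.answers⟩
  | .oracle args out =>
      let a := O s.answers.length (args.map s.wire)
      ⟨s.wires ++ List.ofFn (toBits out a), s.answers ++ [a]⟩

namespace Circuit

/-- The number of bits read, coins tossed, bits written, and the cost of all gates. -/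
def size (C : Circuit) : ℕ :=
  C.inputs + C.coins + C.outputs.length + (C.gates.map Gate.cost).sum

/-- Execution with oracle `O`, input `x` and coins `r`. -/
def exec (C : Circuit) (O : Oracle) (x : List Bool) (r : Bits C.coins) : RunState :=
  C.gates.foldl (Gate.step O) ⟨List.ofFn (toBits C.inputs x) ++ List.ofFn r, []⟩

def run (C : Circuit) (O : Oracle) (x : List Bool) (r : Bits C.coins) : List Bool :=
  C.outputs.map (C.exec O x r).wire

/-- The first output bit is one. -/
def Accepts (C : Circuit) (O : Oracle) (x : List Bool) (r : Bits C.coins) : Prop :=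
  (C.run O x r).head? = some true

end Circuit

/-- A family of circuits of polynomial size. -/
def PolySize (C : ℕ → Circuit) : Prop :=
  ∃ P : Polynomial ℕ, ∀ ℓ, (C ℓ).size ≤ P.eval ℓ

/-- Smaller than every inverse polynomial in the security parameter. -/
def Negligible (f : ℕ → ℝ) : Prop :=
  Asymptotics.SuperpolynomialDecay atTop (fun ℓ : ℕ => (ℓ : ℝ)) f

/-- The probability of an event under the uniform distribution on a finite type. -/
def prob {α : Type} [Fintype α] (E : α → Prop) : ℝ :=
  (Nat.card {a : α // E a} : ℝ) / (Fintype.card α : ℝ)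

/-- The uniform distribution on a finite type, as a measure. -/
def uniform (α : Type) [Fintype α] [Nonempty α] [MeasurableSpace α] : Measure α :=
  (PMF.uniformOfFintype α).toMeasure

instance (α : Type) [Fintype α] [Nonempty α] [MeasurableSpace α] :
    IsProbabilityMeasure (uniform α) := by
  unfold uniform; infer_instance

/-! ### Cyclic groups of prime order and the decisional Diffie-Hellman assumption -/

/-- For every security parameter a cyclic group of prime order with a generator, and an injective
encoding of its elements by bit strings of a fixed length. -/
structure GroupFamily where
  G : ℕ → Type
  [group : ∀ ℓ, CommGroup (G ℓ)]
  p : ℕ → ℕ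
  prime : ∀ ℓ, (p ℓ).Prime
  card_eq : ∀ ℓ, Nat.card (G ℓ) = p ℓ
  gen : ∀ ℓ, G ℓ
  generates : ∀ ℓ (x : G ℓ), x ∈ Subgroup.zpowers (gen ℓ)
  len : ℕ → ℕ
  encode : ∀ ℓ, G ℓ → Bits (len ℓ)
  encode_injective : ∀ ℓ, Function.Injective (encode ℓ)

attribute [instance] GroupFamily.group

namespace GroupFamily

variable (𝔾 : GroupFamily)

instance (ℓ : ℕ) : Nonempty (Fin (𝔾.p ℓ)) := ⟨⟨0, (𝔾.prime ℓ).pos⟩⟩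

/-- The encoding of a group element, as a list of bits. -/
def code (ℓ : ℕ) (x : 𝔾.G ℓ) : List Bool := List.ofFn (𝔾.encode ℓ x)

/-- The group law is computable in polynomial time. -/
def Efficient : Prop :=
  ∃ C : ℕ → Circuit, PolySize C ∧ ∀ ℓ (x y : 𝔾.G ℓ) r,
    (C ℓ).run noOracle (𝔾.code ℓ x ++ 𝔾.code ℓ y) r = 𝔾.code ℓ (x * y)

/-- Acceptance probability on a Diffie-Hellman triple. -/
def probReal (C : Circuit) (ℓ : ℕ) : ℝ :=
  prob fun w : Fin (𝔾.p ℓ) × Fin (𝔾.p ℓ) × Bits C.coins =>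
    C.Accepts noOracle
      (𝔾.code ℓ (𝔾.gen ℓ ^ (w.1 : ℕ)) ++ 𝔾.code ℓ (𝔾.gen ℓ ^ (w.2.1 : ℕ)) ++
        𝔾.code ℓ (𝔾.gen ℓ ^ ((w.1 : ℕ) * (w.2.1 : ℕ)))) w.2.2

/-- Acceptance probability on a random triple. -/
def probRandom (C : Circuit) (ℓ : ℕ) : ℝ :=
  prob fun w : Fin (𝔾.p ℓ) × Fin (𝔾.p ℓ) × Fin (𝔾.p ℓ) × Bits C.coins =>
    C.Accepts noOracle
      (𝔾.code ℓ (𝔾.gen ℓ ^ (w.1 : ℕ)) ++ 𝔾.code ℓ (𝔾.gen ℓ ^ (w.2.1 : ℕ)) ++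
        𝔾.code ℓ (𝔾.gen ℓ ^ (w.2.2.1 : ℕ))) w.2.2.2

/-- The decisional Diffie-Hellman assumption. -/
def DDH : Prop :=
  ∀ C : ℕ → Circuit, PolySize C →
    Negligible fun ℓ => |𝔾.probReal (C ℓ) ℓ - 𝔾.probRandom (C ℓ) ℓ|

end GroupFamily

/-! ### Authenticated encryption -/

/-- A correct symmetric encryption scheme for messages of a fixed length, with uniform keys of
`ℓ` bits. -/
structure AEScheme where
  msgLen : ℕ → ℕ
  ctLen : ℕ → ℕ
  coinLen : ℕ → ℕ
  enc : ∀ ℓ, Bits ℓ → Bits (msgLen ℓ) → Bits (coinLen ℓ) → Bits (ctLen ℓ)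
  dec : ∀ ℓ, Bits ℓ → Bits (ctLen ℓ) → Option (Bits (msgLen ℓ))
  correct : ∀ ℓ k m r, dec ℓ k (enc ℓ k m r) = some m

namespace AEScheme

variable (ae : AEScheme)

/-- Encryption and decryption are computable in polynomial time. -/
def Efficient : Prop :=
  (∃ C : ℕ → Circuit, PolySize C ∧ ∀ ℓ k m (ρ : Bits (ae.coinLen ℓ)) r,
    (C ℓ).run noOracle (List.ofFn k ++ List.ofFn m ++ List.ofFn ρ) r =
      List.ofFn (ae.enc ℓ k m ρ)) ∧
  (∃ C : ℕ → Circuit, PolySize C ∧ ∀ ℓ (k : Bits ℓ) (c : Bits (ae.ctLen ℓ)) r,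
    (C ℓ).run noOracle (List.ofFn k ++ List.ofFn c) r =
      match ae.dec ℓ k c with
      | some m => true :: List.ofFn m
      | none => false :: List.replicate (ae.msgLen ℓ) false)

/-- The encryption oracle under key `k`; the `t`-th call uses the coins `ρ t`. A circuit of size
`s` makes at most `s` calls. -/
def encOracle (ℓ : ℕ) (k : Bits ℓ) {s : ℕ} (ρ : Fin s → Bits (ae.coinLen ℓ)) : Oracle :=
  fun t q => if h : t < s then List.ofFn (ae.enc ℓ k (toBits _ q) (ρ ⟨t, h⟩)) else []

/-- The left-or-right oracle: on a query `m₀ ‖ m₁` it encrypts `m₁` if `b` and `m₀` otherwise. -/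
def lrOracle (b : Bool) (ℓ : ℕ) (k : Bits ℓ) {s : ℕ} (ρ : Fin s → Bits (ae.coinLen ℓ)) : Oracle :=
  fun t q => ae.encOracle ℓ k ρ t
    (if b then q.drop (ae.msgLen ℓ) else q.take (ae.msgLen ℓ))

/-- Acceptance probability with the left-or-right oracle for the bit `b`. -/
def probLR (b : Bool) (C : Circuit) (ℓ : ℕ) : ℝ :=
  prob fun w : Bits ℓ × (Fin C.size → Bits (ae.coinLen ℓ)) × Bits C.coins =>
    C.Accepts (ae.lrOracle b ℓ w.1 w.2.1) [] w.2.2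

/-- Indistinguishability under chosen-plaintext attacks. -/
def INDCPA : Prop :=
  ∀ C : ℕ → Circuit, PolySize C →
    Negligible fun ℓ => |ae.probLR true (C ℓ) ℓ - ae.probLR false (C ℓ) ℓ|

/-- The probability that, given an encryption oracle, `C` outputs a valid ciphertext that is not
an answer of the oracle. -/
def probForge (C : Circuit) (ℓ : ℕ) : ℝ :=
  prob fun w : Bits ℓ × (Fin C.size → Bits (ae.coinLen ℓ)) × Bits C.coins =>
    let O := ae.encOracle ℓ w.1 w.2.1
    let c : Bits (ae.ctLen ℓ) := toBits _ (C.run O [] w.2.2)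
    ae.dec ℓ w.1 c ≠ none ∧ List.ofFn c ∉ (C.exec O [] w.2.2).answers

/-- Integrity of ciphertexts. -/
def INTCTXT : Prop :=
  ∀ C : ℕ → Circuit, PolySize C → Negligible fun ℓ => ae.probForge (C ℓ) ℓ

/-- Security of an authenticated encryption scheme. -/
def Secure : Prop := ae.INDCPA ∧ ae.INTCTXT

end AEScheme

/-! ### The communication system -/

/-- The parameters of the system: the group, the authenticated encryption scheme (whose message
length is the fixed length of padded messages), the number of journalists, the rates of new cover
keys and of messages per recipient, how long the pigeonhole keeps a message, and the dummy
message. -/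
structure System where
  grp : GroupFamily
  ae : AEScheme
  n : ℕ
  rateKey : ℝ
  rateKey_pos : 0 < rateKey
  rateSend : ℝ
  rateSend_pos : 0 < rateSend
  lifetime : ℝ
  dummy : ∀ ℓ, Message (ae.msgLen ℓ)

/-- The names of the key pairs of the `n` journalists. -/
inductive KeyId (n : ℕ) : Type
  /-- the medium-term key of journalist `j` -/
  | medium (j : Fin n)
  /-- the key of journalist `j` for her `q`-th query -/
  | query (j : Fin n) (q : ℕ)
  /-- the `k`-th cover key that journalist `j` uploads in her `s`-th online session -/
  | cover (j : Fin n) (s k : ℕ)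

/-- The two sides of a conversation about the `q`-th query of the querier: messages of the querier
go from the query key to the medium-term key of the owner, messages of the owner the other way. -/
inductive Role : Type
  | querier (q : ℕ)
  | owner (q : ℕ)

/-- A call of `PH.HiddenSend` at a given time. -/
structure HiddenSend (n L : ℕ) where
  time : ℝ
  sender : Fin n
  receiver : Fin n
  role : Role
  msg : Message L

namespace HiddenSend

variable {n L : ℕ}

/-- The sender's key in the conversation. -/
def sendKey (c : HiddenSend n L) : KeyId n :=
  match c.role with
  | .querier q => .query c.sender q
  | .owner _ => .medium c.sender

/-- The receiver's key in the conversation. -/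
def recvKey (c : HiddenSend n L) : KeyId n :=
  match c.role with
  | .querier _ => .medium c.receiver
  | .owner q => .query c.receiver q

end HiddenSend

/-- A call of `PH.SendRaw` at a given time. -/
structure RawSend (n L : ℕ) where
  time : ℝ
  sender : Fin n
  receiver : Fin n
  sendKey : KeyId n
  recvKey : KeyId n
  msg : Message L

/-- The reply of an owner to the `q`-th query of a querier. -/
structure Reply (n L : ℕ) where
  time : ℝ
  owner : Fin n
  querier : Fin n
  q : ℕ
  msg : Message L

/-- What the journalists do, apart from cover traffic. -/
structure Activity (n L : ℕ) where
  /-- the online sessions `[start, stop)` of each journalist -/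
  sessions : Fin n → List (ℝ × ℝ)
  /-- the number of queries of each journalist -/
  queries : Fin n → ℕ
  /-- the replies to queries, sent in the open by `PH.SendRaw` -/
  replies : List (Reply n L)
  /-- the conversation messages -/
  calls : List (HiddenSend n L)
  /-- `awaits u v`: the owner of the key pair `u` keeps running `PH.RecvProcess` with her private
  key of `u` and the public key of `v` -/
  awaits : KeyId n → KeyId n → Prop

/-- The same activity with one more conversation message. -/
def Activity.addCall {n L : ℕ} (E : Activity n L) (c : HiddenSend n L) : Activity n L :=
  { E with calls := c :: E.calls }

/-- Journalist `j` is online at time `t`. -/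
def Activity.Online {n L : ℕ} (E : Activity n L) (j : Fin n) (t : ℝ) : Prop :=
  ∃ I ∈ E.sessions j, I.1 ≤ t ∧ t < I.2

/-- Which key pair `PH.Cover` uses for a conversation message: the current cover key and the
recipient's medium-term key, as for a dummy message, or the two keys of the conversation. -/
inductive KeyChoice : Type
  | coverKey
  | conversationKey

/-! ### Cover traffic -/

/-- The delays that determine when cover keys are uploaded: `(j, s, k)` is the `k`-th delay of
journalist `j` in her session `s`. -/
abbrev KeyDelays (n : ℕ) : Type := Fin n × ℕ × ℕ → ℝ

/-- The delays that determine when messages are sent: `(j, i, s, k)` is the `k`-th delay of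
journalist `j` for the recipient `i` in her session `s`. -/
abbrev SendDelays (n : ℕ) : Type := Fin n × Fin n × ℕ × ℕ → ℝ

/-- The law of the delays: independent, exponential with rates `rateKey` and `rateSend`. -/
def System.delayLaw (sys : System) : Measure (KeyDelays sys.n × SendDelays sys.n) :=
  haveI := isProbabilityMeasure_expMeasure sys.rateKey_pos
  haveI := isProbabilityMeasure_expMeasure sys.rateSend_pos
  (Measure.infinitePi fun _ : Fin sys.n × ℕ × ℕ => expMeasure sys.rateKey).prod
    (Measure.infinitePi fun _ : Fin sys.n × Fin sys.n × ℕ × ℕ => expMeasure sys.rateSend)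

/-- The time of the `k`-th event when waiting for the delays `d 0, d 1, …` in turn from time
`a` on. -/
def arrival (a : ℝ) (d : ℕ → ℝ) (k : ℕ) : ℝ := a + ∑ r ∈ Finset.range (k + 1), d r

/-- The number of events up to time `t` (included). -/
def countUpTo (a : ℝ) (d : ℕ → ℝ) (t : ℝ) : ℕ := {k : ℕ | arrival a d k ≤ t}.ncard

/-- The number of events before time `t`. -/
def countBefore (a : ℝ) (d : ℕ → ℝ) (t : ℝ) : ℕ := {k : ℕ | arrival a d k < t}.ncard

/-- What the server gets to see over time: uploads of cover keys to the bulletin board and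
messages posted to the pigeonhole. -/
inductive Event (n L : ℕ) : Type
  | upload (time : ℝ) (j : Fin n) (s k : ℕ)
  | post (m : RawSend n L)

def Event.time {n L : ℕ} : Event n L → ℝ
  | .upload t _ _ _ => t
  | .post m => m.time

open Classical in
/-- Chronological order. -/
def sortByTime {α : Type} (time : α → ℝ) (l : List α) : List α :=
  l.mergeSort fun x y => decide (time x ≤ time y)

section Cover

variable {n L : ℕ} (E : Activity n L) (d : KeyDelays n × SendDelays n)

/-- The sessions of `j`, numbered: `(s, start, stop)`. -/
def numberedSessions (j : Fin n) : List (ℕ × ℝ × ℝ) :=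
  (E.sessions j).zipIdx.map fun x => (x.2, x.1.1, x.1.2)

/-- "Cover keys": in each session, `j` uploads a fresh cover key after every delay. -/
def uploads (j : Fin n) : List (Event n L) :=
  (numberedSessions E j).flatMap fun x =>
    let dk := fun k => d.1 (j, x.1, k)
    (List.range (countBefore x.2.1 dk x.2.2)).map fun k => .upload (arrival x.2.1 dk k) j x.1 k

/-- "Sending messages": the times at which `j` sends a message to `i`, each with the cover key that
is then current. In each session `j` waits for the upload of the first cover key, and then sends a
message after every delay. -/
def slots (j i : Fin n) : List (ℝ × KeyId n) :=
  sortByTime Prod.fst <| (numberedSessions E j).flatMap fun x =>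
    let dk := fun k => d.1 (j, x.1, k)
    let ds := fun k => d.2 (j, i, x.1, k)
    let first := arrival x.2.1 dk 0
    (List.range (countBefore first ds x.2.2)).map fun k =>
      let t := arrival first ds k
      (t, .cover j x.1 (countUpTo x.2.1 dk t - 1))

/-- Sending a conversation message at time `t` while `κ` is the current cover key. -/
def conversationPost (choice : KeyChoice) (t : ℝ) (κ : KeyId n) (c : HiddenSend n L) :
    RawSend n L :=
  match choice with
  | .coverKey => ⟨t, c.sender, c.receiver, κ, .medium c.receiver, c.msg⟩
  | .conversationKey => ⟨t, c.sender, c.receiver, c.sendKey, c.recvKey, c.msg⟩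

open Classical in
/-- In each slot, send the first message of the queue from `j` to `i`, or the dummy message if the
queue is empty. The last argument lists, in chronological order, the calls of `PH.HiddenSend` whose
message was not sent yet; it is in the queue from the time of the call on. -/
def emptyQueue (choice : KeyChoice) (dummy : Message L) (j i : Fin n) :
    List (ℝ × KeyId n) → List (HiddenSend n L) → List (RawSend n L)
  | [], _ => []
  | (t, κ) :: rest, [] =>
      ⟨t, j, i, κ, .medium i, dummy⟩ :: emptyQueue choice dummy j i rest []
  | (t, κ) :: rest, c :: cs =>
      if c.time ≤ t then conversationPost choice t κ c :: emptyQueue choice dummy j i rest cs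
      else ⟨t, j, i, κ, .medium i, dummy⟩ :: emptyQueue choice dummy j i rest (c :: cs)

/-- All messages that `PH.Cover` of `j` sends to `i`. -/
def coverPosts (choice : KeyChoice) (dummy : Message L) (j i : Fin n) : List (RawSend n L) :=
  emptyQueue choice dummy j i (slots E d j i) <|
    sortByTime HiddenSend.time (E.calls.filter fun c => decide (c.sender = j ∧ c.receiver = i))

open Classical in
/-- The replies to queries; an owner replies when she is online. -/
def replyPosts : List (RawSend n L) :=
  (E.replies.filter fun a => decide (E.Online a.owner a.time)).map fun a =>
    ⟨a.time, a.owner, a.querier, .medium a.owner, .query a.querier a.q, a.msg⟩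

/-- Everything the server sees, in chronological order. -/
def events (choice : KeyChoice) (dummy : Message L) : List (Event n L) :=
  sortByTime Event.time <|
    (List.finRange n).flatMap (fun j => uploads E d j) ++
    (replyPosts E).map .post ++
    (List.finRange n).flatMap fun j =>
      ((List.finRange n).filter fun i => decide (i ≠ j)).flatMap fun i =>
        (coverPosts E d choice dummy j i).map .post

end Cover

/-! ### Retrieval -/

section Retrieval

variable {n L : ℕ} (E : Activity n L) (lifetime : ℝ)

/-- The receiver comes online before the pigeonhole deletes the message. -/
def Timely (m : RawSend n L) : Prop :=
  ∃ t, m.time ≤ t ∧ t ≤ m.time + lifetime ∧ E.Online m.receiver t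

open Classical in
/-- The messages in `past` that were sent with the same two keys as `m`. Their number is the
counter `n_s` of the sender for `m`. -/
def samePair (past : List (RawSend n L)) (m : RawSend n L) : List (RawSend n L) :=
  past.filter fun m' => decide (m'.sendKey = m.sendKey ∧ m'.recvKey = m.recvKey)

/-- The receiver gets to `m`: she awaits messages for this pair of keys, and she received all
earlier ones, so that her counter `n_r` agrees with the counter `n_s` of `m`, she computes the
mailbox address of `m`, and is notified while `m` is available. -/
def Retrieved (past : List (RawSend n L)) (m : RawSend n L) : Prop :=
  E.awaits m.recvKey m.sendKey ∧ Timely E lifetime m ∧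
    ∀ m' ∈ samePair past m, Timely E lifetime m'

open Classical in
/-- A retrieved message is downloaded as soon as the receiver is online and notified of it. -/
def retrievalTime (past : List (RawSend n L)) (m : RawSend n L) : Option ℝ :=
  if Retrieved E lifetime past m then some (sInf {t | m.time ≤ t ∧ E.Online m.receiver t})
  else none

end Retrieval

/-! ### The view of the server -/

/-- The ASCII bits of the strings "addr" and "key". -/
def addrTag : List Bool := [97, 100, 100, 114].flatMap (natBits 8)

def keyTag : List Bool := [107, 101, 121].flatMap (natBits 8)

/-- A time stamp with `τ` bits after and `τ` bits before the binary point. -/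
def stamp (τ : ℕ) (t : ℝ) : List Bool := natBits (2 * τ) ⌊t * 2 ^ τ⌋₊

namespace System

variable (sys : System) (ℓ : ℕ)

/-- The randomness besides the delays: private keys, coins of the encryptions (one for each message
posted), and the hash function `H : {0,1}* → {0,1}^ℓ` (a random oracle). -/
abbrev Secrets : Type :=
  (KeyId sys.n → Fin (sys.grp.p ℓ)) × (ℕ → Bits (sys.ae.coinLen ℓ)) × (List Bool → Bits ℓ)

/-- All of it is independent and uniform. -/
def secretLaw : Measure (sys.Secrets ℓ) :=
  (Measure.infinitePi fun _ : KeyId sys.n => uniform (Fin (sys.grp.p ℓ))).prod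
    ((Measure.infinitePi fun _ : ℕ => uniform (Bits (sys.ae.coinLen ℓ))).prod
      (Measure.infinitePi fun _ : List Bool => uniform (Bits ℓ)))

variable {ℓ} (ω : sys.Secrets ℓ)

def pk (u : KeyId sys.n) : sys.grp.G ℓ := sys.grp.gen ℓ ^ (ω.1 u : ℕ)

/-- The Diffie-Hellman key of the private key of `u` and the public key of `v`. -/
def dh (u v : KeyId sys.n) : sys.grp.G ℓ := sys.pk ω v ^ (ω.1 u : ℕ)

/-- Sender and receiver compute the same Diffie-Hellman key, hence the same address and key. -/
theorem dh_comm (u v : KeyId sys.n) : sys.dh ω u v = sys.dh ω v u := by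
  simp only [dh, pk, ← pow_mul, Nat.mul_comm]

/-- `H(tag ‖ k' ‖ pk_S ‖ n_s)`. -/
def hash (tag : List Bool) (u v : KeyId sys.n) (ns : ℕ) : Bits ℓ :=
  ω.2.2 (tag ++ sys.grp.code ℓ (sys.dh ω u v) ++ sys.grp.code ℓ (sys.pk ω u) ++ ns.bits)

section View

variable (torBroken : Bool) (S R : Fin sys.n) (τ : ℕ)
  (E : Activity sys.n (sys.ae.msgLen ℓ))

/-- The network identity of a journalist, if the adversary can break the anonymity of Tor. -/
def identity (j : Fin sys.n) : List Bool := if torBroken then natBits sys.n j else []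

/-- A public key of `j`. The adversary also knows the private key if `j` is neither the sender nor
the receiver. -/
def keyBits (j : Fin sys.n) (u : KeyId sys.n) : List Bool :=
  sys.grp.code ℓ (sys.pk ω u) ++
    if j = S ∨ j = R then [false] else true :: natBits (sys.grp.len ℓ) (ω.1 u)

/-- What `PH.SendRaw` and `PH.RecvProcess` show of the message `m`, sent after the messages in
`past`: time of posting, network identities, address, ciphertext, time of retrieval. -/
def postBits (past : List (RawSend sys.n (sys.ae.msgLen ℓ)))
    (m : RawSend sys.n (sys.ae.msgLen ℓ)) : List Bool :=
  let ns := (samePair past m).length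
  let addr := sys.hash ω addrTag m.sendKey m.recvKey ns
  let k := sys.hash ω keyTag m.sendKey m.recvKey ns
  let c := sys.ae.enc ℓ k (pad m.msg) (ω.2.1 past.length)
  stamp τ m.time ++ sys.identity torBroken m.sender ++ sys.identity torBroken m.receiver ++
    List.ofFn addr ++ List.ofFn c ++
    match retrievalTime E sys.lifetime past m with
    | some t => true :: stamp τ t
    | none => [false]

/-- The transcript of a list of events; `past` are the messages posted before. -/
def transcript : List (RawSend sys.n (sys.ae.msgLen ℓ)) →
    List (Event sys.n (sys.ae.msgLen ℓ)) → List Bool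
  | _, [] => []
  | past, .upload t j s k :: rest =>
      (false :: (stamp τ t ++ sys.identity torBroken j ++ sys.keyBits ω S R j (.cover j s k))) ++
        transcript past rest
  | past, .post m :: rest =>
      (true :: sys.postBits ω torBroken τ E past m) ++ transcript (past ++ [m]) rest

/-- The view of the adversary: the medium-term and query keys on the bulletin board, and the
transcript. -/
def view (choice : KeyChoice) (d : KeyDelays sys.n × SendDelays sys.n) : List Bool :=
  ((List.finRange sys.n).flatMap fun j =>
    sys.keyBits ω S R j (.medium j) ++
      (List.range (E.queries j)).flatMap fun q => sys.keyBits ω S R j (.query j q)) ++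
  sys.transcript ω torBroken S R τ E [] (events E d choice (sys.dummy ℓ))

end View

/-! ### Unobservability -/

/-- The probability that the adversary `C`, who has oracle access to the hash function, accepts its
view: the average over the delays of the probability over keys, encryption coins, hash function and
coins of the adversary. -/
def acceptProb (choice : KeyChoice) (torBroken : Bool) (S R : Fin sys.n) (ℓ τ : ℕ)
    (E : Activity sys.n (sys.ae.msgLen ℓ)) (C : Circuit) : ℝ :=
  (∫⁻ d, ((sys.secretLaw ℓ).prod (uniform (Bits C.coins)))
    {w | C.Accepts (fun _ q => List.ofFn (w.1.2.2 q))
      (sys.view w.1 torBroken S R τ E choice d) w.2} ∂sys.delayLaw).toReal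

/-- No polynomial-time adversary who sees the view of the communication server, with time stamps of
a precision `τ` of her choice, distinguishes the scenario in which the message `c` is sent from the
scenario in which it is not. -/
def Unobservable (choice : KeyChoice) (torBroken : Bool) (S R : Fin sys.n)
    (E : ∀ ℓ, Activity sys.n (sys.ae.msgLen ℓ)) (c : ∀ ℓ, HiddenSend sys.n (sys.ae.msgLen ℓ)) :
    Prop :=
  ∀ (C : ℕ → Circuit) (τ : ℕ → ℕ), PolySize C →
    Negligible fun ℓ =>
      |sys.acceptProb choice torBroken S R ℓ (τ ℓ) ((E ℓ).addCall (c ℓ)) (C ℓ) -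
        sys.acceptProb choice torBroken S R ℓ (τ ℓ) (E ℓ) (C ℓ)|

/-- The receiver `R` awaits the conversation messages of `S`, the message `c` included, and all
cover messages of `S`; and after any moment at which `S` may send, `R` comes online before the
pigeonhole deletes the message. -/
def AwaitsBoth (S R : Fin sys.n) {ℓ : ℕ} (E : Activity sys.n (sys.ae.msgLen ℓ))
    (c : HiddenSend sys.n (sys.ae.msgLen ℓ)) : Prop :=
  (∀ a ∈ (E.addCall c).calls, a.sender = S → a.receiver = R → E.awaits a.recvKey a.sendKey) ∧
  (∀ s k, E.awaits (.medium R) (.cover S s k)) ∧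
  (∀ t, E.Online S t → ∃ t', t ≤ t' ∧ t' ≤ t + sys.lifetime ∧ E.Online R t')

end System

end Pigeonhole

end

/-! Fix delays, which are almost surely nonnegative. The moments at which `S` sends to `R` depend
only on the sessions and the delays, and each of them produces exactly one message, queued or dummy
(`emptyQueue_times`). A further call therefore leaves the number and the times of all messages
unchanged and alters only the keys and contents of messages from `S` to `R`
(`forall₂_events_addCall`). It can shift counters, but only among messages from `S` to `R`; as `R`
awaits both sorts of messages and comes online in time, no retrieval time changes
(`retrievalTime_congr`). What remains to be hidden are the addresses and ciphertexts of these
messages.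

Call a message special if it goes between `S` and `R`, in either direction, the Diffie-Hellman key
being symmetric. Its address and its encryption key are values of the hash function at points that
contain `g ^ (a * b)`, where the adversary sees `g ^ a` and `g ^ b` but neither exponent. An
adversary who queries such a point would recognise Diffie-Hellman triples, because a query contains
a random third component with probability at most of order size over `p` (`Ex_hits_le`). Without
such a query the run does not change when the hash values of special messages are replaced by fresh
bits (`abs_ind_sub_le_hits`). Then every special message has a key of its own that is used for one
encryption, and a hybrid argument replaces the contents by the dummy message one after the other
(`hybrid_step`). The resulting probability `idealProb` ignores the keys, counters and contents of
special messages, so it is the same number in both scenarios (`idealProb_eventGame_congr`). The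
errors do not depend on the delays, so they survive the integration over them.

The reductions are non-uniform: all randomness except the challenge is fixed. The hash function is
sampled lazily (`Ex_oracleExec`), so that its answers become hard-wired bits and the distinguisher
becomes a straight-line program in the bits of the challenge (`Reach`), which is then turned into
gates (`Reach.realize`). Since the distinguisher varies with the delays and the fixed randomness,
one negligible bound is needed for all circuits of a given polynomial size at once
(`exists_negligible_bound`). Finally, a circuit reads boundedly many bits, so only finitely many
events, keys, coins and hash values matter, and the measures become finite averages
(`transcript_take`, `toReal_measure_eq_Ex`). -/

noncomputable section

namespace Pigeonhole

/-! ### Straight-line programs on Boolean functions -/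

section StraightLine

variable {α : Type}

/-- From the functions in `A`, constants and at most `k` negated conjunctions in all yield every
function in `B`. -/
inductive Reach : Set (α → Bool) → ℕ → Set (α → Bool) → Prop
  | done {A B : Set (α → Bool)} {k : ℕ} : B ⊆ A → Reach A k B
  | const {A B : Set (α → Bool)} {k : ℕ} (b : Bool) :
      Reach (insert (fun _ => b) A) k B → Reach A (k + 1) B
  | nand {A B : Set (α → Bool)} {k : ℕ} {f g : α → Bool} : f ∈ A → g ∈ A →
      Reach (insert (fun a => !(f a && g a)) A) k B → Reach A (k + 1) B

namespace Reach

variable {A A' B B' D : Set (α → Bool)} {k k' : ℕ}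

theorem mono_left (h : Reach A k B) (hA : A ⊆ A') : Reach A' k B := by
  induction h generalizing A' with
  | done hB => exact .done (hB.trans hA)
  | const b _ ih => exact .const b (ih (Set.insert_subset_insert hA))
  | nand hf hg _ ih => exact .nand (hA hf) (hA hg) (ih (Set.insert_subset_insert hA))

theorem mono_cost (h : Reach A k B) (hk : k ≤ k') : Reach A k' B := by
  induction h generalizing k' with
  | done hB => exact .done hB
  | const b _ ih =>
    obtain ⟨j, rfl⟩ : ∃ j, k' = j + 1 := ⟨k' - 1, by omega⟩
    exact .const b (ih (by omega))
  | nand hf hg _ ih =>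
    obtain ⟨j, rfl⟩ : ∃ j, k' = j + 1 := ⟨k' - 1, by omega⟩
    exact .nand hf hg (ih (by omega))

theorem mono_right (h : Reach A k B) (hB : B' ⊆ B) : Reach A k B' := by
  induction h with
  | done h' => exact .done (hB.trans h')
  | const b _ ih => exact .const b (ih hB)
  | nand hf hg _ ih => exact .nand hf hg (ih hB)

/-- A program never discards what it has computed, so its inputs are still available at the end at
no cost. This is what allows programs to be chained and run side by side. -/
theorem with_base (h : Reach A k B) : Reach A k (A ∪ B) := by
  induction h with
  | done h' => exact .done (Set.union_subset subset_rfl h')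
  | const b _ ih =>
    exact .const b (ih.mono_right (Set.union_subset_union_left _ (Set.subset_insert _ _)))
  | nand hf hg _ ih =>
    exact .nand hf hg (ih.mono_right (Set.union_subset_union_left _ (Set.subset_insert _ _)))

theorem trans (h : Reach A k B) (h' : Reach (A ∪ B) k' D) : Reach A (k + k') D := by
  induction h with
  | done hB =>
    exact (h'.mono_left (Set.union_subset subset_rfl hB)).mono_cost (Nat.le_add_left _ _)
  | @const A B k b _ ih =>
    rw [Nat.add_right_comm]
    exact .const b (ih (h'.mono_left (Set.union_subset_union_left _ (Set.subset_insert _ _))))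
  | @nand A B k _ _ hf hg _ ih =>
    rw [Nat.add_right_comm]
    exact .nand hf hg
      (ih (h'.mono_left (Set.union_subset_union_left _ (Set.subset_insert _ _))))

theorem union (h : Reach A k B) (h' : Reach A k' D) : Reach A (k + k') (B ∪ D) :=
  h.trans (((h'.mono_left Set.subset_union_left).with_base).mono_right
    (Set.union_subset_union_left _ Set.subset_union_right))

theorem list {ι : Type*} (l : List ι) (S : ι → Set (α → Bool))
    (h : ∀ i ∈ l, Reach A k (S i)) : Reach A (l.length * k) {f | ∃ i ∈ l, f ∈ S i} := by
  induction l with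
  | nil => exact .done (by simp)
  | cons i l ih =>
    have h1 := (h i (by simp)).union (ih fun j hj => h j (by simp [hj]))
    refine (h1.mono_cost (by simp [Nat.succ_mul, Nat.add_comm])).mono_right ?_
    rintro f ⟨j, hj, hf⟩
    rcases List.mem_cons.1 hj with rfl | hj
    · exact Or.inl hf
    · exact Or.inr ⟨j, hj, hf⟩

theorem const_fn (b : Bool) : Reach A 1 {fun _ => b} :=
  .const b (.done (by simp))

theorem of_mem {f : α → Bool} (h : f ∈ A) : Reach A k {f} := .done (by simpa using h)

variable {f g : α → Bool}

theorem nand_fn (hf : Reach A k {f}) (hg : Reach A k' {g}) :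
    Reach A (k + k' + 1) {fun a => !(f a && g a)} :=
  (hf.union hg).trans (.nand (f := f) (g := g) (by simp) (by simp) (.done (by simp)))

theorem not_fn (hf : Reach A k {f}) : Reach A (k + 1) {fun a => !(f a)} := by
  have := hf.trans (k' := 1) (.nand (f := f) (g := f) (by simp) (by simp) (.done subset_rfl))
  refine this.mono_right ?_
  simp

theorem and_fn (hf : Reach A k {f}) (hg : Reach A k' {g}) :
    Reach A (k + k' + 2) {fun a => f a && g a} := by
  simpa using (hf.nand_fn hg).not_fn

theorem or_fn (hf : Reach A k {f}) (hg : Reach A k' {g}) :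
    Reach A (k + k' + 3) {fun a => f a || g a} := by
  have := hf.not_fn.nand_fn hg.not_fn
  simp only [Bool.not_and, Bool.not_not] at this
  exact this.mono_cost (by omega)

theorem beq_fn (hf : f ∈ A) (hg : g ∈ A) : Reach A 9 {fun a => f a == g a} := by
  have h1 := (of_mem (k := 0) hf).and_fn (of_mem (k := 0) hg)
  have h2 := (of_mem (k := 0) hf).not_fn.and_fn (of_mem (k := 0) hg).not_fn
  have := (h1.or_fn h2).mono_cost (k' := 9) (by omega)
  convert this using 3 with a
  cases f a <;> cases g a <;> rfl

theorem ite_fn {c : α → Bool} {j : ℕ} (hc : Reach A j {c}) (hf : Reach A k {f})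
    (hg : Reach A k' {g}) :
    Reach A (2 * j + k + k' + 4) {fun a => if c a then f a else g a} := by
  -- The multiplexer made of NANDs; the condition is built twice, whence the factor 2 in front of
  -- `j`.
  have := ((hc.nand_fn hf).nand_fn (hc.not_fn.nand_fn hg)).mono_cost
    (k' := 2 * j + k + k' + 4) (by omega)
  convert this using 3 with a
  cases c a <;> cases f a <;> cases g a <;> rfl

end Reach

/-- The values of a list of functions. -/
def evalAll (fs : List (α → Bool)) (a : α) : List Bool := fs.map fun f => f a

@[simp] theorem evalAll_nil (a : α) : evalAll [] a = [] := rfl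

@[simp] theorem evalAll_cons (f : α → Bool) (fs : List (α → Bool)) (a : α) :
    evalAll (f :: fs) a = f a :: evalAll fs a := rfl

@[simp] theorem evalAll_append (fs gs : List (α → Bool)) (a : α) :
    evalAll (fs ++ gs) a = evalAll fs a ++ evalAll gs a := by simp [evalAll]

@[simp] theorem length_evalAll (fs : List (α → Bool)) (a : α) :
    (evalAll fs a).length = fs.length := by simp [evalAll]

theorem getD_evalAll (fs : List (α → Bool)) (a : α) (i : ℕ) :
    (evalAll fs a).getD i false = fs.getD i (fun _ => false) a := by
  simp only [evalAll, List.getD_eq_getElem?_getD, List.getElem?_map]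
  cases fs[i]? <;> rfl

theorem getD_mem_of_forall_mem {A : Set (α → Bool)} {fs : List (α → Bool)}
    (h : ∀ f ∈ fs, f ∈ A) (h0 : (fun _ => false) ∈ A) (i : ℕ) :
    fs.getD i (fun _ => false) ∈ A := by
  rw [List.getD_eq_getElem?_getD]
  cases hi : fs[i]? with
  | none => exact h0
  | some f => exact h f (List.mem_of_getElem? hi)

theorem reach_eq {A : Set (α → Bool)} : ∀ fs gs : List (α → Bool), (∀ f ∈ fs, f ∈ A) →
    (∀ f ∈ gs, f ∈ A) →
    Reach A (11 * fs.length + 1) {fun a => decide (evalAll fs a = evalAll gs a)}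
  | [], [], _, _ => by simpa using Reach.const_fn true
  | [], _ :: _, _, _ => by simpa using Reach.const_fn false
  | _ :: _, [], _, _ => by
      simpa using (Reach.const_fn (A := A) false).mono_cost (by omega)
  | f :: fs, g :: gs, hf, hg => by
      have h1 := Reach.beq_fn (hf f (by simp)) (hg g (by simp))
      have h2 := reach_eq fs gs (fun f' h => hf f' (by simp [h])) (fun f' h => hg f' (by simp [h]))
      refine ((h1.and_fn h2).mono_cost ?_).mono_right ?_
      · simp only [List.length_cons]; omega
      · rw [Set.singleton_subset_iff, Set.mem_singleton_iff]
        funext a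
        simp [Bool.decide_and, Bool.beq_eq_decide_eq]

theorem reach_any {A : Set (α → Bool)} {k : ℕ} (fs : List (α → Bool))
    (h : ∀ f ∈ fs, Reach A k {f}) :
    Reach A (fs.length * (k + 3) + 1) {fun a => (evalAll fs a).any id} := by
  induction fs with
  | nil => simpa using Reach.const_fn false
  | cons f fs ih =>
    have := (h f (by simp)).or_fn (ih fun g hg => h g (by simp [hg]))
    refine (this.mono_cost ?_).mono_right (by simp)
    simp only [List.length_cons]; ring_nf; omega

/-! ### Tables and lazily sampled oracles -/

/-- The first entry for `q` in an association list. -/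
def tableLookup {I β : Type} [DecidableEq I] : List (I × β) → I → Option β
  | [], _ => none
  | (i, b) :: T, q => if i = q then some b else tableLookup T q

theorem tableLookup_append {I β : Type} [DecidableEq I] (T T' : List (I × β)) (q : I) :
    tableLookup (T ++ T') q = (tableLookup T q).or (tableLookup T' q) := by
  induction T with
  | nil => rfl
  | cons e T ih =>
    obtain ⟨i, b⟩ := e
    by_cases h : i = q <;> simp [tableLookup, h, ih]

variable {ℓ : ℕ}

/-- Execution of gates when the `ℓ`-bit oracle answers are looked up in a table, and are taken from
`r` for new queries. -/
def lazyExec (r : ℕ → Bits ℓ) : List Gate → List Bool → List (List Bool × Bits ℓ) →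
    List Bool × List (List Bool × Bits ℓ)
  | [], w, T => (w, T)
  | .const b :: gs, w, T => lazyExec r gs (w ++ [b]) T
  | .nand i j :: gs, w, T => lazyExec r gs (w ++ [!(w.getD i false && w.getD j false)]) T
  | .oracle args out :: gs, w, T =>
      let q := args.map fun i => w.getD i false
      let v := (tableLookup T q).getD (r gs.length)
      -- The number of remaining gates names an answer that was not used before. A repeated query is
      -- recorded too: the first entry wins in a lookup, so the new one has no effect on answers,
      -- and the table doubles as the list of all queries.
      lazyExec r gs (w ++ List.ofFn (toBits out (List.ofFn v))) (T ++ [(q, r gs.length)])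

/-- The values of a table of functions. -/
def evalTable (T : List (List (α → Bool) × Bits ℓ)) (a : α) : List (List Bool × Bits ℓ) :=
  T.map fun e => (evalAll e.1 a, e.2)

/-- The stored answers are constants and only the stored queries depend on `a`, so a lookup is a
chain of case distinctions. Each one costs `22 * q.length + 7`: the comparison of cost `11 *
q.length + 1` twice, a constant, and the four extra gates of the multiplexer. -/
theorem reach_tableLookup {A : Set (α → Bool)} (q : List (α → Bool)) (hq : ∀ f ∈ q, f ∈ A)
    (v : Bits ℓ) (j : ℕ) (T : List (List (α → Bool) × Bits ℓ))
    (hT : ∀ e ∈ T, ∀ f ∈ e.1, f ∈ A) :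
    Reach A (T.length * (22 * q.length + 7) + 1)
      {fun a => (List.ofFn ((tableLookup (evalTable T a) (evalAll q a)).getD v)).getD j false} := by
  induction T with
  | nil => simpa [evalTable, tableLookup] using Reach.const_fn _
  | cons e T ih =>
    have h1 := reach_eq q e.1 hq (hT e (by simp))
    have h2 := ih fun e' h => hT e' (by simp [h])
    have := h1.ite_fn (Reach.const_fn ((List.ofFn e.2).getD j false)) h2
    refine (this.mono_cost ?_).mono_right ?_
    · simp only [List.length_cons]; ring_nf; omega
    · rw [Set.singleton_subset_iff, Set.mem_singleton_iff]
      funext a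
      simp only [evalTable, List.map_cons, tableLookup, decide_eq_true_eq]
      by_cases h : evalAll e.1 a = evalAll q a
      · simp [h]
      · simp [h, Ne.symm h]

theorem evalAll_getD_map (ws : List (α → Bool)) (args : List ℕ) (a : α) :
    evalAll (args.map fun i => ws.getD i fun _ => false) a =
      args.map fun i => (evalAll ws a).getD i false := by
  simp only [evalAll, List.map_map]
  refine List.map_congr_left fun i _ => ?_
  exact (getD_evalAll ws a i).symm

theorem ofFn_toBits (n : ℕ) (l : List Bool) :
    List.ofFn (toBits n l) = (List.range n).map fun i => l.getD i false := by
  apply List.ext_getElem <;> simp [toBits]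

/-- Once the fresh answers `r` are fixed, an oracle gate is a table lookup for each of its at most
`s` output bits, in a table that never exceeds `K` entries. The final table is returned as functions
of `a` as well, since the reduction has to inspect the queries. -/
theorem reach_lazyExec (r : ℕ → Bits ℓ) (s K : ℕ) : ∀ (gs : List Gate) (A : Set (α → Bool))
    (ws : List (α → Bool)) (T : List (List (α → Bool) × Bits ℓ)), (fun _ => false) ∈ A →
    (∀ f ∈ ws, f ∈ A) → (∀ e ∈ T, ∀ f ∈ e.1, f ∈ A) → T.length + gs.length ≤ K →
    (∀ g ∈ gs, g.cost ≤ s) →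
    ∃ (ws' : List (α → Bool)) (T' : List (List (α → Bool) × Bits ℓ)),
      Reach A (gs.length * (s * (K * (22 * s + 7) + 1))) {f | f ∈ ws' ∨ ∃ e ∈ T', f ∈ e.1} ∧
      T'.length ≤ T.length + gs.length ∧
      ∀ a, lazyExec r gs (evalAll ws a) (evalTable T a) = (evalAll ws' a, evalTable T' a)
  | [], A, ws, T, h0, hw, hT, hK, hs => by
      refine ⟨ws, T, .done ?_, by simp, fun a => rfl⟩
      rintro f (hf | ⟨e, he, hf⟩)
      · exact hw f hf
      · exact hT e he f hf
  | .const b :: gs, A, ws, T, h0, hw, hT, hK, hs => by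
      obtain ⟨ws', T', h1, h2, h3⟩ := reach_lazyExec r s K gs (insert (fun _ => b) A)
        (ws ++ [fun _ => b]) T (by simp [h0]) (by simp only [List.mem_append]; aesop)
        (fun e he f hf => Or.inr (hT e he f hf))
        (by simp only [List.length_cons] at hK; omega) (fun g hg => hs g (by simp [hg]))
      refine ⟨ws', T', (Reach.const b h1).mono_cost ?_, by simp; omega, fun a => ?_⟩
      · have : 1 ≤ s := hs (.const b) (by simp)
        simp only [List.length_cons]
        nlinarith [Nat.zero_le (s * (K * (22 * s + 7)))]
      · rw [← h3]; simp [lazyExec]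
  | .nand i j :: gs, A, ws, T, h0, hw, hT, hK, hs => by
      have hi := getD_mem_of_forall_mem hw h0 i
      have hj := getD_mem_of_forall_mem hw h0 j
      set f := ws.getD i (fun _ => false)
      set g := ws.getD j (fun _ => false)
      obtain ⟨ws', T', h1, h2, h3⟩ := reach_lazyExec r s K gs
        (insert (fun a => !(f a && g a)) A)
        (ws ++ [fun a => !(f a && g a)]) T (by simp [h0]) (by simp only [List.mem_append]; aesop)
        (fun e he f hf => Or.inr (hT e he f hf))
        (by simp only [List.length_cons] at hK; omega) (fun g hg => hs g (by simp [hg]))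
      refine ⟨ws', T', (Reach.nand hi hj h1).mono_cost ?_, by simp; omega, fun a => ?_⟩
      · have : 1 ≤ s := hs (.nand i j) (by simp)
        simp only [List.length_cons]
        nlinarith [Nat.zero_le (s * (K * (22 * s + 7)))]
      · rw [← h3, lazyExec, getD_evalAll, getD_evalAll]; simp [f, g]
  | .oracle args out :: gs, A, ws, T, h0, hw, hT, hK, hs => by
      have hcost : 1 + args.length + out ≤ s := hs (.oracle args out) (by simp)
      simp only [List.length_cons] at hK
      set q := args.map fun i => ws.getD i (fun _ => false) with hqdef
      have hq : ∀ f ∈ q, f ∈ A := by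
        intro f hf
        obtain ⟨i, -, rfl⟩ := List.mem_map.1 hf
        exact getD_mem_of_forall_mem hw h0 i
      let ans : ℕ → α → Bool := fun j a =>
        (List.ofFn ((tableLookup (evalTable T a) (evalAll q a)).getD (r gs.length))).getD j false
      have hans := Reach.list (A := A) (List.range out) (fun j => {ans j})
        (fun j _ => reach_tableLookup q hq (r gs.length) j T hT)
      set B : Set (α → Bool) := {f | ∃ j ∈ List.range out, f ∈ ({ans j} : Set (α → Bool))}
      obtain ⟨ws', T', h1, h2, h3⟩ := reach_lazyExec r s K gs (A ∪ B)
        (ws ++ (List.range out).map ans) (T ++ [(q, r gs.length)]) (Or.inl h0)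
        (by
          intro f hf
          rcases List.mem_append.1 hf with hf | hf
          · exact Or.inl (hw f hf)
          · obtain ⟨j, hj, rfl⟩ := List.mem_map.1 hf
            exact Or.inr ⟨j, hj, rfl⟩)
        (by
          intro e he f hf
          rcases List.mem_append.1 he with he | he
          · exact Or.inl (hT e he f hf)
          · rw [List.mem_singleton.1 he] at hf
            exact Or.inl (hq f hf))
        (by simp only [List.length_append, List.length_singleton]; omega)
        (fun g hg => hs g (by simp [hg]))
      refine ⟨ws', T', (hans.trans h1).mono_cost ?_, ?_, fun a => ?_⟩
      · have hq' : q.length ≤ s := by simp only [q, List.length_map]; omega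
        have hT' : T.length ≤ K := by omega
        have : (List.range out).length * (T.length * (22 * q.length + 7) + 1) ≤
            s * (K * (22 * s + 7) + 1) := by
          rw [List.length_range]
          gcongr
          omega
        simp only [List.length_cons, Nat.add_mul, Nat.one_mul]
        omega
      · simp only [List.length_append, List.length_cons, List.length_nil] at h2 ⊢; omega
      · rw [← h3]
        simp only [lazyExec, ofFn_toBits, hqdef, evalAll_append, evalTable, List.map_append,
          List.map_cons, List.map_nil, evalAll_getD_map]
        congr 2
        rw [show evalAll ((List.range out).map ans) a = (List.range out).map fun j => ans j a by
          simp [evalAll]]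
        refine List.map_congr_left fun j _ => ?_
        simp only [ans, hqdef, evalAll_getD_map, evalTable]

/-- Every function that is constructed gets a wire whose index does not depend on `a`; this is why
the initial wires must have a common length `L`. No oracle gate occurs, so the same gates work with
every oracle and in the middle of any computation. -/
theorem Reach.realize {A B : Set (α → Bool)} {k : ℕ} (h : Reach A k B) :
    ∀ (w : α → List Bool) (L : ℕ), (∀ a, (w a).length = L) →
    (∀ f ∈ A, ∃ i < L, ∀ a, (w a).getD i false = f a) →
    ∃ (gs : List Gate) (w' : α → List Bool), (gs.map Gate.cost).sum ≤ k ∧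
      (∀ a O ans, gs.foldl (Gate.step O) ⟨w a, ans⟩ = ⟨w' a, ans⟩) ∧
      ∀ f ∈ B, ∃ i, ∀ a, (w' a).getD i false = f a := by
  have key : ∀ (A : Set (α → Bool)) (w : α → List Bool) (L : ℕ) (g : α → Bool),
      (∀ a, (w a).length = L) → (∀ f ∈ A, ∃ i < L, ∀ a, (w a).getD i false = f a) →
      ∀ f ∈ insert g A, ∃ i < L + 1, ∀ a, (w a ++ [g a]).getD i false = f a := by
    intro A w L g hL hA f hf
    rcases Set.mem_insert_iff.1 hf with rfl | hf
    · exact ⟨L, by omega, fun a => by simp [← hL a]⟩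
    · obtain ⟨i, hi, h⟩ := hA f hf
      refine ⟨i, by omega, fun a => ?_⟩
      rw [List.getD_append _ _ _ _ (by rw [hL]; exact hi), h]
  induction h with
  | done hB =>
    intro w L hL hA
    refine ⟨[], w, by simp, fun _ _ _ => rfl, fun f hf => ?_⟩
    obtain ⟨i, -, h⟩ := hA f (hB hf)
    exact ⟨i, h⟩
  | const b _ ih =>
    intro w L hL hA
    obtain ⟨gs, w', h1, h2, h3⟩ := ih (fun a => w a ++ [b]) (L + 1) (by simp [hL])
      (key _ w L (fun _ => b) hL hA)
    refine ⟨.const b :: gs, w', ?_, fun a O ans => ?_, h3⟩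
    · simp [Gate.cost]; omega
    · simpa [Gate.step] using h2 a O ans
  | @nand A B k f g hf hg _ ih =>
    intro w L hL hA
    obtain ⟨i, -, hi⟩ := hA f hf
    obtain ⟨j, -, hj⟩ := hA g hg
    obtain ⟨gs, w', h1, h2, h3⟩ := ih (fun a => w a ++ [!(f a && g a)]) (L + 1) (by simp [hL])
      (key _ w L _ hL hA)
    refine ⟨.nand i j :: gs, w', ?_, fun a O ans => ?_, h3⟩
    · simp [Gate.cost]; omega
    · rw [List.foldl_cons, ← h2 a O ans]
      simp only [Gate.step, RunState.wire, hi, hj]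

/-- The wires of a circuit before its gates are evaluated. -/
def Circuit.start (C : Circuit) (x : List Bool) (r : Bits C.coins) : List Bool :=
  List.ofFn (toBits C.inputs x) ++ List.ofFn r

theorem exists_start (C : Circuit) (r : Bits C.coins) (A : Set (α → Bool))
    (hA : ∀ b, (fun _ => b) ∈ A) (fs : List (α → Bool)) (hf : ∀ f ∈ fs, f ∈ A) :
    ∃ ws : List (α → Bool), (∀ f ∈ ws, f ∈ A) ∧ ∀ a, C.start (evalAll fs a) r = evalAll ws a := by
  refine ⟨(List.range C.inputs).map (fun i => fs.getD i fun _ => false) ++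
    (List.ofFn r).map (fun b _ => b), fun f h => ?_, fun a => ?_⟩
  · rcases List.mem_append.1 h with h | h
    · obtain ⟨i, -, rfl⟩ := List.mem_map.1 h
      exact getD_mem_of_forall_mem hf (hA false) i
    · obtain ⟨b, -, rfl⟩ := List.mem_map.1 h
      exact hA b
  · simp only [Circuit.start, evalAll_append, evalAll_getD_map, ofFn_toBits]
    simp [evalAll, Function.comp_def]

/-- Answers of `0` bits are empty, just like those of the absent oracle. Circuits without an oracle
are thus the case `ℓ = 0` of lazily sampled runs and need no separate analysis. -/
theorem foldl_noOracle_eq_lazyExec (r : ℕ → Bits 0) : ∀ (gs : List Gate) (w : List Bool)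
    (ans : List (List Bool)) (T : List (List Bool × Bits 0)),
    (gs.foldl (Gate.step noOracle) ⟨w, ans⟩).wires = (lazyExec r gs w T).1
  | [], w, ans, T => rfl
  | .const b :: gs, w, ans, T => by
      simpa [Gate.step, lazyExec] using foldl_noOracle_eq_lazyExec r gs (w ++ [b]) ans T
  | .nand i j :: gs, w, ans, T => by
      exact foldl_noOracle_eq_lazyExec r gs _ ans T
  | .oracle args out :: gs, w, ans, T => by
      have h : ∀ v : Bits 0, List.ofFn v = [] := fun v => by simp
      simpa [Gate.step, lazyExec, noOracle, h] using foldl_noOracle_eq_lazyExec r gs _ _ _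

/-- The number of gates of which `reach_run` composes the evaluation of a circuit of size `s`. -/
def runCost (s : ℕ) : ℕ := s * (s * (s * (22 * s + 7) + 1))

theorem length_le_sum_cost (gs : List Gate) : gs.length ≤ (gs.map Gate.cost).sum := by
  induction gs with
  | nil => simp
  | cons g gs ih =>
    have : 1 ≤ g.cost := by cases g <;> simp [Gate.cost]; omega
    simp; omega

theorem Circuit.length_gates_le (C : Circuit) : C.gates.length ≤ C.size :=
  (length_le_sum_cost _).trans (by simp [Circuit.size])

theorem Circuit.cost_le_size (C : Circuit) {g : Gate} (hg : g ∈ C.gates) : g.cost ≤ C.size :=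
  (List.single_le_sum (by simp) _ (List.mem_map_of_mem hg)).trans (by simp [Circuit.size])

/-- This makes circuits given by hypothesis, such as the one for the group law, usable as
subroutines of a straight-line program. Their coins are fixed. -/
theorem reach_run (C : Circuit) {s : ℕ} (hs : C.size ≤ s) (r : Bits C.coins)
    {A : Set (α → Bool)} (hA : ∀ b, (fun _ => b) ∈ A)
    (fs : List (α → Bool)) (hf : ∀ f ∈ fs, f ∈ A) :
    ∃ outs : List (α → Bool), Reach A (runCost s) {f | f ∈ outs} ∧
      ∀ a, C.run noOracle (evalAll fs a) r = evalAll outs a := by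
  obtain ⟨ws, hws, hst⟩ := exists_start C r A hA fs hf
  obtain ⟨ws', T', h1, -, h3⟩ := reach_lazyExec (ℓ := 0) (fun _ => Fin.elim0) s s C.gates A ws []
    (hA false) hws (by simp) (by simpa using C.length_gates_le.trans hs)
    (fun g hg => (C.cost_le_size hg).trans hs)
  refine ⟨C.outputs.map (fun i => ws'.getD i fun _ => false), ?_, fun a => ?_⟩
  · have hle := C.length_gates_le.trans hs
    refine ((h1.with_base).mono_cost (k' := runCost s) ?_).mono_right ?_
    · unfold runCost; gcongr
    · intro f hf
      obtain ⟨i, -, rfl⟩ := List.mem_map.1 hf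
      rw [List.getD_eq_getElem?_getD]
      cases hi : ws'[i]? with
      | none => exact Or.inl (hA false)
      | some f => exact Or.inr (Or.inl (List.mem_of_getElem? hi))
  · rw [evalAll_getD_map, Circuit.run]
    refine List.map_congr_left fun i _ => ?_
    have := foldl_noOracle_eq_lazyExec (fun _ => Fin.elim0) C.gates (C.start (evalAll fs a) r) [] []
    rw [hst] at this
    have h4 := h3 a
    rw [show evalTable ([] : List (List (α → Bool) × Bits 0)) a = [] from rfl] at h4
    rw [h4] at this
    simp only at this
    rw [← this, ← hst]
    rfl

end StraightLine

/-! ### Averages over finitely many coordinates -/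

open scoped BigOperators
open Finset (expect)

section Averages

variable {I J β Ω : Type} [DecidableEq I] [DecidableEq J] [Fintype β] [Nonempty β]

/-- Extension of a partial assignment by an arbitrary value. -/
def extendBy (s : Finset I) (g : s → β) (i : I) : β :=
  if h : i ∈ s then g ⟨i, h⟩ else Classical.arbitrary β

/-- The average of `F` over independent uniform values of the coordinates in `s`. -/
def Ex (s : Finset I) (F : (I → β) → ℝ) : ℝ :=
  Finset.expect Finset.univ fun g : s → β => F (extendBy s g)

/-- The average over a finite type. -/
def avg {Ω : Type} [Fintype Ω] (F : Ω → ℝ) : ℝ := Finset.expect Finset.univ F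

/-- The indicator of a proposition. -/
def ind (p : Prop) : ℝ := open Classical in if p then 1 else 0

theorem ind_nonneg (p : Prop) : 0 ≤ ind p := by unfold ind; split_ifs <;> norm_num

theorem ind_le_one (p : Prop) : ind p ≤ 1 := by unfold ind; split_ifs <;> norm_num

theorem ind_true {p : Prop} (h : p) : ind p = 1 := by simp [ind, h]

theorem ind_false {p : Prop} (h : ¬p) : ind p = 0 := by simp [ind, h]

theorem ind_mono {p q : Prop} (h : p → q) : ind p ≤ ind q := by
  by_cases hp : p
  · rw [ind_true hp, ind_true (h hp)]
  · rw [ind_false hp]; exact ind_nonneg q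

theorem ind_exists_le_sum {ι : Type*} (s : Finset ι) (p : ι → Prop) :
    ind (∃ i ∈ s, p i) ≤ ∑ i ∈ s, ind (p i) := by
  by_cases h : ∃ i ∈ s, p i
  · obtain ⟨i, hi, hp⟩ := h
    calc ind (∃ i ∈ s, p i) ≤ 1 := ind_le_one _
      _ = ind (p i) := (ind_true hp).symm
      _ ≤ _ := Finset.single_le_sum (f := fun i => ind (p i)) (fun i _ => ind_nonneg _) hi
  · rw [ind_false h]
    exact Finset.sum_nonneg fun i _ => ind_nonneg _

/-! #### `avg` -/

section avg
variable [Fintype Ω]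

theorem avg_mono {F G : Ω → ℝ} (h : ∀ w, F w ≤ G w) : avg F ≤ avg G :=
  Finset.expect_le_expect fun w _ => h w

theorem avg_nonneg {F : Ω → ℝ} (h : ∀ w, 0 ≤ F w) : 0 ≤ avg F :=
  Finset.expect_nonneg fun w _ => h w

theorem avg_const [Nonempty Ω] (c : ℝ) : avg (fun _ : Ω => c) = c := Fintype.expect_const c

theorem avg_sub (F G : Ω → ℝ) : avg (fun w => F w - G w) = avg F - avg G :=
  Finset.expect_sub_distrib _ _ _

theorem avg_add (F G : Ω → ℝ) : avg (fun w => F w + G w) = avg F + avg G :=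
  Finset.expect_add_distrib _ _ _

theorem avg_sum {ι : Type} (s : Finset ι) (F : ι → Ω → ℝ) :
    avg (fun w => ∑ i ∈ s, F i w) = ∑ i ∈ s, avg (F i) :=
  Finset.expect_sum_comm _ _ _

theorem abs_avg_le (F : Ω → ℝ) : |avg F| ≤ avg fun w => |F w| := Finset.abs_expect_le _ _

theorem avg_comm {Ω' : Type} [Fintype Ω'] (F : Ω → Ω' → ℝ) :
    (avg fun w => avg fun v => F w v) = avg fun v => avg fun w => F w v :=
  Finset.expect_comm _ _ _

theorem avg_prod {Ω' : Type} [Fintype Ω'] (F : Ω × Ω' → ℝ) :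
    avg F = avg fun w => avg fun v => F (w, v) := by
  unfold avg
  rw [← Finset.univ_product_univ, Finset.expect_product]

theorem avg_le [Nonempty Ω] {F : Ω → ℝ} {c : ℝ} (h : ∀ w, F w ≤ c) : avg F ≤ c :=
  (avg_mono h).trans (avg_const c).le

theorem avg_equiv {Ω' : Type} [Fintype Ω'] (e : Ω ≃ Ω') (F : Ω' → ℝ) :
    avg (fun w => F (e w)) = avg F :=
  Fintype.expect_equiv e _ _ fun _ => rfl

theorem prob_eq_avg (p : Ω → Prop) : prob p = avg fun w => ind (p w) := by
  classical
  rw [prob, avg, Fintype.expect_eq_sum_div_card]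
  congr 1
  simp only [ind, Finset.sum_boole]
  rw [Nat.card_eq_fintype_card, Fintype.card_subtype]

theorem avg_ind_eq_le [Nonempty Ω] {X : Type} (f : Ω → X) (hf : Function.Injective f) (x : X) :
    avg (fun w => ind (f w = x)) ≤ 1 / Fintype.card Ω := by
  classical
  rw [avg, Fintype.expect_eq_sum_div_card]
  gcongr
  simp only [ind, Finset.sum_boole]
  norm_cast
  rw [Finset.card_le_one]
  intro a ha b hb
  exact hf ((Finset.mem_filter.1 ha).2.trans (Finset.mem_filter.1 hb).2.symm)

end avg

/-! #### `Ex` -/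

variable (s : Finset I)

theorem Ex_eq_avg (F : (I → β) → ℝ) : Ex s F = avg fun g : s → β => F (extendBy s g) := rfl

variable {s}

theorem Ex_mono {F G : (I → β) → ℝ} (h : ∀ w, F w ≤ G w) : Ex s F ≤ Ex s G :=
  avg_mono fun _ => h _

theorem Ex_congr {F G : (I → β) → ℝ} (h : ∀ w, F w = G w) : Ex s F = Ex s G := by
  rw [funext h]

theorem Ex_nonneg {F : (I → β) → ℝ} (h : ∀ w, 0 ≤ F w) : 0 ≤ Ex s F := avg_nonneg fun _ => h _

theorem Ex_const (c : ℝ) : Ex s (fun _ : I → β => c) = c := avg_const c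

theorem Ex_le {F : (I → β) → ℝ} {c : ℝ} (h : ∀ w, F w ≤ c) : Ex s F ≤ c :=
  (Ex_mono h).trans (Ex_const c).le

theorem Ex_sub (F G : (I → β) → ℝ) : Ex s (fun w => F w - G w) = Ex s F - Ex s G := avg_sub _ _

theorem Ex_add (F G : (I → β) → ℝ) : Ex s (fun w => F w + G w) = Ex s F + Ex s G := avg_add _ _

theorem Ex_sum {ι : Type} (t : Finset ι) (F : ι → (I → β) → ℝ) :
    Ex s (fun w => ∑ i ∈ t, F i w) = ∑ i ∈ t, Ex s (F i) := avg_sum _ _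

theorem abs_Ex_le (F : (I → β) → ℝ) : |Ex s F| ≤ Ex s fun w => |F w| := abs_avg_le _

theorem abs_Ex_sub_le {F G : (I → β) → ℝ} {H : (I → β) → ℝ} (h : ∀ w, |F w - G w| ≤ H w) :
    |Ex s F - Ex s G| ≤ Ex s H := by
  rw [← Ex_sub]
  exact (abs_Ex_le _).trans (Ex_mono h)

theorem Ex_comm {γ : Type} [Fintype γ] [Nonempty γ] {t : Finset J}
    (F : (I → β) → (J → γ) → ℝ) :
    (Ex s fun w => Ex t fun v => F w v) = Ex t fun v => Ex s fun w => F w v := avg_comm _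

theorem Ex_avg_comm [Fintype Ω] (F : (I → β) → Ω → ℝ) :
    (Ex s fun w => avg fun v => F w v) = avg fun v => Ex s fun w => F w v := avg_comm _

/-- Exchanging the coordinate `i` with an independent value is an involution of `(S → β) × β`, so it
preserves the uniform distribution. -/
theorem avg_resample {S : Type} [Fintype S] [DecidableEq S] (i : S) (F : (S → β) → ℝ) :
    (avg fun g => avg fun b => F (Function.update g i b)) = avg F := by
  let e : (S → β) × β ≃ (S → β) × β :=
    { toFun := fun x => (Function.update x.1 i x.2, x.1 i)
      invFun := fun x => (Function.update x.1 i x.2, x.1 i)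
      left_inv := fun x => by simp
      right_inv := fun x => by simp }
  have h := avg_equiv e fun x => F x.1
  rw [avg_prod, avg_prod] at h
  simpa [e, avg_const] using h

omit [Fintype β] in
theorem update_extendBy {i : I} (hi : i ∈ s) (g : s → β) (b : β) :
    Function.update (extendBy s g) i b = extendBy s (Function.update g ⟨i, hi⟩ b) := by
  funext j
  by_cases hj : j = i
  · subst hj; simp [extendBy, hi]
  · by_cases hs : j ∈ s <;> simp [extendBy, hj, hs, Function.update, Subtype.ext_iff]

theorem Ex_resample {i : I} (hi : i ∈ s) (F : (I → β) → ℝ) :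
    (Ex s fun w => avg fun b => F (Function.update w i b)) = Ex s F := by
  simp only [Ex_eq_avg, update_extendBy hi]
  exact avg_resample (⟨i, hi⟩ : s) fun g => F (extendBy s g)

/-! ### Random oracles -/

/-- The function `H`, overwritten by a table. -/
def overwrite (T : List (I × β)) (H : I → β) (i : I) : β := (tableLookup T i).getD (H i)

theorem overwrite_cons (i : I) (b : β) (T : List (I × β)) (H : I → β) :
    overwrite ((i, b) :: T) H = Function.update (overwrite T H) i b := by
  funext j
  by_cases h : i = j
  · subst h; simp [overwrite, tableLookup]
  · simp [overwrite, tableLookup, h, Function.update_of_ne (Ne.symm h)]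

/-- Fresh values at the entries of a table do not change the distribution of a uniform function. -/
theorem Ex_overwrite {s : Finset I} {t : Finset J} (pt : J → I) (L : List J) (hL : L.Nodup)
    (ht : ∀ j ∈ L, j ∈ t) (hs : ∀ j ∈ L, pt j ∈ s) (F : (I → β) → ℝ) :
    (Ex t fun Y => Ex s fun H => F (overwrite (L.map fun j => (pt j, Y j)) H)) = Ex s F := by
  induction L generalizing F with
  | nil =>
    have : ∀ H : I → β, overwrite [] H = H := fun H => rfl
    simp only [List.map_nil, this, Ex_const]
  | cons j L ih =>
    rw [List.nodup_cons] at hL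
    have hcong : ∀ (Y : J → β) (b : β), (L.map fun k => (pt k, Function.update Y j b k)) =
        L.map fun k => (pt k, Y k) := fun Y b => List.map_congr_left fun k hk => by
      rw [Function.update_of_ne (by rintro rfl; exact hL.1 hk)]
    rw [← Ex_resample (ht j (by simp))]
    simp only [List.map_cons, overwrite_cons, hcong, Function.update_self]
    -- The induction hypothesis is applied to `F` averaged over a fresh value at `pt j`. The points
    -- need not be distinct: it is enough that the indices are, as this makes the values
    -- independent.
    have := ih hL.2 (fun k hk => ht k (by simp [hk])) (fun k hk => hs k (by simp [hk]))
      (fun H => avg fun b => F (Function.update H (pt j) b))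
    rw [Ex_resample (hs j (by simp))] at this
    rw [← this]
    exact Ex_congr fun Y => (Ex_avg_comm _).symm

variable {ℓ : ℕ}

/-- Execution of gates with oracle `h`. The second component lists all queries. -/
def oracleExec (h : List Bool → Bits ℓ) : List Gate → List Bool → List (List Bool) →
    List Bool × List (List Bool)
  | [], w, Q => (w, Q)
  | .const b :: gs, w, Q => oracleExec h gs (w ++ [b]) Q
  | .nand i j :: gs, w, Q => oracleExec h gs (w ++ [!(w.getD i false && w.getD j false)]) Q
  | .oracle args out :: gs, w, Q =>
      let q := args.map fun i => w.getD i false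
      oracleExec h gs (w ++ List.ofFn (toBits out (List.ofFn (h q)))) (Q ++ [q])

theorem foldl_eq_oracleExec (h : List Bool → Bits ℓ) : ∀ (gs : List Gate) (w : List Bool)
    (ans : List (List Bool)) (Q : List (List Bool)),
    (gs.foldl (Gate.step fun _ q => List.ofFn (h q)) ⟨w, ans⟩).wires = (oracleExec h gs w Q).1
  | [], _, _, _ => rfl
  | .const _ :: gs, _, ans, Q => foldl_eq_oracleExec h gs _ ans Q
  | .nand _ _ :: gs, _, ans, Q => foldl_eq_oracleExec h gs _ ans Q
  | .oracle _ _ :: gs, _, _, _ => foldl_eq_oracleExec h gs _ _ _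

theorem oracleExec_queries (h : List Bool → Bits ℓ) : ∀ (gs : List Gate) (w : List Bool)
    (Q : List (List Bool)),
    oracleExec h gs w Q = ((oracleExec h gs w []).1, Q ++ (oracleExec h gs w []).2)
  | [], w, Q => by simp [oracleExec]
  | .const _ :: gs, _, Q => by rw [oracleExec, oracleExec, oracleExec_queries h gs]
  | .nand _ _ :: gs, _, Q => by rw [oracleExec, oracleExec, oracleExec_queries h gs]
  | .oracle args _ :: gs, w, Q => by
      rw [oracleExec, oracleExec]
      rw [oracleExec_queries h gs _ (Q ++ _), oracleExec_queries h gs _ ([] ++ _)]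
      simp

/-- Executions are the same if the oracles agree on all queries of one of them. -/
theorem oracleExec_congr (h h' : List Bool → Bits ℓ) : ∀ (gs : List Gate) (w : List Bool)
    (Q : List (List Bool)), (∀ q ∈ (oracleExec h gs w Q).2, h' q = h q) →
    oracleExec h' gs w Q = oracleExec h gs w Q
  | [], w, Q, _ => rfl
  | .const _ :: gs, _, Q, hq => oracleExec_congr h h' gs _ Q hq
  | .nand _ _ :: gs, _, Q, hq => oracleExec_congr h h' gs _ Q hq
  | .oracle args out :: gs, w, Q, hq => by
      have h1 := oracleExec_congr h h' gs _ _ hq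
      have h2 : h' (args.map fun i => w.getD i false) = h (args.map fun i => w.getD i false) := by
        apply hq
        rw [oracleExec, oracleExec_queries]
        simp
      rw [oracleExec, oracleExec, ← h1, h2]

/-- A list of gates takes only fresh answers with an index below its length. Hence the answer used
by the current gate is independent of the rest of the run. -/
theorem lazyExec_update (n : ℕ) (y : Bits ℓ) (r : ℕ → Bits ℓ) : ∀ (gs : List Gate)
    (w : List Bool) (T : List (List Bool × Bits ℓ)), gs.length ≤ n →
    lazyExec (Function.update r n y) gs w T = lazyExec r gs w T
  | [], _, _, _ => rfl
  | .const _ :: gs, _, T, h =>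
      lazyExec_update n y r gs _ T (by simp at h; omega)
  | .nand _ _ :: gs, _, T, h =>
      lazyExec_update n y r gs _ T (by simp at h; omega)
  | .oracle args out :: gs, w, T, h => by
      have hn : gs.length < n := by simp at h; omega
      simp only [lazyExec]
      rw [Function.update_of_ne hn.ne, lazyExec_update n y r gs _ _ hn.le]

/-- Lazy sampling of a random oracle. -/
theorem Ex_oracleExec {s : Finset (List Bool)} {t : Finset ℕ}
    (F : List Bool → List (List Bool) → ℝ) :
    ∀ (gs : List Gate) (w : List Bool) (T : List (List Bool × Bits ℓ)),
    (∀ q : List Bool, (∃ args out, Gate.oracle args out ∈ gs ∧ q.length = args.length) → q ∈ s) →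
    (∀ i < gs.length, i ∈ t) →
    (Ex s fun H => F (oracleExec (overwrite T H) gs w (T.map Prod.fst)).1
      (oracleExec (overwrite T H) gs w (T.map Prod.fst)).2) =
    Ex t fun r => F (lazyExec r gs w T).1 ((lazyExec r gs w T).2.map Prod.fst)
  | [], w, T, _, _ => by simp only [oracleExec, lazyExec, Ex_const]
  | .const _ :: gs, _, T, hs, ht =>
      Ex_oracleExec F gs _ T (fun q ⟨a, o, h1, h2⟩ => hs q ⟨a, o, by simp [h1], h2⟩)
        (fun i hi => ht i (by simp; omega))
  | .nand _ _ :: gs, _, T, hs, ht =>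
      Ex_oracleExec F gs _ T (fun q ⟨a, o, h1, h2⟩ => hs q ⟨a, o, by simp [h1], h2⟩)
        (fun i hi => ht i (by simp; omega))
  | .oracle args out :: gs, w, T, hs, ht => by
      set q := args.map fun i => w.getD i false with hq
      have ih : ∀ (w : List Bool) (y : Bits ℓ), _ := fun w y =>
        Ex_oracleExec (s := s) (t := t) F gs w (T ++ [(q, y)])
          (fun q ⟨a, o, h1, h2⟩ => hs q ⟨a, o, by simp [h1], h2⟩)
          (fun i hi => ht i (by simp; omega))
      -- The one step of lazy sampling. For a repeated query the answer comes from the table and a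
      -- second entry is inert; for a new query the value `H q` may be resampled, which amounts to
      -- entering it into the table.
      have key : ∀ G : (List Bool → Bits ℓ) → Bits ℓ → ℝ,
          (Ex s fun H => G (overwrite T H) (overwrite T H q)) = avg fun y => Ex s fun H =>
            G (overwrite (T ++ [(q, y)]) H) ((tableLookup T q).getD y) := by
        intro G
        cases hT : tableLookup T q with
        | some v =>
          have h : ∀ H y, overwrite (T ++ [(q, y)]) H = overwrite T H := by
            intro H y
            funext p
            rw [overwrite, overwrite, tableLookup_append]
            by_cases hp : q = p
            · subst hp; simp [hT]
            · simp [tableLookup, hp]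
          simp only [h, Option.getD_some, avg_const]
          exact Ex_congr fun H => by rw [overwrite.eq_1 T H q, hT]; rfl
        | none =>
          have h : ∀ (H : List Bool → Bits ℓ) y, overwrite (T ++ [(q, y)]) H =
              overwrite T (Function.update H q y) := by
            intro H y
            funext p
            rw [overwrite, overwrite, tableLookup_append]
            by_cases hp : q = p
            · subst hp; simp [hT, tableLookup]
            · simp [tableLookup, hp, Function.update_of_ne (Ne.symm hp)]
          rw [← Ex_avg_comm, ← Ex_resample (hs q ⟨args, out, by simp, by simp [hq]⟩)]
          refine Ex_congr fun H => ?_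
          simp only [h]
          congr 1
          funext y
          rw [overwrite.eq_1 T _ q, hT]
          simp
      have hl := key fun h v =>
        F (oracleExec h gs (w ++ List.ofFn (toBits out (List.ofFn v))) (T.map Prod.fst ++ [q])).1
          (oracleExec h gs (w ++ List.ofFn (toBits out (List.ofFn v))) (T.map Prod.fst ++ [q])).2
      simp only [oracleExec, lazyExec, ← hq]
      rw [hl, ← Ex_resample (ht gs.length (by simp))]
      simp only [Function.update_self, lazyExec_update _ _ _ _ _ _ le_rfl]
      rw [Ex_avg_comm]
      congr 1
      funext y
      rw [← ih]
      simp

end Averages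

/-! ### Uniform measures -/

section UniformMeasure

theorem uniform_singleton {A : Type} [Fintype A] [Nonempty A] [MeasurableSpace A]
    [MeasurableSingletonClass A] (a : A) : uniform A {a} = (Fintype.card A : ENNReal)⁻¹ := by
  rw [uniform, PMF.toMeasure_apply_singleton _ _ (measurableSet_singleton a),
    PMF.uniformOfFintype_apply]

theorem eq_uniform {A : Type} [Fintype A] [Nonempty A] [MeasurableSpace A]
    [MeasurableSingletonClass A] {μ : Measure A}
    (h : ∀ a, μ {a} = (Fintype.card A : ENNReal)⁻¹) : μ = uniform A :=
  Measure.ext_of_singleton fun a => by rw [h, uniform_singleton]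

theorem uniform_prod (A B : Type) [Fintype A] [Nonempty A] [MeasurableSpace A]
    [MeasurableSingletonClass A] [Fintype B] [Nonempty B] [MeasurableSpace B]
    [MeasurableSingletonClass B] : (uniform A).prod (uniform B) = uniform (A × B) := by
  refine eq_uniform fun x => ?_
  obtain ⟨a, b⟩ := x
  rw [← Set.singleton_prod_singleton, Measure.prod_prod, uniform_singleton, uniform_singleton,
    Fintype.card_prod, Nat.cast_mul, ENNReal.mul_inv (by simp) (by simp)]

theorem pi_uniform (ι B : Type) [Fintype ι] [DecidableEq ι] [Fintype B] [Nonempty B]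
    [MeasurableSpace B] [MeasurableSingletonClass B] :
    Measure.pi (fun _ : ι => uniform B) = uniform (ι → B) := by
  refine eq_uniform fun x => ?_
  rw [Measure.pi_singleton]
  simp [uniform_singleton, ENNReal.inv_pow]

theorem uniform_real_eq_avg {A : Type} [Fintype A] [Nonempty A] [MeasurableSpace A]
    [MeasurableSingletonClass A] (p : A → Prop) :
    (uniform A {a | p a}).toReal = avg fun a => ind (p a) := by
  classical
  rw [uniform, PMF.toMeasure_uniformOfFintype_apply _ (Set.toFinite _).measurableSet,
    ← prob_eq_avg, prob]
  simp [Fintype.card_subtype]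

theorem map_restrict_uniform {I B : Type} [DecidableEq I] [Fintype B] [Nonempty B]
    [MeasurableSpace B] [MeasurableSingletonClass B] (s : Finset I) :
    (Measure.infinitePi fun _ : I => uniform B).map s.restrict = uniform (s → B) := by
  rw [Measure.infinitePi_map_restrict, pi_uniform]

end UniformMeasure

/-! ### Polynomial bounds and negligible functions -/

/-- At most a polynomial. -/
def PolyBounded (f : ℕ → ℕ) : Prop := ∃ P : Polynomial ℕ, ∀ ℓ, f ℓ ≤ P.eval ℓ

namespace PolyBounded

variable {f g : ℕ → ℕ}

theorem const (c : ℕ) : PolyBounded fun _ => c := ⟨Polynomial.C c, fun _ => by simp⟩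

theorem mono (hg : PolyBounded g) (h : ∀ ℓ, f ℓ ≤ g ℓ) : PolyBounded f :=
  hg.imp fun _ hP ℓ => (h ℓ).trans (hP ℓ)

theorem add (hf : PolyBounded f) (hg : PolyBounded g) : PolyBounded fun ℓ => f ℓ + g ℓ := by
  obtain ⟨P, hP⟩ := hf
  obtain ⟨Q, hQ⟩ := hg
  exact ⟨P + Q, fun ℓ => by simpa using Nat.add_le_add (hP ℓ) (hQ ℓ)⟩

theorem mul (hf : PolyBounded f) (hg : PolyBounded g) : PolyBounded fun ℓ => f ℓ * g ℓ := by
  obtain ⟨P, hP⟩ := hf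
  obtain ⟨Q, hQ⟩ := hg
  exact ⟨P * Q, fun ℓ => by simpa using Nat.mul_le_mul (hP ℓ) (hQ ℓ)⟩

theorem runCost (hf : PolyBounded f) : PolyBounded fun ℓ => Pigeonhole.runCost (f ℓ) :=
  hf.mul (hf.mul ((hf.mul (((const 22).mul hf).add (const 7))).add (const 1)))

theorem size {C : ℕ → Circuit} (hC : PolySize C) : PolyBounded fun ℓ => (C ℓ).size := hC

end PolyBounded

namespace Negligible

variable {f g : ℕ → ℝ}

theorem mono (hg : Negligible g) (h : ∀ ℓ, |f ℓ| ≤ g ℓ) : Negligible f :=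
  Asymptotics.SuperpolynomialDecay.trans_abs_le hg fun ℓ => (h ℓ).trans (le_abs_self _)

theorem add (hf : Negligible f) (hg : Negligible g) : Negligible fun ℓ => f ℓ + g ℓ :=
  Asymptotics.SuperpolynomialDecay.add hf hg

theorem const_mul (hf : Negligible f) (c : ℝ) : Negligible fun ℓ => c * f ℓ :=
  Asymptotics.SuperpolynomialDecay.const_mul hf c

theorem poly_mul (hf : Negligible f) {b : ℕ → ℕ} (hb : PolyBounded b) :
    Negligible fun ℓ => b ℓ * f ℓ := by
  obtain ⟨P, hP⟩ := hb
  refine Asymptotics.SuperpolynomialDecay.trans_abs_le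
    (Asymptotics.SuperpolynomialDecay.polynomial_mul hf (P.map (Nat.castRingHom ℝ))) fun ℓ => ?_
  rw [abs_mul, abs_mul]
  refine mul_le_mul_of_nonneg_right ?_ (abs_nonneg _)
  have : ((b ℓ : ℕ) : ℝ) ≤ (P.eval ℓ : ℕ) := by exact_mod_cast hP ℓ
  rw [Nat.abs_cast]
  refine this.trans (le_trans (le_of_eq ?_) (le_abs_self _))
  simp [Polynomial.eval_natCast_map]

end Negligible

/-- If every polynomial-size family has a negligible advantage, then the advantages of all circuits
up to a polynomial size have a common negligible bound. -/
theorem exists_negligible_bound (adv : Circuit → ℕ → ℝ) (h0 : ∀ C ℓ, 0 ≤ adv C ℓ)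
    (h1 : ∀ C ℓ, adv C ℓ ≤ 1)
    (h : ∀ C : ℕ → Circuit, PolySize C → Negligible fun ℓ => adv (C ℓ) ℓ)
    {b : ℕ → ℕ} (hb : PolyBounded b) :
    ∃ ε : ℕ → ℝ, Negligible ε ∧ ∀ ℓ (C : Circuit), C.size ≤ b ℓ → adv C ℓ ≤ ε ℓ := by
  let S : ℕ → Set ℝ := fun ℓ => {x | ∃ C : Circuit, C.size ≤ b ℓ ∧ adv C ℓ = x}
  have hbdd : ∀ ℓ, BddAbove (S ℓ) := fun ℓ => ⟨1, by rintro _ ⟨C, -, rfl⟩; exact h1 C ℓ⟩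
  have hle : ∀ ℓ (C : Circuit), C.size ≤ b ℓ → adv C ℓ ≤ sSup (S ℓ) := fun ℓ C hC =>
    le_csSup (hbdd ℓ) ⟨C, hC, rfl⟩
  have hne : ∀ ℓ, (S ℓ).Nonempty := fun ℓ => ⟨_, ⟨0, 0, [], []⟩, by simp [Circuit.size], rfl⟩
  -- The supremum need not be attained, but some circuit comes within a factor of two. One such
  -- circuit for every `ℓ` is a polynomial-size family, by non-uniformity.
  have hex : ∀ ℓ, ∃ C : Circuit, C.size ≤ b ℓ ∧ sSup (S ℓ) ≤ 2 * adv C ℓ := by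
    intro ℓ
    by_cases hs : sSup (S ℓ) ≤ 0
    · obtain ⟨x, C, hC, -⟩ := hne ℓ
      exact ⟨C, hC, by linarith [h0 C ℓ]⟩
    · obtain ⟨_, ⟨C, hC, rfl⟩, hlt⟩ := exists_lt_of_lt_csSup (hne ℓ)
        (show sSup (S ℓ) / 2 < sSup (S ℓ) by linarith)
      exact ⟨C, hC, by linarith⟩
  choose C hC hsup using hex
  obtain ⟨P, hP⟩ := hb
  refine ⟨fun ℓ => sSup (S ℓ), ((h C ⟨P, fun ℓ => (hC ℓ).trans (hP ℓ)⟩).const_mul 2).mono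
    fun ℓ => ?_, hle⟩
  rw [abs_of_nonneg ((h0 _ ℓ).trans (hle ℓ _ (hC ℓ)))]
  exact hsup ℓ

theorem prob_nonneg {Ω : Type} [Fintype Ω] (E : Ω → Prop) : 0 ≤ prob E := by
  rw [prob_eq_avg]; exact avg_nonneg fun _ => ind_nonneg _

theorem prob_le_one {Ω : Type} [Fintype Ω] [Nonempty Ω] (E : Ω → Prop) : prob E ≤ 1 := by
  rw [prob_eq_avg]; exact avg_le fun _ => ind_le_one _

theorem abs_sub_le_one {x y : ℝ} (hx : 0 ≤ x) (hx' : x ≤ 1) (hy : 0 ≤ y) (hy' : y ≤ 1) :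
    |x - y| ≤ 1 := by rw [abs_le]; constructor <;> linarith

/-- A circuit that accepts if and only if wire `i` carries a one. -/
theorem accepts_singleton (C : Circuit) (i : ℕ) (hC : C.outputs = [i]) (O : Oracle)
    (x : List Bool) (r : Bits C.coins) :
    C.Accepts O x r ↔ (C.exec O x r).wires.getD i false = true := by
  simp [Circuit.Accepts, Circuit.run, hC, RunState.wire]

/-! ### Diffie-Hellman -/

namespace GroupFamily

variable (𝔾 : GroupFamily) {ℓ : ℕ}

theorem orderOf_gen (ℓ : ℕ) : orderOf (𝔾.gen ℓ) = 𝔾.p ℓ := by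
  rw [orderOf_eq_card_of_forall_mem_zpowers (𝔾.generates ℓ), 𝔾.card_eq]

theorem gen_pow_eq_iff (a b : ℕ) :
    𝔾.gen ℓ ^ a = 𝔾.gen ℓ ^ b ↔ a ≡ b [MOD 𝔾.p ℓ] := by
  rw [pow_eq_pow_iff_modEq, orderOf_gen]

theorem gen_pow_injective :
    Function.Injective fun a : Fin (𝔾.p ℓ) => 𝔾.gen ℓ ^ (a : ℕ) := by
  intro a b h
  have := (𝔾.gen_pow_eq_iff _ _).1 h
  exact Fin.ext (by rwa [Nat.ModEq, Nat.mod_eq_of_lt a.2, Nat.mod_eq_of_lt b.2] at this)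

theorem code_injective : Function.Injective (𝔾.code ℓ) := fun _ _ h =>
  𝔾.encode_injective ℓ (List.ofFn_injective h)

@[simp] theorem length_code (x : 𝔾.G ℓ) : (𝔾.code ℓ x).length = 𝔾.len ℓ := by simp [code]

/-- Private keys thus have at most `len ℓ` binary digits, which bounds the cost of exponentiation.
-/
theorem p_le_two_pow (ℓ : ℕ) : 𝔾.p ℓ ≤ 2 ^ 𝔾.len ℓ := by
  rw [← 𝔾.card_eq]
  calc Nat.card (𝔾.G ℓ) ≤ Nat.card (Bits (𝔾.len ℓ)) :=
        Nat.card_le_card_of_injective _ (𝔾.encode_injective ℓ)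
    _ = _ := by simp

/-- The circuit for the group law has to write down an encoded element, and its size counts the bits
written. -/
theorem polyBounded_len (h : 𝔾.Efficient) : PolyBounded 𝔾.len := by
  obtain ⟨C, hC, hmul⟩ := h
  refine (PolyBounded.size hC).mono fun ℓ => ?_
  have := congrArg List.length (hmul ℓ 1 1 fun _ => false)
  rw [length_code, Circuit.run, List.length_map] at this
  rw [← this, Circuit.size]
  omega

variable {α : Type}

/-- The bits of the encoding of a group element that depends on `α`. -/
def bits (X : α → 𝔾.G ℓ) : List (α → Bool) := List.ofFn fun i a => 𝔾.encode ℓ (X a) i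

@[simp] theorem evalAll_bits (X : α → 𝔾.G ℓ) (a : α) :
    evalAll (𝔾.bits X) a = 𝔾.code ℓ (X a) := by
  simp [evalAll, bits, code, List.map_ofFn, Function.comp_def]

@[simp] theorem length_bits (X : α → 𝔾.G ℓ) : (𝔾.bits X).length = 𝔾.len ℓ := by simp [bits]

theorem evalAll_injective [Nonempty α] {fs gs : List (α → Bool)}
    (h : ∀ a, evalAll fs a = evalAll gs a) : fs = gs := by
  refine List.ext_getElem ?_ fun i h1 h2 => ?_
  · simpa using congrArg List.length (h (Classical.arbitrary α))
  · funext a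
    have := congrArg (fun l => l.getD i false) (h a)
    simp only [getD_evalAll] at this
    rwa [List.getD_eq_getElem _ _ h1, List.getD_eq_getElem _ _ h2] at this

theorem bits_const_mem {A : Set (α → Bool)} (hA : ∀ b, (fun _ => b) ∈ A) (x : 𝔾.G ℓ) :
    ∀ f ∈ 𝔾.bits (fun _ : α => x), f ∈ A := by
  intro f hf
  obtain ⟨i, rfl⟩ := (List.mem_ofFn' _ _).1 hf
  exact hA _

/-- A circuit of size at most `s` that multiplies. -/
def MulCircuit (ℓ s : ℕ) : Prop :=
  ∃ C : Circuit, C.size ≤ s ∧ ∀ (x y : 𝔾.G ℓ) r,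
    C.run noOracle (𝔾.code ℓ x ++ 𝔾.code ℓ y) r = 𝔾.code ℓ (x * y)

variable [Nonempty α] {A : Set (α → Bool)} {s : ℕ}

theorem reach_mul (hM : 𝔾.MulCircuit ℓ s) (hA : ∀ b, (fun _ => b) ∈ A) (X Y : α → 𝔾.G ℓ)
    (hX : ∀ f ∈ 𝔾.bits X, f ∈ A) (hY : ∀ f ∈ 𝔾.bits Y, f ∈ A) :
    Reach A (runCost s) {f | f ∈ 𝔾.bits fun a => X a * Y a} := by
  obtain ⟨C, hs, hC⟩ := hM
  obtain ⟨outs, h1, h2⟩ := reach_run C hs (fun _ => false) hA (𝔾.bits X ++ 𝔾.bits Y)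
    (fun f hf => (List.mem_append.1 hf).elim (hX f) (hY f))
  have : outs = 𝔾.bits fun a => X a * Y a := evalAll_injective fun a => by
    rw [← h2, evalAll_append, evalAll_bits, evalAll_bits, evalAll_bits, hC]
  rwa [← this]

/-- Square and multiply. The exponent is a constant of the program, so no case distinction on its
digits is computed; each digit costs at most two multiplications. -/
theorem reach_pow (hM : 𝔾.MulCircuit ℓ s) (hA : ∀ b, (fun _ => b) ∈ A) (X : α → 𝔾.G ℓ)
    (hX : ∀ f ∈ 𝔾.bits X, f ∈ A) (n k : ℕ) (hk : k < 2 ^ n) :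
    Reach A (n * (2 * runCost s)) {f | f ∈ 𝔾.bits fun a => X a ^ k} := by
  induction n generalizing k with
  | zero =>
    obtain rfl : k = 0 := by simpa using hk
    simp only [pow_zero]
    exact .done fun f hf => 𝔾.bits_const_mem hA 1 f hf
  | succ n ih =>
    have h1 := ih (k / 2) (by rw [Nat.div_lt_iff_lt_mul two_pos]; rwa [pow_succ] at hk)
    set B : Set (α → Bool) := {f | f ∈ 𝔾.bits fun a => X a ^ (k / 2)}
    have h2 := 𝔾.reach_mul (A := A ∪ B) hM (fun b => Or.inl (hA b)) (fun a => X a ^ (k / 2))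
      (fun a => X a ^ (k / 2)) (fun f hf => Or.inr hf) (fun f hf => Or.inr hf)
    simp only [← pow_add] at h2
    rcases Nat.even_or_odd' k with ⟨m, rfl | rfl⟩
    · rw [show 2 * m / 2 = m by omega] at *
      rw [show m + m = 2 * m by omega] at h2
      exact (h1.trans h2).mono_cost (by ring_nf; omega)
    · rw [show (2 * m + 1) / 2 = m by omega] at *
      rw [show m + m = 2 * m by omega] at h2
      have h3 := 𝔾.reach_mul (A := (A ∪ B) ∪ {f | f ∈ 𝔾.bits fun a => X a ^ (2 * m)}) hM
        (fun b => Or.inl (Or.inl (hA b))) (fun a => X a ^ (2 * m)) X (fun f hf => Or.inr hf)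
        (fun f hf => Or.inl (Or.inl (hX f hf)))
      simp only [← pow_succ] at h3
      exact (h1.trans (h2.trans h3)).mono_cost (by ring_nf; omega)

/-- Triples of group elements. -/
abbrev Triple (ℓ : ℕ) : Type := 𝔾.G ℓ × 𝔾.G ℓ × 𝔾.G ℓ

/-- The bits of a triple of group elements. -/
def tripleBits (ℓ : ℕ) : List (𝔾.Triple ℓ → Bool) :=
  𝔾.bits (fun t => t.1) ++ 𝔾.bits (fun t => t.2.1) ++ 𝔾.bits (fun t => t.2.2)

/-- The circuit tosses no coins: whatever randomness the distinguisher has besides the triple is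
already fixed inside `acc`. -/
theorem exists_triple_circuit {k : ℕ} {acc : 𝔾.Triple ℓ → Bool}
    (h : Reach {f | f ∈ 𝔾.tripleBits ℓ} k {acc}) :
    ∃ C : Circuit, C.size ≤ 3 * 𝔾.len ℓ + 1 + k ∧ ∀ t r,
      C.Accepts noOracle (𝔾.code ℓ t.1 ++ 𝔾.code ℓ t.2.1 ++ 𝔾.code ℓ t.2.2) r ↔ acc t = true := by
  obtain ⟨gs, w', h1, h2, h3⟩ := h.realize (fun t => evalAll (𝔾.tripleBits ℓ) t) (3 * 𝔾.len ℓ)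
    (fun t => by simp [tripleBits]; ring) (fun f hf => by
      obtain ⟨i, hi, rfl⟩ := List.getElem_of_mem hf
      refine ⟨i, lt_of_lt_of_eq hi (by simp [tripleBits]; ring), fun a => ?_⟩
      rw [getD_evalAll, List.getD_eq_getElem _ _ hi])
  obtain ⟨i, hi⟩ := h3 acc rfl
  refine ⟨⟨3 * 𝔾.len ℓ, 0, gs, [i]⟩, by simp [Circuit.size]; omega, fun t r => ?_⟩
  rw [accepts_singleton _ i rfl, Circuit.exec, ← hi t]
  have hin : List.ofFn (toBits (3 * 𝔾.len ℓ)
      (𝔾.code ℓ t.1 ++ 𝔾.code ℓ t.2.1 ++ 𝔾.code ℓ t.2.2)) ++ List.ofFn r =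
      evalAll (𝔾.tripleBits ℓ) t := by
    rw [List.ofFn_zero, List.append_nil]
    apply List.ext_getElem
    · simp [tripleBits]; ring
    · intro j hj _
      simp only [tripleBits, evalAll_append, evalAll_bits, List.getElem_ofFn, toBits]
      rw [List.getD_eq_getElem]
  rw [hin, h2]

/-- The probability that `acc` holds for a Diffie-Hellman triple. -/
def avgReal (acc : 𝔾.Triple ℓ → Bool) : ℝ :=
  avg fun a : Fin (𝔾.p ℓ) => avg fun b : Fin (𝔾.p ℓ) =>
    ind (acc (𝔾.gen ℓ ^ (a : ℕ), 𝔾.gen ℓ ^ (b : ℕ), 𝔾.gen ℓ ^ ((a : ℕ) * (b : ℕ))) = true)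

/-- The probability that `acc` holds for a random triple. -/
def avgRandom (acc : 𝔾.Triple ℓ → Bool) : ℝ :=
  avg fun a : Fin (𝔾.p ℓ) => avg fun b : Fin (𝔾.p ℓ) => avg fun c : Fin (𝔾.p ℓ) =>
    ind (acc (𝔾.gen ℓ ^ (a : ℕ), 𝔾.gen ℓ ^ (b : ℕ), 𝔾.gen ℓ ^ (c : ℕ)) = true)

/-- The decisional Diffie-Hellman assumption for straight-line programs, uniformly. -/
theorem exists_ddh_bound (hddh : 𝔾.DDH) (hlen : PolyBounded 𝔾.len) {b : ℕ → ℕ}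
    (hb : PolyBounded b) : ∃ ε : ℕ → ℝ, Negligible ε ∧ ∀ ℓ (acc : 𝔾.Triple ℓ → Bool),
      Reach {f | f ∈ 𝔾.tripleBits ℓ} (b ℓ) {acc} → |𝔾.avgReal acc - 𝔾.avgRandom acc| ≤ ε ℓ := by
  obtain ⟨ε, hε, h⟩ := exists_negligible_bound (fun C ℓ => |𝔾.probReal C ℓ - 𝔾.probRandom C ℓ|)
    (fun _ _ => abs_nonneg _)
    (fun _ _ => abs_sub_le_one (prob_nonneg _) (prob_le_one _) (prob_nonneg _) (prob_le_one _))
    hddh (b := fun ℓ => 3 * 𝔾.len ℓ + 1 + b ℓ)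
    ((((PolyBounded.const 3).mul hlen).add (PolyBounded.const 1)).add hb)
  refine ⟨ε, hε, fun ℓ acc hacc => ?_⟩
  obtain ⟨C, hs, hC⟩ := 𝔾.exists_triple_circuit hacc
  have := h ℓ C hs
  rw [probReal, probRandom, prob_eq_avg, prob_eq_avg] at this
  simp only [avg_prod] at this
  have h1 := fun (a b c : Fin (𝔾.p ℓ)) r =>
    hC (𝔾.gen ℓ ^ (a : ℕ), 𝔾.gen ℓ ^ (b : ℕ), 𝔾.gen ℓ ^ (c : ℕ)) r
  have h2 := fun (a b : Fin (𝔾.p ℓ)) r =>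
    hC (𝔾.gen ℓ ^ (a : ℕ), 𝔾.gen ℓ ^ (b : ℕ), 𝔾.gen ℓ ^ ((a : ℕ) * (b : ℕ))) r
  simp only at h1 h2
  simp only [h1, h2, avg_const] at this
  exact this

theorem card_fin_p (ℓ : ℕ) : (Fintype.card (Fin (𝔾.p ℓ)) : ℝ) = 𝔾.p ℓ := by simp

/-- In a small group the assumption fails by itself. The test "first component trivial, third
component not" never accepts a Diffie-Hellman triple, but accepts a random triple with probability
`1 / p * (1 - 1 / p)`, which is at least `1 / (2 * p)`. -/
theorem negligible_inv_p (hddh : 𝔾.DDH) (hlen : PolyBounded 𝔾.len) :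
    Negligible fun ℓ => 1 / (𝔾.p ℓ : ℝ) := by
  obtain ⟨ε, hε, h⟩ := 𝔾.exists_ddh_bound hddh hlen (b := fun ℓ => 22 * 𝔾.len ℓ + 10)
    (((PolyBounded.const 22).mul hlen).add (PolyBounded.const 10))
  refine (hε.const_mul 2).mono fun ℓ => ?_
  let acc : 𝔾.Triple ℓ → Bool := fun t =>
    decide (𝔾.code ℓ t.1 = 𝔾.code ℓ 1) && !decide (𝔾.code ℓ t.2.2 = 𝔾.code ℓ 1)
  have hacc : Reach {f | f ∈ 𝔾.tripleBits ℓ} (22 * 𝔾.len ℓ + 10) {acc} := by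
    set A : Set (𝔾.Triple ℓ → Bool) := {f | f ∈ 𝔾.tripleBits ℓ}
    have hcs : Reach A (1 + 1) ({fun _ => true} ∪ {fun _ => false}) :=
      (Reach.const_fn true).union (Reach.const_fn false)
    set B := A ∪ ({fun _ => true} ∪ {fun _ => false})
    have hc : ∀ b, (fun _ => b) ∈ B := by rintro (_ | _) <;> simp [B]
    have h1 := reach_eq (A := B) (𝔾.bits fun t => t.1) (𝔾.bits fun _ => (1 : 𝔾.G ℓ))
      (fun f hf => Or.inl (by simp [A, tripleBits, hf])) (𝔾.bits_const_mem hc 1)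
    have h2 := reach_eq (A := B) (𝔾.bits fun t => t.2.2) (𝔾.bits fun _ => (1 : 𝔾.G ℓ))
      (fun f hf => Or.inl (by simp [A, tripleBits, hf])) (𝔾.bits_const_mem hc 1)
    have := hcs.trans (h1.and_fn h2.not_fn)
    simp only [evalAll_bits, length_bits] at this
    exact this.mono_cost (by omega)
  have hp : (1 : ℝ) < 𝔾.p ℓ := by exact_mod_cast (𝔾.prime ℓ).one_lt
  have hpos : (0 : ℝ) < 𝔾.p ℓ := by linarith
  have hone : ∀ a : Fin (𝔾.p ℓ), 𝔾.code ℓ (𝔾.gen ℓ ^ (a : ℕ)) = 𝔾.code ℓ 1 ↔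
      a = ⟨0, (𝔾.prime ℓ).pos⟩ := by
    intro a
    rw [𝔾.code_injective.eq_iff, ← 𝔾.gen_pow_injective.eq_iff]
    simp
  have hreal : 𝔾.avgReal acc = 0 := by
    rw [avgReal, ← avg_const (Ω := Fin (𝔾.p ℓ)) 0]
    congr 1; funext a
    rw [← avg_const (Ω := Fin (𝔾.p ℓ)) 0]
    congr 1; funext b
    refine ind_false ?_
    simp only [acc, Bool.and_eq_true, decide_eq_true_eq, hone, Bool.not_eq_true',
      decide_eq_false_iff_not, not_and, not_not]
    rintro rfl
    simp
  have hsingle : avg (fun a : Fin (𝔾.p ℓ) => ind (a = ⟨0, (𝔾.prime ℓ).pos⟩)) = 1 / 𝔾.p ℓ := by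
    have : ∑ a : Fin (𝔾.p ℓ), ind (a = ⟨0, (𝔾.prime ℓ).pos⟩) = 1 :=
      (Fintype.sum_eq_single _ fun a ha => ind_false ha).trans (ind_true rfl)
    rw [avg, Fintype.expect_eq_sum_div_card, this, card_fin_p]
  have hrand : 𝔾.avgRandom acc = 1 / 𝔾.p ℓ * (1 - 1 / 𝔾.p ℓ) := by
    have h1 : ∀ a b c : Fin (𝔾.p ℓ),
        ind (acc (𝔾.gen ℓ ^ (a : ℕ), 𝔾.gen ℓ ^ (b : ℕ), 𝔾.gen ℓ ^ (c : ℕ)) = true) =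
        ind (a = ⟨0, (𝔾.prime ℓ).pos⟩) - ind (a = ⟨0, (𝔾.prime ℓ).pos⟩) *
          ind (c = ⟨0, (𝔾.prime ℓ).pos⟩) := by
      intro a b c
      simp only [acc, Bool.and_eq_true, decide_eq_true_eq, hone, Bool.not_eq_true',
        decide_eq_false_iff_not]
      by_cases ha : a = ⟨0, (𝔾.prime ℓ).pos⟩ <;> by_cases hc : c = ⟨0, (𝔾.prime ℓ).pos⟩ <;>
        simp [ind, ha, hc]
    have h2 : ∀ a : Fin (𝔾.p ℓ), (avg fun c : Fin (𝔾.p ℓ) => ind (a = ⟨0, (𝔾.prime ℓ).pos⟩) -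
        ind (a = ⟨0, (𝔾.prime ℓ).pos⟩) * ind (c = ⟨0, (𝔾.prime ℓ).pos⟩)) =
        ind (a = ⟨0, (𝔾.prime ℓ).pos⟩) * (1 - 1 / 𝔾.p ℓ) := by
      intro a
      rw [avg_sub, avg_const, ← hsingle, avg, ← Finset.mul_expect, avg]
      ring
    rw [avgRandom]
    simp only [h1, h2, avg_const]
    rw [avg, ← Finset.expect_mul, ← avg, hsingle]
  have := h ℓ acc hacc
  rw [hreal, hrand, zero_sub, abs_neg] at this
  have hp2 : (2 : ℝ) ≤ 𝔾.p ℓ := by exact_mod_cast (𝔾.prime ℓ).two_le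
  have h3 : 1 / (𝔾.p ℓ : ℝ) ≤ 1 / 2 := by gcongr
  have h4 : 0 < 1 / (𝔾.p ℓ : ℝ) := by positivity
  rw [abs_of_pos h4]
  have h5 := (le_abs_self _).trans this
  nlinarith

end GroupFamily

/-! ### Indistinguishability of ciphertexts -/

namespace AEScheme

variable (ae : AEScheme) {ℓ : ℕ}

theorem polyBounded_ctLen (h : ae.Efficient) : PolyBounded ae.ctLen := by
  obtain ⟨⟨C, hC, henc⟩, -⟩ := h
  refine (PolyBounded.size hC).mono fun ℓ => ?_
  have := congrArg List.length
    (henc ℓ (fun _ => false) (fun _ => false) (fun _ => false) fun _ => false)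
  rw [List.length_ofFn, Circuit.run, List.length_map] at this
  rw [← this, Circuit.size]
  omega

/-- The circuit for decryption has to write out a whole message; correctness of the scheme supplies
a ciphertext on which it does. -/
theorem polyBounded_msgLen (h : ae.Efficient) : PolyBounded ae.msgLen := by
  obtain ⟨-, C, hC, hdec⟩ := h
  refine (PolyBounded.size hC).mono fun ℓ => ?_
  have := congrArg List.length
    (hdec ℓ (fun _ => false) (ae.enc ℓ (fun _ => false) (fun _ => false) fun _ => false)
      fun _ => false)
  rw [ae.correct, Circuit.run, List.length_map] at this
  simp only [List.length_cons, List.length_ofFn] at this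
  rw [Circuit.size]
  omega

/-- The bits of a ciphertext. -/
def ctBits (ℓ : ℕ) : List (Bits (ae.ctLen ℓ) → Bool) := List.ofFn fun i c => c i

/-- The probability that `acc` holds for an encryption of `m`. -/
def avgEnc (m : Bits (ae.msgLen ℓ)) (acc : Bits (ae.ctLen ℓ) → Bool) : ℝ :=
  avg fun k : Bits ℓ => avg fun ρ : Bits (ae.coinLen ℓ) => ind (acc (ae.enc ℓ k m ρ) = true)

theorem foldl_const (O : Oracle) (l w : List Bool) (ans : List (List Bool)) :
    (l.map Gate.const).foldl (Gate.step O) ⟨w, ans⟩ = ⟨w ++ l, ans⟩ := by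
  induction l generalizing w with
  | nil => simp
  | cons b l ih => simp [Gate.step, ih]

theorem avg_eval {S β : Type} [Fintype S] [DecidableEq S] [Fintype β] [Nonempty β] (i : S)
    (F : β → ℝ) : (avg fun g : S → β => F (g i)) = avg F := by
  rw [← avg_resample i fun g : S → β => F (g i)]
  simp [avg_const]

theorem toBits_ofFn {n : ℕ} (m : Bits n) : toBits n (List.ofFn m) = m := by
  funext i; simp [toBits]

/-- The two messages are hard-wired, the oracle is called once on their concatenation, and the gates
of `acc` run on the answer. A single call is enough because in the hybrid argument every key
encrypts one message only. -/
theorem exists_lr_circuit {k : ℕ} (m₀ m₁ : Bits (ae.msgLen ℓ))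
    {acc : Bits (ae.ctLen ℓ) → Bool} (h : Reach {f | f ∈ ae.ctBits ℓ} k {acc}) :
    ∃ C : Circuit, C.size ≤ 4 * ae.msgLen ℓ + ae.ctLen ℓ + 2 + k ∧
      ∀ b, ae.probLR b C ℓ = ae.avgEnc (if b then m₁ else m₀) acc := by
  set ms := List.ofFn m₀ ++ List.ofFn m₁ with hms
  have hlen : ms.length = 2 * ae.msgLen ℓ := by simp [hms]; ring
  obtain ⟨gs, w', h1, h2, h3⟩ := h.realize (fun c => ms ++ List.ofFn c)
    (2 * ae.msgLen ℓ + ae.ctLen ℓ) (fun c => by simp [hlen]) (fun f hf => by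
      obtain ⟨i, rfl⟩ := (List.mem_ofFn' _ _).1 hf
      refine ⟨2 * ae.msgLen ℓ + i, by omega, fun a => ?_⟩
      simp [← hlen])
  obtain ⟨i, hi⟩ := h3 acc rfl
  let C : Circuit := ⟨0, 0, ms.map Gate.const ++
    Gate.oracle (List.range (2 * ae.msgLen ℓ)) (ae.ctLen ℓ) :: gs, [i]⟩
  have hconst : ∀ l : List Bool, ((l.map Gate.const).map Gate.cost).sum = l.length := by
    intro l; induction l with
    | nil => rfl
    | cons b l ih => simp only [List.map_cons, List.sum_cons, ih, Gate.cost, List.length_cons]; ring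
  have hsize : C.size = 4 * ae.msgLen ℓ + ae.ctLen ℓ + 2 + (gs.map Gate.cost).sum := by
    simp only [C, Circuit.size, List.map_append, List.sum_append, hconst, hlen, List.map_cons,
      List.sum_cons, Gate.cost, List.length_range, List.length_singleton]
    ring
  refine ⟨C, by omega, fun b => ?_⟩
  -- The coins of the only oracle call are those with index `0`; the type of indices must be
  -- nonempty.
  have hpos : 0 < C.size := by omega
  have hacc : ∀ (κ : Bits ℓ) (ρ : Fin C.size → Bits (ae.coinLen ℓ)) r,
      C.Accepts (ae.lrOracle b ℓ κ ρ) [] r ↔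
        acc (ae.enc ℓ κ (if b then m₁ else m₀) (ρ ⟨0, hpos⟩)) = true := by
    intro κ ρ r
    rw [accepts_singleton _ i rfl, ← hi]
    have hq : (List.range (2 * ae.msgLen ℓ)).map (RunState.wire ⟨ms, []⟩) = ms := by
      apply List.ext_getElem
      · simp [hlen]
      · intro j hj hj'
        simp [RunState.wire, hj']
    have hbase : List.ofFn (toBits C.inputs []) ++ List.ofFn r = [] := by
      apply List.eq_nil_of_length_eq_zero; simp [C]
    have hans : ae.lrOracle b ℓ κ ρ 0 ms =
        List.ofFn (ae.enc ℓ κ (if b then m₁ else m₀) (ρ ⟨0, hpos⟩)) := by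
      rw [lrOracle, encOracle, dif_pos hpos]
      congr 2
      cases b
      · simp only [Bool.false_eq_true, if_false, hms]
        rw [List.take_left' (by simp), toBits_ofFn]
      · simp only [if_true, hms]
        rw [List.drop_left' (by simp), toBits_ofFn]
    rw [Circuit.exec, hbase]
    simp only [C, List.foldl_append, List.foldl_cons, foldl_const, List.nil_append, Gate.step, hq,
      List.length_nil]
    rw [hans, toBits_ofFn, h2]
  rw [probLR, prob_eq_avg, avgEnc]
  simp only [avg_prod, hacc, avg_const]
  congr 1
  funext κ
  exact avg_eval (⟨0, hpos⟩ : Fin C.size)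
    fun ρ => ind (acc (ae.enc ℓ κ (if b then m₁ else m₀) ρ) = true)

/-- Security against chosen-plaintext attacks for straight-line programs, uniformly. -/
theorem exists_cpa_bound (hcpa : ae.INDCPA) (hct : PolyBounded ae.ctLen)
    (hmsg : PolyBounded ae.msgLen) {b : ℕ → ℕ} (hb : PolyBounded b) :
    ∃ ε : ℕ → ℝ, Negligible ε ∧ ∀ ℓ (m₀ m₁ : Bits (ae.msgLen ℓ)) (acc : Bits (ae.ctLen ℓ) → Bool),
      Reach {f | f ∈ ae.ctBits ℓ} (b ℓ) {acc} → |ae.avgEnc m₁ acc - ae.avgEnc m₀ acc| ≤ ε ℓ := by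
  obtain ⟨ε, hε, h⟩ := exists_negligible_bound
    (fun C ℓ => |ae.probLR true C ℓ - ae.probLR false C ℓ|)
    (fun _ _ => abs_nonneg _)
    (fun _ _ => abs_sub_le_one (prob_nonneg _) (prob_le_one _) (prob_nonneg _) (prob_le_one _))
    hcpa (b := fun ℓ => 4 * ae.msgLen ℓ + ae.ctLen ℓ + 2 + b ℓ)
    (((((PolyBounded.const 4).mul hmsg).add hct).add (PolyBounded.const 2)).add hb)
  refine ⟨ε, hε, fun ℓ m₀ m₁ acc hacc => ?_⟩
  obtain ⟨C, hs, hC⟩ := ae.exists_lr_circuit m₀ m₁ hacc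
  simpa [hC] using h ℓ C hs

end AEScheme

/-! ### Bit strings assembled from given functions -/

section Assembled

variable {α : Type} {A : Set (α → Bool)}

/-- Every bit of the string `F a` is the value at `a` of a function in `A`. -/
def Assembled (A : Set (α → Bool)) (F : α → List Bool) : Prop :=
  ∃ fs : List (α → Bool), (∀ f ∈ fs, f ∈ A) ∧ ∀ a, F a = evalAll fs a

namespace Assembled

theorem append {F G : α → List Bool} (hF : Assembled A F) (hG : Assembled A G) :
    Assembled A fun a => F a ++ G a := by
  obtain ⟨fs, h1, h2⟩ := hF
  obtain ⟨gs, h3, h4⟩ := hG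
  refine ⟨fs ++ gs, fun f hf => (List.mem_append.1 hf).elim (h1 f) (h3 f), fun a => ?_⟩
  simp only [h2, h4, evalAll_append]

theorem const (hA : ∀ b, (fun _ => b) ∈ A) (l : List Bool) : Assembled A fun _ => l := by
  refine ⟨l.map fun b _ => b, fun f hf => ?_, fun a => by simp [evalAll, Function.comp_def]⟩
  obtain ⟨b, -, rfl⟩ := List.mem_map.1 hf
  exact hA b

theorem cons {F : α → List Bool} (hA : ∀ b, (fun _ => b) ∈ A) (b : Bool) (hF : Assembled A F) :
    Assembled A fun a => b :: F a := (const hA [b]).append hF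

theorem flatMap {ι : Type} (l : List ι) (F : ι → α → List Bool) (h : ∀ i, Assembled A (F i)) :
    Assembled A fun a => l.flatMap fun i => F i a := by
  induction l with
  | nil => exact ⟨[], by simp, fun _ => rfl⟩
  | cons i l ih => simpa using (h i).append ih

end Assembled

theorem GroupFamily.assembled_code (𝔾 : GroupFamily) {ℓ : ℕ} {X : α → 𝔾.G ℓ}
    (h : ∀ f ∈ 𝔾.bits X, f ∈ A) : Assembled A fun a => 𝔾.code ℓ (X a) :=
  ⟨𝔾.bits X, h, fun a => (𝔾.evalAll_bits X a).symm⟩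

theorem AEScheme.assembled_ct (ae : AEScheme) {ℓ : ℕ} {A : Set (Bits (ae.ctLen ℓ) → Bool)}
    (h : ∀ f ∈ ae.ctBits ℓ, f ∈ A) : Assembled A fun c => List.ofFn c :=
  ⟨ae.ctBits ℓ, h, fun a => by simp [evalAll, ctBits, List.map_ofFn, Function.comp_def]⟩

end Assembled

theorem binaryDigits_injective : Function.Injective Nat.bits := by
  intro a b h
  have : Nat.digits 2 a = Nat.digits 2 b := by rw [Nat.digits_two_eq_bits, Nat.digits_two_eq_bits, h]
  rw [← Nat.ofDigits_digits 2 a, this, Nat.ofDigits_digits]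

/-! ### Keys and points of the hash function -/

/-- The journalist who owns a key pair. -/
def KeyId.owner {n : ℕ} : KeyId n → Fin n
  | .medium j => j
  | .query j _ => j
  | .cover j _ _ => j

instance {n : ℕ} : DecidableEq (KeyId n) := Classical.decEq _

/-- The tags of addresses and of keys. -/
def tagBits (b : Bool) : List Bool := if b then addrTag else keyTag

theorem length_tagBits_le (b : Bool) : (tagBits b).length ≤ 32 := by
  cases b <;> simp [tagBits, addrTag, keyTag, natBits]

/-- The tags have different lengths, but their first characters already differ, so eight bits
decide. -/
theorem take_tagBits_injective {b b' : Bool} {l l' : List Bool}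
    (h : tagBits b ++ l = tagBits b' ++ l') : b = b' := by
  have key : ∀ b l, (tagBits b ++ l).take 8 = (tagBits b).take 8 := by
    intro b l
    rw [List.take_append_of_le_length]
    cases b <;> simp [tagBits, addrTag, keyTag, natBits]
  have h8 := congrArg (List.take 8) h
  rw [key, key] at h8
  cases b <;> cases b' <;> first | rfl | (exfalso; revert h8; decide)

namespace System

variable (sys : System) {ℓ : ℕ}

/-- The names of the key pairs of the journalists. -/
abbrev Key : Type := KeyId sys.n

/-- The input of the hash function for the tag `b`, the Diffie-Hellman key `k`, the public key `h`
and the counter `ns`. -/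
def hashInput (b : Bool) (k h : sys.grp.G ℓ) (ns : ℕ) : List Bool :=
  tagBits b ++ sys.grp.code ℓ k ++ sys.grp.code ℓ h ++ ns.bits

/-- The input can be parsed: the tag is recognised by its first bits, the two group elements have
encodings of a fixed length, and the counter, of variable length, comes last. -/
theorem hashInput_injective {b b' : Bool} {k k' h h' : sys.grp.G ℓ} {ns ns' : ℕ}
    (H : sys.hashInput b k h ns = sys.hashInput b' k' h' ns') :
    b = b' ∧ k = k' ∧ h = h' ∧ ns = ns' := by
  simp only [hashInput, List.append_assoc] at H
  obtain rfl := take_tagBits_injective H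
  have h1 := List.append_cancel_left H
  obtain ⟨h2, h3⟩ := List.append_inj h1 (by simp)
  obtain ⟨h4, h5⟩ := List.append_inj h3 (by simp)
  exact ⟨rfl, sys.grp.code_injective h2, sys.grp.code_injective h4, binaryDigits_injective h5⟩

/-- The part of a query that would be a Diffie-Hellman key. -/
def dhPart (ℓ : ℕ) (b : Bool) (q : List Bool) : List Bool :=
  (q.drop (tagBits b).length).take (sys.grp.len ℓ)

theorem dhPart_hashInput (b : Bool) (k h : sys.grp.G ℓ) (ns : ℕ) :
    sys.dhPart ℓ b (sys.hashInput b k h ns) = sys.grp.code ℓ k := by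
  simp only [dhPart, hashInput, List.append_assoc, List.drop_left]
  rw [List.take_left' (by simp)]

theorem length_hashInput_le (b : Bool) (k h : sys.grp.G ℓ) (ns : ℕ) :
    (sys.hashInput b k h ns).length ≤ 32 + 2 * sys.grp.len ℓ + ns := by
  have h1 := length_tagBits_le b
  have h2 : ns.bits.length ≤ ns := by
    rw [Nat.size_eq_bits_len, Nat.size_le]
    exact Nat.lt_two_pow_self
  simp only [hashInput, List.length_append, GroupFamily.length_code]
  omega

variable (ℓ) in
/-- Private keys. -/
abbrev Priv : Type := sys.Key → Fin (sys.grp.p ℓ)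

/-- The public key of `u`. -/
def pub (x : sys.Priv ℓ) (u : sys.Key) : sys.grp.G ℓ := sys.grp.gen ℓ ^ (x u : ℕ)

/-- The Diffie-Hellman key of `u` and `v`. -/
def shared (x : sys.Priv ℓ) (u v : sys.Key) : sys.grp.G ℓ := sys.pub x v ^ (x u : ℕ)

/-- What is known about the key pair `u` when its public key is `h`. -/
def keyInfo (S R : Fin sys.n) (h : sys.grp.G ℓ) (x : sys.Priv ℓ) (u : sys.Key) : List Bool :=
  sys.grp.code ℓ h ++
    if u.owner = S ∨ u.owner = R then [false] else true :: natBits (sys.grp.len ℓ) (x u)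

/-- The pair of keys belongs to `S` and `R`. -/
def Special (S R : Fin sys.n) (u v : sys.Key) : Prop :=
  (u.owner = S ∧ v.owner = R) ∨ (u.owner = R ∧ v.owner = S)

end System

/-! ### Games -/

/-- A view that shows information about keys and, for each of `m` messages, an address and a
ciphertext. The `i`-th message goes from `sk i` to `rk i` with counter `ns i`. -/
structure Game (sys : System) (ℓ : ℕ) where
  m : ℕ
  sk : ℕ → sys.Key
  rk : ℕ → sys.Key
  ns : ℕ → ℕ
  msg : ℕ → Bits (sys.ae.msgLen ℓ)
  view : (sys.Key → List Bool) → (ℕ → List Bool) → List Bool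

namespace Game

variable {sys : System} {ℓ : ℕ} (G : Game sys ℓ) (S R : Fin sys.n)

/-- The messages are different, and the view is put together from the bits of its ingredients. -/
structure Proper : Prop where
  ne : ∀ i < G.m, G.sk i ≠ G.rk i
  inj : ∀ i < G.m, ∀ j < G.m, G.sk i = G.sk j → G.rk i = G.rk j → G.ns i = G.ns j → i = j
  ns_le : ∀ i < G.m, G.ns i ≤ G.m
  assembled : ∀ {α : Type} (A : Set (α → Bool)), (∀ b, (fun _ => b) ∈ A) →
    ∀ (kb : α → sys.Key → List Bool) (ac : α → ℕ → List Bool),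
    (∀ u, Assembled A fun a => kb a u) → (∀ i, Assembled A fun a => ac a i) →
    Assembled A fun a => G.view (kb a) (ac a)

/-- Hash values of the messages: `(i, true)` for the address and `(i, false)` for the key of the
`i`-th message. -/
abbrev HashValues (ℓ : ℕ) : Type := ℕ × Bool → Bits ℓ

/-- Addresses and ciphertexts. -/
def posted (Y : HashValues ℓ) (ρ : ℕ → Bits (sys.ae.coinLen ℓ))
    (μ : ℕ → Bits (sys.ae.msgLen ℓ)) (i : ℕ) : List Bool :=
  if i < G.m then
    List.ofFn (Y (i, true)) ++ List.ofFn (sys.ae.enc ℓ (Y (i, false)) (μ i) (ρ i))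
  else []

/-- Information on all keys. -/
def keys (x : sys.Priv ℓ) (u : sys.Key) : List Bool := sys.keyInfo S R (sys.pub x u) x u

/-- The view for given hash values. -/
def input (x : sys.Priv ℓ) (Y : HashValues ℓ) (ρ : ℕ → Bits (sys.ae.coinLen ℓ))
    (μ : ℕ → Bits (sys.ae.msgLen ℓ)) : List Bool :=
  G.view (keys S R x) (G.posted Y ρ μ)

/-- The points at which the hash function is evaluated. -/
def point (x : sys.Priv ℓ) (j : ℕ × Bool) : List Bool :=
  sys.hashInput j.2 (sys.shared x (G.sk j.1) (G.rk j.1)) (sys.pub x (G.sk j.1)) (G.ns j.1)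

/-- The indices of all points. -/
def indices : List (ℕ × Bool) := List.range G.m ×ˢ [true, false]

theorem mem_indices {j : ℕ × Bool} : j ∈ G.indices ↔ j.1 < G.m := by
  obtain ⟨i, b⟩ := j
  simp [indices]

theorem nodup_indices : G.indices.Nodup := List.nodup_range.product (by decide)

theorem length_indices : G.indices.length = 2 * G.m := by
  simp [indices, List.length_product, mul_comm]

open Classical in
/-- The indices of the points that do not involve both `S` and `R`. -/
def ordinary : List (ℕ × Bool) :=
  G.indices.filter fun j => decide ¬sys.Special S R (G.sk j.1) (G.rk j.1)

theorem mem_ordinary {j : ℕ × Bool} :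
    j ∈ G.ordinary S R ↔ j.1 < G.m ∧ ¬sys.Special S R (G.sk j.1) (G.rk j.1) := by
  simp [ordinary, mem_indices]

theorem length_ordinary_le : (G.ordinary S R).length ≤ 2 * G.m :=
  (List.length_filter_le _ _).trans G.length_indices.le

/-- The table of the hash values at points with indices in `L`. -/
def table (x : sys.Priv ℓ) (Y : HashValues ℓ) (L : List (ℕ × Bool)) :
    List (List Bool × Bits ℓ) := L.map fun j => (G.point x j, Y j)

open Classical in
/-- Encrypt the dummy message instead of special messages with number less than `h`. -/
def hybridMsg (h i : ℕ) : Bits (sys.ae.msgLen ℓ) :=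
  if i < h ∧ sys.Special S R (G.sk i) (G.rk i) then pad (sys.dummy ℓ) else G.msg i

end Game

/-- The output, read off the wires, accepts. -/
def Circuit.AcceptsWires (C : Circuit) (w : List Bool) : Prop :=
  (C.outputs.map fun i => w.getD i false).head? = some true

/-! ### Runs of a circuit with a random oracle, sampled at once or lazily. -/

section Run

variable {ℓ : ℕ}

/-- A run of `C` with a random oracle: the wires, and all queries. -/
def Circuit.hashRun (C : Circuit) (r : Bits C.coins) (h : List Bool → Bits ℓ) (x : List Bool) :
    List Bool × List (List Bool) := oracleExec h C.gates (C.start x r) []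

/-- A run of `C` with a lazily sampled random oracle. -/
def Circuit.lazyRun (C : Circuit) (r : Bits C.coins) (y : ℕ → Bits ℓ)
    (T : List (List Bool × Bits ℓ)) (x : List Bool) : List Bool × List (List Bool) :=
  ((lazyExec y C.gates (C.start x r) T).1,
    ((lazyExec y C.gates (C.start x r) T).2.map Prod.fst).drop T.length)

theorem Circuit.accepts_iff (C : Circuit) (r : Bits C.coins) (h : List Bool → Bits ℓ)
    (x : List Bool) :
    C.Accepts (fun _ q => List.ofFn (h q)) x r ↔ C.AcceptsWires (C.hashRun r h x).1 := by
  rw [Circuit.Accepts, Circuit.run, Circuit.AcceptsWires, Circuit.hashRun,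
    ← foldl_eq_oracleExec h C.gates _ []]
  rfl

/-- Lazy sampling started from the prescribed table `T`. The prescribed points stand at the front of
the final table and are dropped in `lazyRun`, so that only queries made by the circuit itself are
listed. A query is no longer than the size of the circuit, hence the condition on `s`. -/
theorem Circuit.Ex_hashRun (C : Circuit) (r : Bits C.coins) (T : List (List Bool × Bits ℓ))
    (x : List Bool) (s : Finset (List Bool)) (hs : ∀ q : List Bool, q.length ≤ C.size → q ∈ s)
    (F : List Bool → List (List Bool) → ℝ) :
    (Ex s fun H => F (C.hashRun r (overwrite T H) x).1 (C.hashRun r (overwrite T H) x).2) =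
      Ex (Finset.range C.gates.length) fun y => F (C.lazyRun r y T x).1 (C.lazyRun r y T x).2 := by
  have := Ex_oracleExec (s := s) (t := Finset.range C.gates.length)
    (fun w Q => F w (Q.drop T.length)) C.gates (C.start x r) T
    (fun q ⟨args, out, h1, h2⟩ => hs q (by
      have := C.cost_le_size h1
      simp only [Gate.cost] at this
      omega)) (fun i hi => Finset.mem_range.2 hi)
  simp only [Circuit.hashRun, Circuit.lazyRun] at this ⊢
  rw [← this]
  refine Ex_congr fun H => ?_
  rw [oracleExec_queries _ _ _ (T.map Prod.fst)]
  simp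

theorem length_lazyExec_le (y : ℕ → Bits ℓ) : ∀ (gs : List Gate) (w : List Bool)
    (T : List (List Bool × Bits ℓ)), (lazyExec y gs w T).2.length ≤ T.length + gs.length
  | [], _, _ => by simp [lazyExec]
  | .const _ :: gs, _, T => (length_lazyExec_le y gs _ T).trans (by simp only [List.length_cons]; omega)
  | .nand _ _ :: gs, _, T => (length_lazyExec_le y gs _ T).trans (by simp only [List.length_cons]; omega)
  | .oracle _ _ :: gs, _, T => (length_lazyExec_le y gs _ _).trans (by simp; omega)

theorem Circuit.length_lazyRun_le (C : Circuit) (r : Bits C.coins) (y : ℕ → Bits ℓ)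
    (T : List (List Bool × Bits ℓ)) (x : List Bool) :
    (C.lazyRun r y T x).2.length ≤ C.size := by
  have h1 := length_lazyExec_le y C.gates (C.start x r) T
  have h2 := C.length_gates_le
  simp only [Circuit.lazyRun, List.length_drop, List.length_map]
  omega

/-- Lazily sampled runs are straight-line programs in the input and the table. -/
theorem Circuit.reach_lazyRun {α : Type} (C : Circuit) (r : Bits C.coins) (y : ℕ → Bits ℓ)
    {A : Set (α → Bool)} (hA : ∀ b, (fun _ => b) ∈ A) {x : α → List Bool} (hx : Assembled A x)
    {J : Type} (L : List J) (pt : α → J → List Bool) (Y : J → Bits ℓ)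
    (hpt : ∀ j ∈ L, Assembled A fun a => pt a j) {s : ℕ} (hs : C.size ≤ s) :
    ∃ (w : List (α → Bool)) (Q : List (List (α → Bool))),
      Reach A (s * (s * ((L.length + s) * (22 * s + 7) + 1))) {f | f ∈ w ∨ ∃ q ∈ Q, f ∈ q} ∧
      Q.length ≤ s ∧ ∀ a, C.lazyRun r y (L.map fun j => (pt a j, Y j)) (x a) =
        (evalAll w a, Q.map fun q => evalAll q a) := by
  obtain ⟨fs, h1, h2⟩ := hx
  obtain ⟨ws, h3, h4⟩ := exists_start C r A hA fs h1
  have hT : ∃ T : List (List (α → Bool) × Bits ℓ), (∀ e ∈ T, ∀ f ∈ e.1, f ∈ A) ∧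
      T.length = L.length ∧ ∀ a, evalTable T a = L.map fun j => (pt a j, Y j) := by
    induction L with
    | nil => exact ⟨[], by simp, rfl, fun a => rfl⟩
    | cons j L ih =>
      obtain ⟨T, hT1, hT2, hT3⟩ := ih fun k hk => hpt k (by simp [hk])
      obtain ⟨ps, hp1, hp2⟩ := hpt j (by simp)
      refine ⟨(ps, Y j) :: T, ?_, by simp [hT2], fun a => ?_⟩
      · intro e he f hf
        rcases List.mem_cons.1 he with rfl | he
        · exact hp1 f hf
        · exact hT1 e he f hf
      · have := hT3 a
        simp only [evalTable] at this
        simp only [evalTable, List.map_cons, this, hp2]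
  obtain ⟨T, hT1, hT2, hT3⟩ := hT
  have hg := C.length_gates_le.trans hs
  obtain ⟨w, T', h5, h6, h7⟩ := reach_lazyExec y s (L.length + s) C.gates A ws T (hA false) h3 hT1
    (by omega) (fun g hg => (C.cost_le_size hg).trans hs)
  refine ⟨w, (T'.map Prod.fst).drop L.length, (h5.mono_cost (by gcongr)).mono_right ?_, ?_,
    fun a => ?_⟩
  · rintro f (hf | ⟨q, hq, hf⟩)
    · exact Or.inl hf
    · obtain ⟨e, he, rfl⟩ := List.mem_map.1 (List.mem_of_mem_drop hq)
      exact Or.inr ⟨e, he, hf⟩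
  · simp only [List.length_drop, List.length_map]; omega
  · rw [Circuit.lazyRun, ← hT3, h2, h4, h7]
    simp [evalTable, hT2, List.map_drop, Function.comp_def]

end Run

namespace Game

variable {sys : System} {ℓ : ℕ} (G : Game sys ℓ) (S R : Fin sys.n)

/-! ### Replacing hash values by fresh ones -/

/-- The keys in use. -/
def usedKeys : Finset sys.Key :=
  open Classical in (Finset.range G.m).image G.sk ∪ (Finset.range G.m).image G.rk

theorem sk_mem_usedKeys {i : ℕ} (hi : i < G.m) : G.sk i ∈ G.usedKeys := by
  classical
  exact Finset.mem_union_left _ (Finset.mem_image_of_mem _ (Finset.mem_range.2 hi))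

theorem rk_mem_usedKeys {i : ℕ} (hi : i < G.m) : G.rk i ∈ G.usedKeys := by
  classical
  exact Finset.mem_union_right _ (Finset.mem_image_of_mem _ (Finset.mem_range.2 hi))

theorem card_usedKeys_le : G.usedKeys.card ≤ 2 * G.m := by
  classical
  refine (Finset.card_union_le _ _).trans ?_
  have h1 := Finset.card_image_le (s := Finset.range G.m) (f := G.sk)
  have h2 := Finset.card_image_le (s := Finset.range G.m) (f := G.rk)
  rw [Finset.card_range] at h1 h2
  omega

/-- The private keys in use are different and nonzero. -/
def Generic (x : sys.Priv ℓ) : Prop :=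
  ∀ u ∈ G.usedKeys, (x u : ℕ) ≠ 0 ∧ ∀ v ∈ G.usedKeys, u ≠ v → x u ≠ x v

theorem pub_injOn {x : sys.Priv ℓ} (hx : G.Generic x) {u v : sys.Key} (hu : u ∈ G.usedKeys)
    (hv : v ∈ G.usedKeys) (h : sys.pub x u = sys.pub x v) : u = v := by
  by_contra hne
  exact (hx u hu).2 v hv hne (sys.grp.gen_pow_injective h)

/-- Equal inputs have equal public keys of the sender, hence equal sender keys. The sender's
exponent is nonzero modulo the prime `p` and can be cancelled from the equality of Diffie-Hellman
keys, which gives equal receiver keys. Messages with the same two keys are told apart by their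
counters. -/
theorem point_injOn (hG : G.Proper) {x : sys.Priv ℓ} (hx : G.Generic x)
    {j k : ℕ × Bool} (hj : j.1 < G.m) (hk : k.1 < G.m) (h : G.point x j = G.point x k) :
    j = k := by
  obtain ⟨h1, h2, h3, h4⟩ := sys.hashInput_injective h
  have hs := G.pub_injOn hx (G.sk_mem_usedKeys hj) (G.sk_mem_usedKeys hk) h3
  refine Prod.ext (hG.inj _ hj _ hk hs ?_ h4) h1
  rw [← hs, System.shared, System.shared, System.pub, System.pub, ← pow_mul, ← pow_mul,
    sys.grp.gen_pow_eq_iff] at h2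
  refine G.pub_injOn hx (G.rk_mem_usedKeys hj) (G.rk_mem_usedKeys hk)
    ((sys.grp.gen_pow_eq_iff _ _).2 (Nat.ModEq.cancel_right_of_coprime ?_ h2))
  refine ((sys.grp.prime ℓ).coprime_iff_not_dvd.2 fun hd => ?_)
  exact absurd (Nat.le_of_dvd (Nat.pos_of_ne_zero (hx _ (G.sk_mem_usedKeys hj)).1) hd)
    (not_le.2 (x (G.sk j.1)).2)

theorem tableLookup_map_of_injOn {I J β : Type} [DecidableEq I] {pt : J → I} (Y : J → β)
    {L : List J} (h : ∀ j ∈ L, ∀ k ∈ L, pt j = pt k → j = k) {j : J} (hj : j ∈ L) :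
    tableLookup (L.map fun j => (pt j, Y j)) (pt j) = some (Y j) := by
  induction L with
  | nil => simp at hj
  | cons k L ih =>
    by_cases hk : pt k = pt j
    · obtain rfl := h k (by simp) j hj hk
      simp [tableLookup]
    · have hne : j ≠ k := fun e => hk (by rw [e])
      have hj' : j ∈ L := (List.mem_cons.1 hj).resolve_left hne
      simpa [tableLookup, hk] using
        ih (fun a ha b hb => h a (by simp [ha]) b (by simp [hb])) hj'

theorem tableLookup_map_filter {I J β : Type} [DecidableEq I] (pt : J → I) (Y : J → β)
    (L : List J) (P : J → Bool) (q : I) (h : ∀ j ∈ L, pt j = q → P j = true) :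
    tableLookup ((L.filter P).map fun j => (pt j, Y j)) q =
      tableLookup (L.map fun j => (pt j, Y j)) q := by
  induction L with
  | nil => rfl
  | cons k L ih =>
    have ih := ih fun j hj => h j (by simp [hj])
    by_cases hk : pt k = q
    · simp [h k (by simp) hk, tableLookup, hk]
    · by_cases hP : P k = true <;> simp [hP, tableLookup, hk, ih]

/-- The hash values of the messages are drawn first and then programmed into the oracle.
Distinctness of the points ensures that the oracle returns at each point the very value used in the
view. -/
theorem Ex_hash_resample (hG : G.Proper) {x : sys.Priv ℓ} (hx : G.Generic x) (C : Circuit)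
    (r : Bits C.coins) (ρ : ℕ → Bits (sys.ae.coinLen ℓ)) (μ : ℕ → Bits (sys.ae.msgLen ℓ))
    {s : Finset (List Bool)} (hs : ∀ j ∈ G.indices, G.point x j ∈ s) :
    (Ex s fun H => ind (C.AcceptsWires (C.hashRun r H
      (G.input S R x (fun j => H (G.point x j)) ρ μ)).1)) =
    Ex (Finset.range G.m ×ˢ Finset.univ) fun Y => Ex s fun H => ind (C.AcceptsWires
      (C.hashRun r (overwrite (G.table x Y G.indices) H) (G.input S R x Y ρ μ)).1) := by
  rw [← Ex_overwrite (t := Finset.range G.m ×ˢ Finset.univ) (G.point x) G.indices G.nodup_indices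
    (fun j hj => by simpa using G.mem_indices.1 hj) hs]
  refine Ex_congr fun Y => Ex_congr fun H => ?_
  have : ∀ j : ℕ × Bool, j.1 < G.m → overwrite (G.table x Y G.indices) H (G.point x j) = Y j := by
    intro j hj
    rw [overwrite, table, tableLookup_map_of_injOn Y (fun a ha b hb hab => G.point_injOn hG hx
      (G.mem_indices.1 ha) (G.mem_indices.1 hb) hab) (G.mem_indices.2 hj)]
    rfl
  have hp : G.posted (fun j => overwrite (G.table x Y G.indices) H (G.point x j)) ρ μ =
      G.posted Y ρ μ := by
    funext i
    unfold posted
    split_ifs with hi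
    · have h1 := this (i, true) hi
      have h2 := this (i, false) hi
      simp only [h1, h2]
    · rfl
  rw [input, input, ← hp]
  rfl

/-- One of the queries contains the Diffie-Hellman key `k`. -/
def Hits (k : sys.grp.G ℓ) (Q : List (List Bool)) : Prop :=
  ∃ q ∈ Q, ∃ b, sys.dhPart ℓ b q = sys.grp.code ℓ k

open Classical in
/-- The numbers of the messages between `S` and `R`. -/
def specials : Finset ℕ :=
  (Finset.range G.m).filter fun i => sys.Special S R (G.sk i) (G.rk i)

theorem mem_specials {i : ℕ} :
    i ∈ G.specials S R ↔ i < G.m ∧ sys.Special S R (G.sk i) (G.rk i) := by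
  simp [specials]

/-- Identical until bad: the two oracles can differ only at special points, and each of these
contains the Diffie-Hellman key of a special message. The bad event is measured in the run whose
oracle does not know the special points, where the reduction can simulate it. -/
theorem abs_ind_sub_le_hits (C : Circuit) (r : Bits C.coins) (x : sys.Priv ℓ)
    (Y : HashValues ℓ) (H : List Bool → Bits ℓ) (inp : List Bool) :
    |ind (C.AcceptsWires (C.hashRun r (overwrite (G.table x Y G.indices) H) inp).1) -
      ind (C.AcceptsWires (C.hashRun r (overwrite (G.table x Y (G.ordinary S R)) H) inp).1)| ≤
    ∑ i ∈ G.specials S R, ind (Hits (sys.shared x (G.sk i) (G.rk i))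
      (C.hashRun r (overwrite (G.table x Y (G.ordinary S R)) H) inp).2) := by
  refine le_trans ?_ (ind_exists_le_sum (G.specials S R) fun i =>
    Hits (sys.shared x (G.sk i) (G.rk i))
      (C.hashRun r (overwrite (G.table x Y (G.ordinary S R)) H) inp).2)
  by_cases h : ∃ i ∈ G.specials S R, Hits (sys.shared x (G.sk i) (G.rk i))
      (C.hashRun r (overwrite (G.table x Y (G.ordinary S R)) H) inp).2
  · rw [ind_true h]
    exact abs_sub_le_one (ind_nonneg _) (ind_le_one _) (ind_nonneg _) (ind_le_one _)
  · have heq : C.hashRun r (overwrite (G.table x Y G.indices) H) inp =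
        C.hashRun r (overwrite (G.table x Y (G.ordinary S R)) H) inp := by
      refine oracleExec_congr _ _ _ _ _ fun q hq => ?_
      rw [overwrite, overwrite, table, table, ordinary, tableLookup_map_filter]
      intro j hj hjq
      simp only [decide_eq_true_eq]
      intro hsp
      refine h ⟨j.1, (G.mem_specials S R).2 ⟨G.mem_indices.1 hj, hsp⟩, q, hq, j.2, ?_⟩
      rw [← hjq, point, sys.dhPart_hashInput]
    rw [heq, sub_self, abs_zero]
    exact ind_nonneg _

/-! ### Reduction to the decisional Diffie-Hellman problem -/

section Reduction

variable (x : sys.Priv ℓ) (u v : sys.Key)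

/-- The public keys when those of `u` and `v` are `A` and `B`. -/
def embedPub (A B : sys.grp.G ℓ) (w : sys.Key) : sys.grp.G ℓ :=
  open Classical in if w = u then A else if w = v then B else sys.pub x w

/-- The Diffie-Hellman key of an ordinary message, computed with the private key that is neither
the one of `u` nor the one of `v`. -/
def embedShared (A B : sys.grp.G ℓ) (i : ℕ) : sys.grp.G ℓ :=
  open Classical in
  if G.sk i = u ∨ G.sk i = v then embedPub x u v A B (G.sk i) ^ (x (G.rk i) : ℕ)
  else embedPub x u v A B (G.rk i) ^ (x (G.sk i) : ℕ)

/-- The points of ordinary messages. -/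
def embedPoint (A B : sys.grp.G ℓ) (j : ℕ × Bool) : List Bool :=
  sys.hashInput j.2 (G.embedShared x u v A B j.1) (embedPub x u v A B (G.sk j.1)) (G.ns j.1)

/-- The view. -/
def embedInput (Y : HashValues ℓ) (ρ : ℕ → Bits (sys.ae.coinLen ℓ))
    (μ : ℕ → Bits (sys.ae.msgLen ℓ)) (A B : sys.grp.G ℓ) : List Bool :=
  G.view (fun w => sys.keyInfo S R (embedPub x u v A B w) x w) (G.posted Y ρ μ)

variable {x u v}

/-- The private keys with those of `u` and `v` replaced. -/
def setKeys (x : sys.Priv ℓ) (u v : sys.Key) (a b : Fin (sys.grp.p ℓ)) : sys.Priv ℓ :=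
  open Classical in Function.update (Function.update x u a) v b

theorem setKeys_left (huv : u ≠ v) (a b : Fin (sys.grp.p ℓ)) : setKeys x u v a b u = a := by
  simp [setKeys, huv]

theorem setKeys_right (a b : Fin (sys.grp.p ℓ)) : setKeys x u v a b v = b := by
  simp [setKeys]

theorem setKeys_other {w : sys.Key} (hu : w ≠ u) (hv : w ≠ v) (a b : Fin (sys.grp.p ℓ)) :
    setKeys x u v a b w = x w := by
  simp [setKeys, hu, hv]

theorem embedPub_eq (huv : u ≠ v) (a b : Fin (sys.grp.p ℓ)) (w : sys.Key) :
    embedPub x u v (sys.grp.gen ℓ ^ (a : ℕ)) (sys.grp.gen ℓ ^ (b : ℕ)) w =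
      sys.pub (setKeys x u v a b) w := by
  simp only [embedPub, System.pub]
  split_ifs with h1 h2
  · rw [h1, setKeys_left huv]
  · rw [h2, setKeys_right]
  · rw [setKeys_other h1 h2]

/-- The two keys of an ordinary message are different and are not `u` and `v` in either order,
because these form a special pair. So one of them is neither `u` nor `v`, and its private key is
known to the reduction. -/
theorem embedPoint_eq (hG : G.Proper) (huv : sys.Special S R u v) (hne : u ≠ v)
    (a b : Fin (sys.grp.p ℓ)) {j : ℕ × Bool} (hj : j ∈ G.ordinary S R) :
    G.embedPoint x u v (sys.grp.gen ℓ ^ (a : ℕ)) (sys.grp.gen ℓ ^ (b : ℕ)) j =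
      G.point (setKeys x u v a b) j := by
  obtain ⟨hm, hns⟩ := (G.mem_ordinary S R).1 hj
  rw [embedPoint, point, embedPub_eq hne]
  congr 1
  rw [embedShared, embedPub_eq hne, embedPub_eq hne]
  have hcomm : ∀ y z : sys.Key, sys.shared (setKeys x u v a b) y z =
      sys.pub (setKeys x u v a b) y ^ (setKeys x u v a b z : ℕ) := by
    intro y z
    simp only [System.shared, System.pub, ← pow_mul, Nat.mul_comm]
  have hnej := hG.ne j.1 hm
  split_ifs with h
  · rw [hcomm]
    have h1 : G.rk j.1 ≠ u := by
      rintro h1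
      rcases h with h | h
      · exact hnej (h.trans h1.symm)
      · apply hns
        rw [h, h1]
        exact huv.symm.imp And.symm And.symm
    have h2 : G.rk j.1 ≠ v := by
      rintro h2
      rcases h with h | h
      · apply hns
        rw [h, h2]
        exact huv
      · exact hnej (h.trans h2.symm)
    rw [setKeys_other h1 h2]
  · rw [not_or] at h
    rw [System.shared, setKeys_other h.1 h.2]

/-- The view discloses no private keys of `S` and `R`, and `u` and `v` belong to them; the unknown
exponents enter only through public keys. -/
theorem embedInput_eq (huv : sys.Special S R u v) (hne : u ≠ v)
    (Y : HashValues ℓ) (ρ : ℕ → Bits (sys.ae.coinLen ℓ)) (μ : ℕ → Bits (sys.ae.msgLen ℓ))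
    (a b : Fin (sys.grp.p ℓ)) :
    G.embedInput S R x u v Y ρ μ (sys.grp.gen ℓ ^ (a : ℕ)) (sys.grp.gen ℓ ^ (b : ℕ)) =
      G.input S R (setKeys x u v a b) Y ρ μ := by
  have : (fun w => sys.keyInfo S R
      (embedPub x u v (sys.grp.gen ℓ ^ (a : ℕ)) (sys.grp.gen ℓ ^ (b : ℕ)) w) x w) =
      keys S R (setKeys x u v a b) := by
    funext w
    rw [keys, embedPub_eq hne, System.keyInfo, System.keyInfo]
    congr 1
    split_ifs with h
    · rfl
    · have hu : w ≠ u := by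
        rintro rfl
        exact h (huv.imp And.left And.left)
      have hv : w ≠ v := by
        rintro rfl
        exact h (huv.symm.imp And.right And.right)
      rw [setKeys_other hu hv]
  rw [embedInput, input, this]

variable (x u v)

/-- The distinguisher: does a lazily sampled run query the third component? -/
def embedHits (C : Circuit) (r : Bits C.coins) (y : ℕ → Bits ℓ) (Y : HashValues ℓ)
    (ρ : ℕ → Bits (sys.ae.coinLen ℓ)) (μ : ℕ → Bits (sys.ae.msgLen ℓ))
    (t : sys.grp.Triple ℓ) : Bool :=
  open Classical in
  decide (Hits t.2.2 (C.lazyRun r y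
    ((G.ordinary S R).map fun j => (G.embedPoint x u v t.1 t.2.1 j, Y j))
    (G.embedInput S R x u v Y ρ μ t.1 t.2.1)).2)

/-- The cost of a lazily sampled run of a circuit of size `s` with a table of `k` entries. -/
def lazyCost (k s : ℕ) : ℕ := s * (s * ((k + s) * (22 * s + 7) + 1))

/-- The cost of the distinguisher for at most `N` messages, a circuit of size `s`, group elements
of length `len` and a circuit of size `sM` for multiplication. -/
def ddhCost (N s len sM : ℕ) : ℕ :=
  2 + (2 * N * (len * (2 * runCost sM)) + (lazyCost (2 * N) s + (2 * s * (11 * len + 4) + 1)))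

theorem reach_consts {α : Type} (A : Set (α → Bool)) :
    Reach A 2 ({fun _ => true} ∪ {fun _ => false}) :=
  (Reach.const_fn true).union (Reach.const_fn false)

theorem const_mem_consts {α : Type} (A : Set (α → Bool)) (b : Bool) :
    (fun _ => b) ∈ A ∪ (({fun _ => true} : Set (α → Bool)) ∪ {fun _ => false}) := by
  cases b <;> simp

/-- As functions of the triple, public keys are input bits or constants, and Diffie-Hellman keys of
ordinary messages are powers of these with known exponents. Addresses and ciphertexts are constants,
because `Y` and `ρ` are fixed. What is left is to run the circuit and to compare its queries with
the third component. -/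
theorem reach_embedHits (hG : G.Proper) (C : Circuit) (r : Bits C.coins) (y : ℕ → Bits ℓ)
    (Y : HashValues ℓ) (ρ : ℕ → Bits (sys.ae.coinLen ℓ)) (μ : ℕ → Bits (sys.ae.msgLen ℓ))
    {N s sM : ℕ} (hN : G.m ≤ N) (hs : C.size ≤ s) (hM : sys.grp.MulCircuit ℓ sM) :
    Reach {f | f ∈ sys.grp.tripleBits ℓ} (ddhCost N s (sys.grp.len ℓ) sM)
      {G.embedHits S R x u v C r y Y ρ μ} := by
  set A₀ : Set (sys.grp.Triple ℓ → Bool) := {f | f ∈ sys.grp.tripleBits ℓ}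
  set A := A₀ ∪ (({fun _ => true} : Set (sys.grp.Triple ℓ → Bool)) ∪ {fun _ => false})
  have hc : ∀ b, (fun _ => b) ∈ A := const_mem_consts A₀
  have hpub : ∀ w, ∀ f ∈ sys.grp.bits
      (fun t : sys.grp.Triple ℓ => embedPub x u v t.1 t.2.1 w), f ∈ A := by
    intro w
    unfold embedPub
    split_ifs
    · exact fun f hf => Or.inl (by simp [A₀, GroupFamily.tripleBits, hf])
    · exact fun f hf => Or.inl (by simp [A₀, GroupFamily.tripleBits, hf])
    · exact sys.grp.bits_const_mem hc _
  have hsh : ∀ j ∈ G.ordinary S R, Reach A (sys.grp.len ℓ * (2 * runCost sM))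
      {f | f ∈ sys.grp.bits fun t : sys.grp.Triple ℓ => G.embedShared x u v t.1 t.2.1 j.1} := by
    intro j _
    have hlt : ∀ w, (x w : ℕ) < 2 ^ sys.grp.len ℓ := fun w =>
      (x w).2.trans_le (sys.grp.p_le_two_pow ℓ)
    unfold embedShared
    split_ifs
    · exact sys.grp.reach_pow hM hc _ (hpub _) _ _ (hlt _)
    · exact sys.grp.reach_pow hM hc _ (hpub _) _ _ (hlt _)
  have hB := (Reach.list _ _ hsh).mono_cost (Nat.mul_le_mul_right _
    ((G.length_ordinary_le S R).trans (Nat.mul_le_mul_left 2 hN)))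
  set B : Set (sys.grp.Triple ℓ → Bool) := {f | ∃ j ∈ G.ordinary S R, f ∈
    {f | f ∈ sys.grp.bits fun t : sys.grp.Triple ℓ => G.embedShared x u v t.1 t.2.1 j.1}}
  have hcB : ∀ b, (fun _ => b) ∈ A ∪ B := fun b => Or.inl (hc b)
  have hpt : ∀ j ∈ G.ordinary S R, Assembled (A ∪ B)
      fun t : sys.grp.Triple ℓ => G.embedPoint x u v t.1 t.2.1 j := by
    intro j hj
    unfold embedPoint System.hashInput
    refine (((Assembled.const hcB _).append (sys.grp.assembled_code ?_)).append
      (sys.grp.assembled_code ?_)).append (Assembled.const hcB _)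
    · exact fun f hf => Or.inr ⟨j, hj, hf⟩
    · exact fun f hf => Or.inl (hpub _ f hf)
  have hin : Assembled (A ∪ B)
      fun t : sys.grp.Triple ℓ => G.embedInput S R x u v Y ρ μ t.1 t.2.1 := by
    refine hG.assembled _ hcB _ _ (fun w => ?_) fun i => Assembled.const hcB _
    refine (sys.grp.assembled_code fun f hf => Or.inl (hpub w f hf)).append ?_
    exact Assembled.const hcB _
  obtain ⟨w, Q, h1, h2, h3⟩ := C.reach_lazyRun r y hcB hin (G.ordinary S R)
    (fun (t : sys.grp.Triple ℓ) j => G.embedPoint x u v t.1 t.2.1 j) Y hpt hs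
  set D : Set (sys.grp.Triple ℓ → Bool) := {f | f ∈ w ∨ ∃ q ∈ Q, f ∈ q}
  set Z := sys.grp.bits fun t : sys.grp.Triple ℓ => t.2.2
  have hZ : ∀ f ∈ Z, f ∈ A ∪ B ∪ D := fun f hf =>
    Or.inl (Or.inl (Or.inl (by simp only [Z] at hf; simp [A₀, GroupFamily.tripleBits, hf])))
  let part : Bool → List (sys.grp.Triple ℓ → Bool) → List (sys.grp.Triple ℓ → Bool) :=
    fun b q => (q.drop (tagBits b).length).take (sys.grp.len ℓ)
  -- The tag determines where the Diffie-Hellman key would begin in a query, so both tags are tried: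
  -- two tests for each query.
  let tests : List (sys.grp.Triple ℓ → Bool) := Q.flatMap fun q =>
    [true, false].map fun b t => decide (evalAll (part b q) t = evalAll Z t)
  have htests : ∀ f ∈ tests, Reach (A ∪ B ∪ D) (11 * sys.grp.len ℓ + 1) {f} := by
    intro f hf
    obtain ⟨q, hq, hf⟩ := List.mem_flatMap.1 hf
    obtain ⟨b, -, rfl⟩ := List.mem_map.1 hf
    refine (reach_eq (part b q) Z (fun f hf => ?_) hZ).mono_cost ?_
    · exact Or.inr (Or.inr ⟨q, hq, List.mem_of_mem_drop (List.mem_of_mem_take hf)⟩)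
    · have : (part b q).length ≤ sys.grp.len ℓ := List.length_take_le _ _
      omega
  have hany := reach_any tests htests
  have hlen : tests.length ≤ 2 * s := by
    have : tests.length = Q.length * 2 := by
      simp [tests, List.length_flatMap]
    omega
  have hacc : (fun t => (evalAll tests t).any id) = G.embedHits S R x u v C r y Y ρ μ := by
    funext t
    rw [embedHits, h3 t, Bool.eq_iff_iff]
    simp only [decide_eq_true_eq, List.any_eq_true]
    have hpart : ∀ b q, evalAll (part b q) t = sys.dhPart ℓ b (evalAll q t) := by
      intro b q
      simp only [part, System.dhPart, evalAll, List.map_take, List.map_drop]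
    constructor
    · rintro ⟨c, hc', hct⟩
      obtain ⟨f, hf, rfl⟩ := List.mem_map.1 hc'
      obtain ⟨q, hq, hf⟩ := List.mem_flatMap.1 hf
      obtain ⟨b, -, rfl⟩ := List.mem_map.1 hf
      have hb : evalAll (part b q) t = evalAll Z t := of_decide_eq_true hct
      rw [hpart, sys.grp.evalAll_bits] at hb
      exact ⟨_, List.mem_map_of_mem hq, b, hb⟩
    · rintro ⟨_, hq', b, hb⟩
      obtain ⟨q, hq, rfl⟩ := List.mem_map.1 hq'
      refine ⟨_, List.mem_map_of_mem (List.mem_flatMap.2 ⟨q, hq,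
        List.mem_map_of_mem (show b ∈ [true, false] by cases b <;> simp)⟩), decide_eq_true ?_⟩
      rw [hpart, sys.grp.evalAll_bits, hb]
  rw [hacc] at hany
  refine ((reach_consts A₀).trans (hB.trans (h1.trans hany))).mono_cost ?_
  unfold ddhCost lazyCost
  have := (G.length_ordinary_le S R).trans (Nat.mul_le_mul_left 2 hN)
  gcongr 2 + (_ + (s * (s * ((?_ + _) * _ + _)) + (?_ * ?_ + _)))
  omega

/-- The run uses only the first two components, so the third is independent of its queries. Each
query, read with either tag, names one group element and is met with probability at most `1 / p`. -/
theorem avgRandom_embedHits_le (C : Circuit) (r : Bits C.coins) (y : ℕ → Bits ℓ)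
    (Y : HashValues ℓ) (ρ : ℕ → Bits (sys.ae.coinLen ℓ)) (μ : ℕ → Bits (sys.ae.msgLen ℓ)) :
    sys.grp.avgRandom (G.embedHits S R x u v C r y Y ρ μ) ≤ 2 * C.size * (1 / sys.grp.p ℓ) := by
  rw [GroupFamily.avgRandom]
  refine avg_le fun a => avg_le fun b => ?_
  simp only [embedHits, decide_eq_true_eq]
  set Q := (C.lazyRun r y ((G.ordinary S R).map fun j =>
    (G.embedPoint x u v (sys.grp.gen ℓ ^ (a : ℕ)) (sys.grp.gen ℓ ^ (b : ℕ)) j, Y j))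
    (G.embedInput S R x u v Y ρ μ (sys.grp.gen ℓ ^ (a : ℕ)) (sys.grp.gen ℓ ^ (b : ℕ)))).2
  have hQ : Q.length ≤ C.size := C.length_lazyRun_le r y _ _
  have hle : ∀ c : Fin (sys.grp.p ℓ), ind (Hits (sys.grp.gen ℓ ^ (c : ℕ)) Q) ≤
      ∑ e ∈ Q.toFinset ×ˢ (Finset.univ : Finset Bool),
        ind (sys.grp.code ℓ (sys.grp.gen ℓ ^ (c : ℕ)) = sys.dhPart ℓ e.2 e.1) := fun c => by
    refine le_trans (ind_mono ?_) (ind_exists_le_sum _ _)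
    rintro ⟨q, hq, b, h⟩
    exact ⟨(q, b), by simpa using hq, h.symm⟩
  refine (avg_mono hle).trans ?_
  rw [avg_sum]
  have hinj : Function.Injective fun c : Fin (sys.grp.p ℓ) =>
      sys.grp.code ℓ (sys.grp.gen ℓ ^ (c : ℕ)) :=
    sys.grp.code_injective.comp sys.grp.gen_pow_injective
  refine (Finset.sum_le_card_nsmul _ _ (1 / (sys.grp.p ℓ : ℝ)) fun e _ => ?_).trans ?_
  · have := avg_ind_eq_le _ hinj (sys.dhPart ℓ e.2 e.1)
    rwa [sys.grp.card_fin_p] at this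
  · rw [nsmul_eq_mul]
    refine mul_le_mul_of_nonneg_right ?_ (by positivity)
    rw [Finset.card_product, Finset.card_univ, Fintype.card_bool]
    have : Q.toFinset.card ≤ C.size := (List.toFinset_card_le _).trans hQ
    have : Q.toFinset.card * 2 ≤ 2 * C.size := by omega
    exact_mod_cast this

end Reduction

end Game

namespace Game

variable {sys : System} {ℓ : ℕ} (G : Game sys ℓ) (S R : Fin sys.n)

/-! ### The probability of queries to special points -/

theorem embedHits_eq_true_iff (hG : G.Proper) {u v : sys.Key} (huv : sys.Special S R u v)
    (hne : u ≠ v) (x : sys.Priv ℓ) (C : Circuit) (r : Bits C.coins) (y : ℕ → Bits ℓ)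
    (Y : HashValues ℓ) (ρ : ℕ → Bits (sys.ae.coinLen ℓ)) (μ : ℕ → Bits (sys.ae.msgLen ℓ))
    (a b : Fin (sys.grp.p ℓ)) :
    G.embedHits S R x u v C r y Y ρ μ (sys.grp.gen ℓ ^ (a : ℕ), sys.grp.gen ℓ ^ (b : ℕ),
      sys.grp.gen ℓ ^ ((a : ℕ) * (b : ℕ))) = true ↔
    Hits (sys.shared (setKeys x u v a b) u v) (C.lazyRun r y
      (G.table (setKeys x u v a b) Y (G.ordinary S R))
      (G.input S R (setKeys x u v a b) Y ρ μ)).2 := by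
  have h1 : ((G.ordinary S R).map fun j => (G.embedPoint x u v (sys.grp.gen ℓ ^ (a : ℕ))
      (sys.grp.gen ℓ ^ (b : ℕ)) j, Y j)) = G.table (setKeys x u v a b) Y (G.ordinary S R) :=
    List.map_congr_left fun j hj => by rw [G.embedPoint_eq S R hG huv hne a b hj]
  have h2 : sys.shared (setKeys x u v a b) u v = sys.grp.gen ℓ ^ ((a : ℕ) * (b : ℕ)) := by
    rw [System.shared, System.pub, setKeys_left hne, setKeys_right, ← pow_mul, Nat.mul_comm]
  simp only [embedHits, decide_eq_true_eq]
  rw [h1, h2, G.embedInput_eq S R huv hne]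

theorem Ex_setKeys {s : Finset sys.Key} {u v : sys.Key} (hu : u ∈ s) (hv : v ∈ s)
    (F : sys.Priv ℓ → ℝ) :
    (Ex s fun x => avg fun a => avg fun b => F (setKeys x u v a b)) = Ex s F := by
  exact (Ex_resample hu fun x => avg fun b => F (Function.update x v b)).trans (Ex_resample hv F)

/-- With everything fixed except the two private keys of the message, the event is acceptance of
`embedHits` on a Diffie-Hellman triple. The assumption passes to a random triple at the price of
`ε`, and there the event is improbable. -/
theorem Ex_hits_le (hG : G.Proper) (C : Circuit) {i : ℕ} (hi : i ∈ G.specials S R)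
    (μ : ℕ → Bits (sys.ae.msgLen ℓ)) {s : Finset sys.Key} (hu : G.sk i ∈ s)
    (hv : G.rk i ∈ s) (sY : Finset (ℕ × Bool)) (sρ : Finset ℕ) {sH : Finset (List Bool)}
    (hs : ∀ q : List Bool, q.length ≤ C.size → q ∈ sH) {N sM : ℕ} (hN : G.m ≤ N)
    (hM : sys.grp.MulCircuit ℓ sM) {ε : ℝ}
    (hε : ∀ acc : sys.grp.Triple ℓ → Bool, Reach {f | f ∈ sys.grp.tripleBits ℓ}
      (ddhCost N C.size (sys.grp.len ℓ) sM) {acc} →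
      |sys.grp.avgReal acc - sys.grp.avgRandom acc| ≤ ε) :
    (Ex s fun x => avg fun r => Ex sY fun Y => Ex sρ fun ρ => Ex sH fun H =>
      ind (Hits (sys.shared x (G.sk i) (G.rk i)) (C.hashRun r
        (overwrite (G.table x Y (G.ordinary S R)) H) (G.input S R x Y ρ μ)).2)) ≤
    ε + 2 * C.size * (1 / sys.grp.p ℓ) := by
  obtain ⟨him, hsp⟩ := (G.mem_specials S R).1 hi
  have hne : G.sk i ≠ G.rk i := hG.ne i him
  have hlazy : ∀ (x : sys.Priv ℓ) r (Y : HashValues ℓ) ρ, _ := fun x r Y ρ =>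
    C.Ex_hashRun r (G.table x Y (G.ordinary S R)) (G.input S R x Y ρ μ) sH hs
      fun _ Q => ind (Hits (sys.shared x (G.sk i) (G.rk i)) Q)
  simp only [hlazy]
  rw [Ex_avg_comm]
  refine avg_le fun r => ?_
  rw [Ex_comm]
  refine Ex_le fun Y => ?_
  rw [Ex_comm]
  refine Ex_le fun ρ => ?_
  rw [Ex_comm]
  refine Ex_le fun y => ?_
  -- The private keys of the message are drawn anew; they are the exponents of the challenge, and
  -- the remaining keys `x` are fixed.
  rw [← Ex_setKeys hu hv]
  refine Ex_le fun x => ?_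
  simp only [← G.embedHits_eq_true_iff S R hG hsp hne x C r y Y ρ μ]
  have h1 := hε _ (G.reach_embedHits S R x (G.sk i) (G.rk i) hG C r y Y ρ μ hN le_rfl hM)
  have h2 := G.avgRandom_embedHits_le S R x (G.sk i) (G.rk i) C r y Y ρ μ
  have h3 := (le_abs_self _).trans h1
  rw [GroupFamily.avgReal] at h3
  linarith

/-! ### Collisions of keys -/

theorem Ex_not_generic_le {s : Finset sys.Key} (hs : G.usedKeys ⊆ s) :
    (Ex s fun x : sys.Priv ℓ => ind (¬G.Generic x)) ≤
      4 * (G.m : ℝ) ^ 2 * (1 / sys.grp.p ℓ) := by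
  let z : Fin (sys.grp.p ℓ) := ⟨0, (sys.grp.prime ℓ).pos⟩
  -- A diagonal pair stands for the event that this private key is zero, an off-diagonal pair for a
  -- collision. One sum over at most `(2 * m) ^ 2` pairs covers both.
  have hle : ∀ x : sys.Priv ℓ, ind (¬G.Generic x) ≤ ∑ e ∈ G.usedKeys ×ˢ G.usedKeys,
      ind (x e.1 = if e.1 = e.2 then z else x e.2) := fun x => by
    refine le_trans (ind_mono fun h => ?_) (ind_exists_le_sum _ _)
    simp only [Generic, not_forall] at h
    obtain ⟨u, hu, h⟩ := h
    by_cases h0 : (x u : ℕ) = 0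
    · exact ⟨(u, u), by simp [hu], by simp [z, Fin.ext_iff, h0]⟩
    · simp only [h0, ne_eq, not_false_eq_true, true_and, not_forall, not_not] at h
      obtain ⟨v, hv, huv, h⟩ := h
      exact ⟨(u, v), by simp [hu, hv], by simp [huv, h]⟩
  refine (Ex_mono hle).trans ?_
  rw [Ex_sum]
  refine (Finset.sum_le_card_nsmul _ _ (1 / (sys.grp.p ℓ : ℝ)) fun e he => ?_).trans ?_
  · rw [← Ex_resample (hs (Finset.mem_product.1 he).1)]
    refine Ex_le fun x => ?_
    rw [← sys.grp.card_fin_p]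
    by_cases h : e.1 = e.2
    · simp only [h, if_true, Function.update_self]
      exact avg_ind_eq_le (fun a => a) Function.injective_id z
    · simp only [h, if_false, Function.update_self, Function.update_of_ne (Ne.symm h)]
      exact avg_ind_eq_le (fun a => a) Function.injective_id (x e.2)
  · rw [nsmul_eq_mul]
    refine mul_le_mul_of_nonneg_right ?_ (by positivity)
    rw [Finset.card_product]
    have : G.usedKeys.card * G.usedKeys.card ≤ (2 * G.m) * (2 * G.m) :=
      Nat.mul_le_mul G.card_usedKeys_le G.card_usedKeys_le
    calc ((G.usedKeys.card * G.usedKeys.card : ℕ) : ℝ) ≤ ((2 * G.m) * (2 * G.m) : ℕ) := by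
          exact_mod_cast this
      _ = _ := by push_cast; ring

/-! ### Replacing special messages by the dummy message -/

section Hybrid

variable (x : sys.Priv ℓ) (C : Circuit) (r : Bits C.coins)

/-- The acceptance probability if the first `h` messages, as far as special, are replaced by the
dummy message, for given private keys and coins. -/
def hybrid (sY : Finset (ℕ × Bool)) (sρ : Finset ℕ) (sH : Finset (List Bool)) (h : ℕ) : ℝ :=
  Ex sY fun Y => Ex sρ fun ρ => Ex sH fun H => ind (C.AcceptsWires (C.hashRun r
    (overwrite (G.table x Y (G.ordinary S R)) H) (G.input S R x Y ρ (G.hybridMsg S R h))).1)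

/-- The addresses and ciphertexts where the `h`-th ciphertext is `ct`. -/
def embedPosted (Y : HashValues ℓ) (ρ : ℕ → Bits (sys.ae.coinLen ℓ))
    (μ : ℕ → Bits (sys.ae.msgLen ℓ)) (h : ℕ) (ct : Bits (sys.ae.ctLen ℓ)) (i : ℕ) : List Bool :=
  if i = h then List.ofFn (Y (h, true)) ++ List.ofFn ct else G.posted Y ρ μ i

/-- The distinguisher: acceptance of a lazily sampled run on the view with ciphertext `ct`. -/
def embedAccepts (y : ℕ → Bits ℓ) (Y : HashValues ℓ) (ρ : ℕ → Bits (sys.ae.coinLen ℓ))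
    (μ : ℕ → Bits (sys.ae.msgLen ℓ)) (h : ℕ) (ct : Bits (sys.ae.ctLen ℓ)) : Bool :=
  open Classical in
  decide (C.AcceptsWires (C.lazyRun r y (G.table x Y (G.ordinary S R))
    (G.view (keys S R x) (G.embedPosted Y ρ μ h ct))).1)

/-- Here the keys and the whole table are constants, and only the challenge ciphertext varies. The
cost is therefore that of one lazily sampled run. -/
theorem reach_embedAccepts (hG : G.Proper) (y : ℕ → Bits ℓ) (Y : HashValues ℓ)
    (ρ : ℕ → Bits (sys.ae.coinLen ℓ)) (μ : ℕ → Bits (sys.ae.msgLen ℓ)) (h : ℕ) {N : ℕ}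
    (hN : G.m ≤ N) :
    Reach {f | f ∈ sys.ae.ctBits ℓ} (2 + lazyCost (2 * N) C.size)
      {G.embedAccepts S R x C r y Y ρ μ h} := by
  set A₀ : Set (Bits (sys.ae.ctLen ℓ) → Bool) := {f | f ∈ sys.ae.ctBits ℓ}
  set A := A₀ ∪ (({fun _ => true} : Set (Bits (sys.ae.ctLen ℓ) → Bool)) ∪ {fun _ => false})
  have hc : ∀ b, (fun _ => b) ∈ A := const_mem_consts A₀
  have hin : Assembled A fun ct => G.view (keys S R x) (G.embedPosted Y ρ μ h ct) := by
    refine hG.assembled A hc (fun _ => keys S R x) _ (fun w => Assembled.const hc _) fun i => ?_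
    unfold embedPosted
    split_ifs
    · exact (Assembled.const hc _).append (sys.ae.assembled_ct fun f hf => Or.inl hf)
    · exact Assembled.const hc _
  obtain ⟨w, Q, h1, -, h3⟩ := C.reach_lazyRun r y hc hin (G.ordinary S R)
    (fun _ j => G.point x j) Y (fun j _ => Assembled.const hc _) le_rfl
  have hcost : 2 + C.size * (C.size * (((G.ordinary S R).length + C.size) *
      (22 * C.size + 7) + 1)) ≤ 2 + lazyCost (2 * N) C.size := by
    have := (G.length_ordinary_le S R).trans (Nat.mul_le_mul_left 2 hN)
    unfold lazyCost
    gcongr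
  refine (((reach_consts A₀).trans h1.with_base).mono_cost hcost).mono_right ?_
  rw [Set.singleton_subset_iff]
  have hval : ∀ ct, G.embedAccepts S R x C r y Y ρ μ h ct =
      ((C.outputs.map fun i => w.getD i (fun _ => false)).headD fun _ => false) ct := by
    intro ct
    have hb : G.embedAccepts S R x C r y Y ρ μ h ct = true ↔
        C.AcceptsWires (C.lazyRun r y (G.table x Y (G.ordinary S R))
          (G.view (keys S R x) (G.embedPosted Y ρ μ h ct))).1 := by
      simp only [embedAccepts, decide_eq_true_eq]
    rw [Bool.eq_iff_iff, hb, table, h3 ct, Circuit.AcceptsWires]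
    cases C.outputs with
    | nil => simp
    | cons i l =>
      simp only [getD_evalAll, List.map_cons, List.head?_cons, Option.some.injEq, List.headD_cons]
  rw [funext hval]
  cases C.outputs with
  | nil => exact Or.inl (hc false)
  | cons i l =>
    simp only [List.map_cons, List.headD_cons]
    rw [List.getD_eq_getElem?_getD]
    cases hi : w[i]? with
    | none => exact Or.inl (hc false)
    | some f => exact Or.inr (Or.inl (List.mem_of_getElem? hi))

theorem Ex_Ex_resample {I J β γ : Type} [DecidableEq I] [DecidableEq J] [Fintype β] [Nonempty β]
    [Fintype γ] [Nonempty γ] {s : Finset I} {t : Finset J} {i : I} {j : J} (hi : i ∈ s)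
    (hj : j ∈ t) (F : (I → β) → (J → γ) → ℝ) :
    (Ex s fun Y => Ex t fun ρ => avg fun k => avg fun c =>
      F (Function.update Y i k) (Function.update ρ j c)) = Ex s fun Y => Ex t fun ρ => F Y ρ := by
  rw [← Ex_resample hi fun Y => Ex t fun ρ => F Y ρ]
  refine Ex_congr fun Y => ?_
  rw [Ex_avg_comm]
  congr 1
  funext k
  exact Ex_resample hj fun ρ => F (Function.update Y i k) ρ

/-- The oracle is not programmed at special points, so the encryption key of a special message
influences nothing but its ciphertext. -/
theorem table_update {h : ℕ} (hsp : sys.Special S R (G.sk h) (G.rk h)) (Y : HashValues ℓ)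
    (k : Bits ℓ) :
    G.table x (Function.update Y (h, false) k) (G.ordinary S R) =
      G.table x Y (G.ordinary S R) := by
  refine List.map_congr_left fun j hj => ?_
  have : j ≠ (h, false) := by
    rintro rfl
    exact ((G.mem_ordinary S R).1 hj).2 hsp
  rw [Function.update_of_ne this]

theorem posted_update {h : ℕ} (hm : h < G.m) (Y : HashValues ℓ) (k : Bits ℓ)
    (ρ : ℕ → Bits (sys.ae.coinLen ℓ)) (c : Bits (sys.ae.coinLen ℓ))
    (μ μ' : ℕ → Bits (sys.ae.msgLen ℓ)) (hμ : ∀ i, i ≠ h → μ' i = μ i) :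
    G.posted (Function.update Y (h, false) k) (Function.update ρ h c) μ' =
      G.embedPosted Y ρ μ h (sys.ae.enc ℓ k (μ' h) c) := by
  funext i
  unfold posted embedPosted
  by_cases hi : i = h
  · subst hi
    simp [hm]
  · simp [hi, hμ i hi, posted]

/-- The two hybrids differ at most in the contents of message `h`, and only if it is special. Its
key and its encryption coins occur nowhere else, so the ciphertext is a challenge under a fresh key,
and everything else can be hard-wired. -/
theorem hybrid_step (hG : G.Proper) {sY : Finset (ℕ × Bool)} {sρ : Finset ℕ}
    {sH : Finset (List Bool)} (hs : ∀ q : List Bool, q.length ≤ C.size → q ∈ sH) {N : ℕ}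
    (hN : G.m ≤ N) {ε : ℝ} (hε0 : 0 ≤ ε)
    (hε : ∀ (m₀ m₁ : Bits (sys.ae.msgLen ℓ)) (acc : Bits (sys.ae.ctLen ℓ) → Bool),
      Reach {f | f ∈ sys.ae.ctBits ℓ} (2 + lazyCost (2 * N) C.size) {acc} →
      |sys.ae.avgEnc m₁ acc - sys.ae.avgEnc m₀ acc| ≤ ε) {h : ℕ} (hh : h < G.m)
    (hY : (h, false) ∈ sY) (hρ : h ∈ sρ) :
    |G.hybrid S R x C r sY sρ sH (h + 1) - G.hybrid S R x C r sY sρ sH h| ≤ ε := by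
  classical
  by_cases hsp : sys.Special S R (G.sk h) (G.rk h)
  swap
  · have : G.hybridMsg S R (h + 1) = G.hybridMsg S R h := by
      funext i
      unfold hybridMsg
      by_cases hi : i = h
      · subst hi; simp [hsp]
      · have : i < h + 1 ↔ i < h := by omega
        exact if_congr (and_congr_left' this) rfl rfl
    rw [hybrid, hybrid, this, sub_self, abs_zero]
    exact hε0
  have hμ : ∀ i, i ≠ h → G.hybridMsg S R (h + 1) i = G.hybridMsg S R h i := by
    intro i hi
    have : i < h + 1 ↔ i < h := by omega
    exact if_congr (and_congr_left' this) rfl rfl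
  have hlazy : ∀ g, G.hybrid S R x C r sY sρ sH g =
      Ex (Finset.range C.gates.length) fun y => Ex sY fun Y => Ex sρ fun ρ =>
        ind (C.AcceptsWires (C.lazyRun r y (G.table x Y (G.ordinary S R))
          (G.input S R x Y ρ (G.hybridMsg S R g))).1) := by
    intro g
    have h1 : ∀ (Y : HashValues ℓ) ρ, _ := fun Y ρ =>
      C.Ex_hashRun r (G.table x Y (G.ordinary S R)) (G.input S R x Y ρ (G.hybridMsg S R g)) sH hs
        fun w _ => ind (C.AcceptsWires w)
    simp only [hybrid, h1]
    exact (Ex_congr fun Y => Ex_comm _).trans (Ex_comm _)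
  rw [hlazy, hlazy]
  refine (abs_Ex_sub_le (H := fun _ => ε) fun y => ?_).trans (Ex_const _).le
  have hre := fun g => Ex_Ex_resample hY hρ fun (Y : HashValues ℓ) ρ =>
    ind (C.AcceptsWires (C.lazyRun r y (G.table x Y (G.ordinary S R))
      (G.input S R x Y ρ (G.hybridMsg S R g))).1)
  beta_reduce at hre
  -- The key and the coins of message `h` are drawn anew on both sides, inside all other averages;
  -- they become the randomness of the challenge encryption.
  rw [← hre (h + 1), ← hre h]
  refine (abs_Ex_sub_le (H := fun _ => ε) fun Y => ?_).trans (Ex_const _).le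
  refine (abs_Ex_sub_le (H := fun _ => ε) fun ρ => ?_).trans (Ex_const _).le
  have key : ∀ g, (∀ i, i ≠ h → G.hybridMsg S R g i = G.hybridMsg S R h i) →
      (avg fun k => avg fun c => ind (C.AcceptsWires (C.lazyRun r y
        (G.table x (Function.update Y (h, false) k) (G.ordinary S R))
        (G.input S R x (Function.update Y (h, false) k) (Function.update ρ h c)
          (G.hybridMsg S R g))).1)) =
      sys.ae.avgEnc (G.hybridMsg S R g h)
        (G.embedAccepts S R x C r y Y ρ (G.hybridMsg S R h) h) := by
    intro g hg
    simp only [AEScheme.avgEnc, embedAccepts, decide_eq_true_eq, input]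
    congr 1; funext k
    congr 1; funext c
    rw [G.table_update S R x hsp, G.posted_update hh Y k ρ c _ _ hg]
  rw [key _ hμ, key _ fun _ _ => rfl]
  exact hε _ _ _ (G.reach_embedAccepts S R x C r hG y Y ρ _ h hN)

theorem hybrid_sub_le (hG : G.Proper) {sY : Finset (ℕ × Bool)} {sρ : Finset ℕ}
    {sH : Finset (List Bool)} (hs : ∀ q : List Bool, q.length ≤ C.size → q ∈ sH) {N : ℕ}
    (hN : G.m ≤ N) {ε : ℝ} (hε0 : 0 ≤ ε)
    (hε : ∀ (m₀ m₁ : Bits (sys.ae.msgLen ℓ)) (acc : Bits (sys.ae.ctLen ℓ) → Bool),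
      Reach {f | f ∈ sys.ae.ctBits ℓ} (2 + lazyCost (2 * N) C.size) {acc} →
      |sys.ae.avgEnc m₁ acc - sys.ae.avgEnc m₀ acc| ≤ ε)
    (hY : ∀ h < G.m, (h, false) ∈ sY) (hρ : ∀ h < G.m, h ∈ sρ) {h : ℕ} (hh : h ≤ G.m) :
    |G.hybrid S R x C r sY sρ sH h - G.hybrid S R x C r sY sρ sH 0| ≤ h * ε := by
  induction h with
  | zero => simp
  | succ h ih =>
    have h1 := ih (by omega)
    have h2 := G.hybrid_step S R x C r hG hs hN hε0 hε (h := h) (by omega) (hY h (by omega))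
      (hρ h (by omega))
    have h3 := abs_sub_le (G.hybrid S R x C r sY sρ sH (h + 1)) (G.hybrid S R x C r sY sρ sH h)
      (G.hybrid S R x C r sY sρ sH 0)
    push_cast
    linarith

end Hybrid

/-! ### The real view and the ideal view -/

/-- The acceptance probability of `C` on the real view. -/
def realProb (C : Circuit) (sX : Finset sys.Key) (sρ : Finset ℕ) (sH : Finset (List Bool)) : ℝ :=
  Ex sX fun x => avg fun r => Ex sρ fun ρ => Ex sH fun H => ind (C.AcceptsWires
    (C.hashRun r H (G.input S R x (fun j => H (G.point x j)) ρ G.msg)).1)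

/-- The acceptance probability of `C` on a view in which special messages have addresses and keys
that are independent of the hash function, and are replaced by the dummy message. -/
def idealProb (C : Circuit) (sX : Finset sys.Key) (sρ : Finset ℕ) (sH : Finset (List Bool)) : ℝ :=
  Ex sX fun x => avg fun r => G.hybrid S R x C r (Finset.range G.m ×ˢ Finset.univ) sρ sH G.m

/-- For generic private keys the oracle can be programmed, and forgetting the special points costs
the probability of hitting one of them. Other private keys are given up with the trivial bound 1. -/
theorem abs_realProb_sub_hybrid_le (hG : G.Proper) (C : Circuit) (x : sys.Priv ℓ) {sρ : Finset ℕ}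
    {sH : Finset (List Bool)} (hsP : ∀ j ∈ G.indices, G.point x j ∈ sH) :
    |(avg fun r => Ex sρ fun ρ => Ex sH fun H => ind (C.AcceptsWires
      (C.hashRun r H (G.input S R x (fun j => H (G.point x j)) ρ G.msg)).1)) -
      avg fun r => G.hybrid S R x C r (Finset.range G.m ×ˢ Finset.univ) sρ sH 0| ≤
    ind (¬G.Generic x) + ∑ i ∈ G.specials S R, avg fun r : Bits C.coins =>
      Ex (Finset.range G.m ×ˢ Finset.univ) fun Y : HashValues ℓ => Ex sρ fun ρ => Ex sH fun H =>
        ind (Hits (sys.shared x (G.sk i) (G.rk i)) (C.hashRun r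
          (overwrite (G.table x Y (G.ordinary S R)) H) (G.input S R x Y ρ G.msg)).2) := by
  have hmsg : G.hybridMsg S R 0 = G.msg := by
    funext i; simp [hybridMsg]
  by_cases hx : G.Generic x
  · rw [ind_false (not_not.2 hx), zero_add, ← avg_sum, ← avg_sub]
    refine (abs_avg_le _).trans (avg_mono fun r => ?_)
    have h1 : (Ex sρ fun ρ => Ex sH fun H => ind (C.AcceptsWires
        (C.hashRun r H (G.input S R x (fun j => H (G.point x j)) ρ G.msg)).1)) =
        Ex (Finset.range G.m ×ˢ Finset.univ) fun Y : HashValues ℓ => Ex sρ fun ρ => Ex sH fun H =>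
          ind (C.AcceptsWires (C.hashRun r (overwrite (G.table x Y G.indices) H)
            (G.input S R x Y ρ G.msg)).1) := by
      refine (Ex_congr fun ρ => G.Ex_hash_resample S R hG hx C r ρ G.msg hsP).trans ?_
      exact Ex_comm _
    rw [h1, hybrid, hmsg]
    refine (abs_Ex_sub_le fun Y => abs_Ex_sub_le fun ρ => abs_Ex_sub_le fun H =>
      G.abs_ind_sub_le_hits S R C r x Y H _).trans ?_
    simp only [Ex_sum]
    exact le_rfl
  · rw [ind_true hx]
    have hnn : 0 ≤ ∑ i ∈ G.specials S R, avg fun r : Bits C.coins =>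
        Ex (Finset.range G.m ×ˢ Finset.univ) fun Y : HashValues ℓ => Ex sρ fun ρ => Ex sH fun H =>
        ind (Hits (sys.shared x (G.sk i) (G.rk i)) (C.hashRun r
          (overwrite (G.table x Y (G.ordinary S R)) H) (G.input S R x Y ρ G.msg)).2) :=
      Finset.sum_nonneg fun i _ => avg_nonneg fun r => Ex_nonneg fun Y => Ex_nonneg fun ρ =>
        Ex_nonneg fun H => ind_nonneg _
    refine (abs_sub_le_one ?_ ?_ ?_ ?_).trans (by linarith)
    · exact avg_nonneg fun r => Ex_nonneg fun Y => Ex_nonneg fun ρ => ind_nonneg _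
    · exact avg_le fun r => Ex_le fun Y => Ex_le fun ρ => ind_le_one _
    · exact avg_nonneg fun r => Ex_nonneg fun Y => Ex_nonneg fun ρ => Ex_nonneg fun H =>
        ind_nonneg _
    · exact avg_le fun r => Ex_le fun Y => Ex_le fun ρ => Ex_le fun H => ind_le_one _

/-- Three losses are added: colliding or zero private keys, a hit for each special message, and one
ciphertext challenge for each message. The intermediate probability `mid` has fresh hash values but
the original contents. -/
theorem abs_realProb_sub_idealProb_le (hG : G.Proper) (C : Circuit)
    {sX : Finset sys.Key} (hsX : G.usedKeys ⊆ sX) {sρ : Finset ℕ} (hρ : ∀ h < G.m, h ∈ sρ)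
    {sH : Finset (List Bool)} (hs : ∀ q : List Bool, q.length ≤ C.size → q ∈ sH)
    (hsP : ∀ x, ∀ j ∈ G.indices, G.point x j ∈ sH) {N sM : ℕ} (hN : G.m ≤ N)
    (hM : sys.grp.MulCircuit ℓ sM) {εD εC : ℝ}
    (hεD : ∀ acc : sys.grp.Triple ℓ → Bool, Reach {f | f ∈ sys.grp.tripleBits ℓ}
      (ddhCost N C.size (sys.grp.len ℓ) sM) {acc} →
      |sys.grp.avgReal acc - sys.grp.avgRandom acc| ≤ εD)
    (hεC0 : 0 ≤ εC)
    (hεC : ∀ (m₀ m₁ : Bits (sys.ae.msgLen ℓ)) (acc : Bits (sys.ae.ctLen ℓ) → Bool),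
      Reach {f | f ∈ sys.ae.ctBits ℓ} (2 + lazyCost (2 * N) C.size) {acc} →
      |sys.ae.avgEnc m₁ acc - sys.ae.avgEnc m₀ acc| ≤ εC) :
    |G.realProb S R C sX sρ sH - G.idealProb S R C sX sρ sH| ≤
      4 * (G.m : ℝ) ^ 2 * (1 / sys.grp.p ℓ) +
        G.m * (εD + 2 * C.size * (1 / sys.grp.p ℓ)) + G.m * εC := by
  have hY : ∀ h < G.m, (h, false) ∈ Finset.range G.m ×ˢ (Finset.univ : Finset Bool) :=
    fun h hh => by simpa using hh
  set mid : ℝ := Ex sX fun x => avg fun r =>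
    G.hybrid S R x C r (Finset.range G.m ×ˢ Finset.univ) sρ sH 0 with hmid
  have h1 : |G.realProb S R C sX sρ sH - mid| ≤ 4 * (G.m : ℝ) ^ 2 * (1 / sys.grp.p ℓ) +
      G.m * (εD + 2 * C.size * (1 / sys.grp.p ℓ)) := by
    refine (abs_Ex_sub_le fun x => G.abs_realProb_sub_hybrid_le S R hG C x (hsP x)).trans ?_
    rw [Ex_add, Ex_sum]
    refine add_le_add (G.Ex_not_generic_le hsX) ?_
    have hnn : 0 ≤ εD + 2 * C.size * (1 / (sys.grp.p ℓ : ℝ)) := by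
      have := (abs_nonneg _).trans (hεD (fun _ => false)
        ((Reach.const_fn false).mono_cost (by unfold ddhCost; omega)))
      positivity
    refine (Finset.sum_le_card_nsmul _ _ (εD + 2 * C.size * (1 / (sys.grp.p ℓ : ℝ)))
      fun i hi => ?_).trans ?_
    · have him := ((G.mem_specials S R).1 hi).1
      exact G.Ex_hits_le S R hG C hi G.msg (hsX (G.sk_mem_usedKeys him))
        (hsX (G.rk_mem_usedKeys him)) _ _ hs hN hM hεD
    · rw [nsmul_eq_mul]
      refine mul_le_mul_of_nonneg_right ?_ hnn
      classical
      have : (G.specials S R).card ≤ G.m :=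
        (Finset.card_filter_le _ _).trans (Finset.card_range _).le
      exact_mod_cast this
  have h2 : |mid - G.idealProb S R C sX sρ sH| ≤ G.m * εC := by
    rw [abs_sub_comm]
    refine (abs_Ex_sub_le (H := fun _ => G.m * εC) fun x => ?_).trans (Ex_const _).le
    rw [← avg_sub]
    refine (abs_avg_le _).trans (avg_le fun r => ?_)
    exact G.hybrid_sub_le S R x C r hG hs hN hεC0 hεC hY hρ le_rfl
  have := abs_sub_le (G.realProb S R C sX sρ sH) mid (G.idealProb S R C sX sρ sH)
  linarith

end Game

/-! ### Cover traffic with nonnegative delays -/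

section Traffic

variable {n L : ℕ}

theorem monotone_arrival (a : ℝ) {d : ℕ → ℝ} (hd : ∀ k, 0 ≤ d k) : Monotone (arrival a d) :=
  monotone_nat_of_le_succ fun k => by
    simp only [arrival, Finset.sum_range_succ _ (k + 1)]
    linarith [hd (k + 1)]

theorem le_arrival (a : ℝ) {d : ℕ → ℝ} (hd : ∀ k, 0 ≤ d k) (k : ℕ) : a ≤ arrival a d k := by
  simp only [arrival, le_add_iff_nonneg_right]
  exact Finset.sum_nonneg fun i _ => hd i

/-- Nonnegative delays make arrival times monotone, so the indices counted form an initial segment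
of `ℕ`. This keeps all slots inside the session. -/
theorem arrival_lt_of_lt_countBefore {a t : ℝ} {d : ℕ → ℝ} (hd : ∀ k, 0 ≤ d k) {k : ℕ}
    (hk : k < countBefore a d t) : arrival a d k < t := by
  by_contra h
  have hsub : {i : ℕ | arrival a d i < t} ⊆ Set.Iio k := fun i hi => by
    by_contra hik
    exact h ((monotone_arrival a hd (not_lt.1 hik)).trans_lt hi)
  have := Set.ncard_le_ncard hsub (Set.finite_Iio k)
  rw [Set.ncard_Iio_nat] at this
  exact absurd hk (not_lt.2 this)

theorem mem_sortByTime {α : Type} {time : α → ℝ} {l : List α} {a : α} :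
    a ∈ sortByTime time l ↔ a ∈ l := by
  simp [sortByTime]

/-- Sorting preserves a relation between events at the same times. -/
theorem forall₂_sortByTime {α : Type} {time : α → ℝ} {r : α → α → Prop}
    (hr : ∀ a b, r a b → time a = time b) {l l' : List α} (h : List.Forall₂ r l l') :
    List.Forall₂ r (sortByTime time l) (sortByTime time l') := by
  classical
  -- Both lists are projections of one list of related pairs. Sorting the pairs by the time of the
  -- first component sorts both projections, because the two times agree.
  obtain ⟨z, hz, rfl, rfl⟩ : ∃ z : List (α × α), (∀ p ∈ z, r p.1 p.2) ∧ z.map Prod.fst = l ∧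
      z.map Prod.snd = l' := by
    induction h with
    | nil => exact ⟨[], by simp, rfl, rfl⟩
    | @cons a b _ _ hab _ ih =>
      obtain ⟨z, h1, rfl, rfl⟩ := ih
      exact ⟨(a, b) :: z, by simpa [hab] using h1, rfl, rfl⟩
  have h1 : sortByTime time (z.map Prod.fst) = (sortByTime (fun p => time p.1) z).map Prod.fst :=
    (List.map_mergeSort (f := Prod.fst) fun _ _ _ _ => rfl).symm
  have h2 : sortByTime time (z.map Prod.snd) = (sortByTime (fun p => time p.1) z).map Prod.snd :=
    (List.map_mergeSort (f := Prod.snd) fun p hp q hq => by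
      simp only [hr _ _ (hz p hp), hr _ _ (hz q hq)]).symm
  rw [h1, h2, List.forall₂_map_left_iff, List.forall₂_map_right_iff, List.forall₂_same]
  exact fun p hp => hz p (mem_sortByTime.1 hp)

variable (E : Activity n L) {d : KeyDelays n × SendDelays n}

theorem mem_slots (hd : (∀ i, 0 ≤ d.1 i) ∧ ∀ i, 0 ≤ d.2 i) {j i : Fin n} {x : ℝ × KeyId n}
    (hx : x ∈ slots E d j i) : E.Online j x.1 ∧ ∃ s k, x.2 = .cover j s k := by
  rw [slots, mem_sortByTime, List.mem_flatMap] at hx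
  obtain ⟨⟨s, a, b⟩, hs, hx⟩ := hx
  obtain ⟨k, hk, rfl⟩ := List.mem_map.1 hx
  rw [List.mem_range] at hk
  refine ⟨⟨(a, b), ?_, ?_, ?_⟩, s, _, rfl⟩
  · obtain ⟨⟨⟨a', b'⟩, s'⟩, h, h'⟩ := List.mem_map.1 hs
    simp only [Prod.mk.injEq] at h'
    obtain ⟨-, rfl, rfl⟩ := h'
    exact List.fst_mem_of_mem_zipIdx h
  · exact (le_arrival a (fun k => hd.1 _) 0).trans (le_arrival _ (fun k => hd.2 _) k)
  · exact arrival_lt_of_lt_countBefore (fun k => hd.2 _) hk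

/-- The essence of cover traffic: a slot is filled whatever the queue contains, so the queue has no
influence on when and how often messages are sent. -/
theorem emptyQueue_times (choice : KeyChoice) (dummy : Message L) (j i : Fin n) :
    ∀ (sl : List (ℝ × KeyId n)) (q : List (HiddenSend n L)),
    (emptyQueue choice dummy j i sl q).map RawSend.time = sl.map Prod.fst
  | [], _ => by simp [emptyQueue]
  | (t, κ) :: rest, [] => by simp [emptyQueue, emptyQueue_times choice dummy j i rest []]
  | (t, κ) :: rest, c :: cs => by
      rw [emptyQueue]
      split_ifs
      · rw [List.map_cons, emptyQueue_times choice dummy j i rest cs]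
        cases choice <;> rfl
      · rw [List.map_cons, emptyQueue_times choice dummy j i rest (c :: cs)]
        rfl

/-- A message in the output is a dummy message or a conversation message in some slot; which of the
two fills a given slot need not be followed. -/
theorem forall_mem_emptyQueue (choice : KeyChoice) (dummy : Message L) (j i : Fin n)
    (P : RawSend n L → Prop) : ∀ (sl : List (ℝ × KeyId n)) (q : List (HiddenSend n L)),
    (∀ x ∈ sl, P ⟨x.1, j, i, x.2, .medium i, dummy⟩) →
    (∀ x ∈ sl, ∀ c ∈ q, P (conversationPost choice x.1 x.2 c)) →
    ∀ m ∈ emptyQueue choice dummy j i sl q, P m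
  | [], _, _, _, m, hm => by simp [emptyQueue] at hm
  | (t, κ) :: rest, [], h1, h2, m, hm => by
      rw [emptyQueue] at hm
      rcases List.mem_cons.1 hm with rfl | hm
      · exact h1 (t, κ) (by simp)
      · exact forall_mem_emptyQueue choice dummy j i P rest [] (fun x hx => h1 x (by simp [hx]))
          (fun x hx c hc => by simp at hc) m hm
  | (t, κ) :: rest, c :: cs, h1, h2, m, hm => by
      rw [emptyQueue] at hm
      split_ifs at hm
      · rcases List.mem_cons.1 hm with rfl | hm
        · exact h2 (t, κ) (by simp) c (by simp)
        · exact forall_mem_emptyQueue choice dummy j i P rest cs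
            (fun x hx => h1 x (by simp [hx])) (fun x hx c hc => h2 x (by simp [hx]) c (by simp [hc]))
            m hm
      · rcases List.mem_cons.1 hm with rfl | hm
        · exact h1 (t, κ) (by simp)
        · exact forall_mem_emptyQueue choice dummy j i P rest (c :: cs)
            (fun x hx => h1 x (by simp [hx])) (fun x hx c hc => h2 x (by simp [hx]) c hc) m hm

/-- A message uses keys of its sender and its receiver. -/
structure RawSend.UsesOwnKeys (m : RawSend n L) : Prop where
  send : m.sendKey.owner = m.sender
  recv : m.recvKey.owner = m.receiver
  ne : m.sendKey ≠ m.recvKey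

/-- A message that uses the keys of its parties, is sent while its sender is online, and, if it is a
cover or conversation message from `S` to `R`, is awaited. -/
structure CoverPost (S R : Fin n) (j i : Fin n) (m : RawSend n L) : Prop where
  sender : m.sender = j
  receiver : m.receiver = i
  keys : m.UsesOwnKeys
  online : E.Online j m.time
  awaits : j = S → i = R → E.awaits m.recvKey m.sendKey

theorem coverPost_of_mem_coverPosts (hd : (∀ i, 0 ≤ d.1 i) ∧ ∀ i, 0 ≤ d.2 i)
    (choice : KeyChoice) (dummy : Message L) {S R j i : Fin n} (hij : i ≠ j)
    (hc : ∀ a ∈ E.calls, a.sender = S → a.receiver = R → E.awaits a.recvKey a.sendKey)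
    (hk : ∀ s k, E.awaits (.medium R) (.cover S s k)) :
    ∀ m ∈ coverPosts E d choice dummy j i, CoverPost E S R j i m := by
  refine forall_mem_emptyQueue choice dummy j i _ _ _ (fun x hx => ?_) fun x hx c hc' => ?_
  · obtain ⟨hon, s, k, hκ⟩ := mem_slots E hd hx
    refine ⟨rfl, rfl, ⟨?_, rfl, ?_⟩, hon, ?_⟩
    · simp [hκ, KeyId.owner]
    · simp [hκ]
    · rintro rfl rfl
      simp only [hκ]
      exact hk s k
  · obtain ⟨hon, s, k, hκ⟩ := mem_slots E hd hx
    rw [mem_sortByTime, List.mem_filter, decide_eq_true_eq] at hc'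
    obtain ⟨hmem, rfl, rfl⟩ := hc'
    cases choice with
    | coverKey =>
      refine ⟨rfl, rfl, ⟨?_, rfl, ?_⟩, hon, ?_⟩
      · simp [conversationPost, hκ, KeyId.owner]
      · simp [conversationPost, hκ]
      · rintro rfl rfl
        simp only [conversationPost, hκ]
        exact hk s k
    | conversationKey =>
      have hS : c.sendKey.owner = c.sender := by
        unfold HiddenSend.sendKey; cases c.role <;> rfl
      have hR : c.recvKey.owner = c.receiver := by
        unfold HiddenSend.recvKey; cases c.role <;> rfl
      -- The two keys of a conversation differ because their owners do.
      refine ⟨rfl, rfl, ⟨hS, hR, fun h => hij ?_⟩, hon, hc c hmem⟩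
      simp only [conversationPost] at h
      rw [← hR, ← h, hS]

/-- A message as it occurs when `S` sends to `R` in time. -/
structure SoundPost (lifetime : ℝ) (S R : Fin n) (m : RawSend n L) : Prop where
  keys : m.UsesOwnKeys
  timely : m.sender = S → m.receiver = R → Timely E lifetime m

/-- Messages that are the same, or both go from `S` to `R` at the same time and are awaited. -/
def SamePost (S R : Fin n) (m m' : RawSend n L) : Prop :=
  m = m' ∨ (m.sender = S ∧ m.receiver = R ∧ E.awaits m.recvKey m.sendKey) ∧
    (m'.sender = S ∧ m'.receiver = R ∧ E.awaits m'.recvKey m'.sendKey) ∧ m.time = m'.time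

/-- Events that are the same up to messages from `S` to `R`. -/
inductive SameEvent (S R : Fin n) : Event n L → Event n L → Prop
  | refl (e : Event n L) : SameEvent S R e e
  | post {m m' : RawSend n L} (h : SamePost E S R m m') : SameEvent S R (.post m) (.post m')

theorem SameEvent.time_eq {S R : Fin n} {e e' : Event n L} (h : SameEvent E S R e e') :
    e.time = e'.time := by
  cases h with
  | refl => rfl
  | post h =>
    rcases h with rfl | ⟨-, -, h⟩
    · rfl
    · exact h

variable {lifetime : ℝ} {S R : Fin n}

/-- Whatever `S` sends, cover traffic or reply, is sent while `S` is online, and then `R` comes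
online in time. Nothing is claimed about replies being awaited: they occur unchanged in both
scenarios. -/
theorem soundPost_of_mem_events (hd : (∀ i, 0 ≤ d.1 i) ∧ ∀ i, 0 ≤ d.2 i)
    (choice : KeyChoice) (dummy : Message L)
    (hc : ∀ a ∈ E.calls, a.sender = S → a.receiver = R → E.awaits a.recvKey a.sendKey)
    (hk : ∀ s k, E.awaits (.medium R) (.cover S s k))
    (ht : ∀ t, E.Online S t → ∃ t', t ≤ t' ∧ t' ≤ t + lifetime ∧ E.Online R t')
    {m : RawSend n L} (hm : .post m ∈ events E d choice dummy) : SoundPost E lifetime S R m := by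
  rw [events, mem_sortByTime, List.mem_append, List.mem_append] at hm
  rcases hm with (hm | hm) | hm
  · obtain ⟨j, -, hm⟩ := List.mem_flatMap.1 hm
    obtain ⟨x, -, hm⟩ := List.mem_flatMap.1 hm
    obtain ⟨k, -, hm⟩ := List.mem_map.1 hm
    cases hm
  · obtain ⟨m', hm', hm⟩ := List.mem_map.1 hm
    cases hm
    obtain ⟨a, ha, rfl⟩ := List.mem_map.1 hm'
    replace ha := List.mem_filter.1 ha
    simp only [decide_eq_true_eq] at ha
    refine ⟨⟨rfl, rfl, by simp⟩, fun h1 h2 => ?_⟩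
    simp only at h1 h2
    obtain ⟨t', h3, h4, h5⟩ := ht a.time (h1 ▸ ha.2)
    exact ⟨t', h3, h4, by simpa only [h2] using h5⟩
  · obtain ⟨j, -, hm⟩ := List.mem_flatMap.1 hm
    obtain ⟨i, hi, hm⟩ := List.mem_flatMap.1 hm
    obtain ⟨m', hm', hm⟩ := List.mem_map.1 hm
    cases hm
    rw [List.mem_filter, decide_eq_true_eq] at hi
    have h := coverPost_of_mem_coverPosts E hd choice dummy hi.2 hc hk _ hm'
    refine ⟨h.keys, fun h1 h2 => ?_⟩
    have hon := h.online
    rw [← h.sender, h1] at hon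
    obtain ⟨t', h3, h4, h5⟩ := ht _ hon
    exact ⟨t', h3, h4, h2 ▸ h5⟩

/-- A further call of `PH.HiddenSend` from `S` to `R` changes only messages from `S` to `R`. -/
theorem forall₂_events_addCall (hd : (∀ i, 0 ≤ d.1 i) ∧ ∀ i, 0 ≤ d.2 i)
    (choice : KeyChoice) (dummy : Message L) (c : HiddenSend n L) (hcS : c.sender = S)
    (hcR : c.receiver = R)
    (hc : ∀ a ∈ (E.addCall c).calls, a.sender = S → a.receiver = R →
      E.awaits a.recvKey a.sendKey)
    (hk : ∀ s k, E.awaits (.medium R) (.cover S s k)) :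
    List.Forall₂ (SameEvent E S R) (events E d choice dummy)
      (events (E.addCall c) d choice dummy) := by
  refine forall₂_sortByTime (fun _ _ h => SameEvent.time_eq E h) ?_
  refine List.rel_append ?_ ?_
  · exact List.forall₂_same.2 fun e _ => .refl e
  have hflat : ∀ {ι : Type} (l : List ι) (f g : ι → List (Event n L)),
      (∀ i ∈ l, List.Forall₂ (SameEvent E S R) (f i) (g i)) →
      List.Forall₂ (SameEvent E S R) (l.flatMap f) (l.flatMap g) := by
    intro ι l f g h
    induction l with
    | nil => exact .nil
    | cons i l ih =>
      simp only [List.flatMap_cons]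
      exact List.rel_append (h i (by simp)) (ih fun k hk => h k (by simp [hk]))
  refine hflat _ _ _ fun j _ => hflat _ _ _ fun i hi => ?_
  rw [List.mem_filter, decide_eq_true_eq] at hi
  by_cases hji : j = S ∧ i = R
  · obtain ⟨rfl, rfl⟩ := hji
    have h0 := coverPost_of_mem_coverPosts E hd choice dummy hi.2 (S := j) (R := i)
      (fun a ha => hc a (List.mem_cons_of_mem _ ha)) hk
    have h1 := coverPost_of_mem_coverPosts (E.addCall c) hd choice dummy hi.2 (S := j) (R := i)
      hc hk
    -- The slots are determined by sessions and delays, which the further call does not affect. This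
    -- matches the two lists entry by entry.
    have htimes : (coverPosts E d choice dummy j i).map RawSend.time =
        (coverPosts (E.addCall c) d choice dummy j i).map RawSend.time := by
      rw [coverPosts, coverPosts, emptyQueue_times, emptyQueue_times]
      rfl
    generalize coverPosts E d choice dummy j i = l at h0 htimes
    generalize coverPosts (E.addCall c) d choice dummy j i = l' at h1 htimes
    induction l generalizing l' with
    | nil =>
      cases l' with
      | nil => exact .nil
      | cons _ _ => simp at htimes
    | cons m l ih =>
      cases l' with
      | nil => simp at htimes
      | cons m' l' =>
        simp only [List.map_cons, List.cons.injEq] at htimes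
        have a0 := h0 m (by simp)
        have a1 := h1 m' (by simp)
        exact .cons (.post (Or.inr ⟨⟨a0.sender, a0.receiver, a0.awaits rfl rfl⟩,
          ⟨a1.sender, a1.receiver, a1.awaits rfl rfl⟩, htimes.1⟩))
          (ih (fun x hx => h0 x (by simp [hx])) l' (fun x hx => h1 x (by simp [hx])) htimes.2)
  · have hq : (E.addCall c).calls.filter (fun a => decide (a.sender = j ∧ a.receiver = i)) =
        E.calls.filter (fun a => decide (a.sender = j ∧ a.receiver = i)) := by
      refine List.filter_cons_of_neg ?_
      rw [decide_eq_true_eq, hcS, hcR]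
      exact fun h => hji ⟨h.1.symm, h.2.symm⟩
    have : coverPosts (E.addCall c) d choice dummy j i = coverPosts E d choice dummy j i := by
      rw [coverPosts, coverPosts, hq]
      rfl
    rw [this]
    exact List.forall₂_same.2 fun e _ => .refl e

/-! ### Retrieval -/

theorem not_samePair_of_owner {S R : Fin n} {m m' : RawSend n L} (hm : m.UsesOwnKeys)
    (hm' : m'.UsesOwnKeys) (h : ¬(m.sender = S ∧ m.receiver = R))
    (h' : m'.sender = S ∧ m'.receiver = R) :
    ¬(m'.sendKey = m.sendKey ∧ m'.recvKey = m.recvKey) := by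
  rintro ⟨h1, h2⟩
  exact h ⟨by rw [← hm.send, ← h1, hm'.send, h'.1], by rw [← hm.recv, ← h2, hm'.recv, h'.2]⟩

/-- The keys of a message determine its sender and its receiver. Earlier messages from `S` to `R`,
the only ones that may have changed, do not count for a message between other parties. -/
theorem samePair_congr {past past' : List (RawSend n L)}
    (h : List.Forall₂ (SamePost E S R) past past') (hp : ∀ m ∈ past, m.UsesOwnKeys)
    (hp' : ∀ m ∈ past', m.UsesOwnKeys) {m : RawSend n L} (hm : m.UsesOwnKeys)
    (hSR : ¬(m.sender = S ∧ m.receiver = R)) : samePair past m = samePair past' m := by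
  classical
  induction h with
  | nil => rfl
  | @cons a b l l' hab _ ih =>
    have ih := ih (fun x hx => hp x (by simp [hx])) (fun x hx => hp' x (by simp [hx]))
    simp only [samePair] at ih ⊢
    rcases hab with rfl | ⟨h1, h2, -⟩
    · simp only [List.filter_cons, ih]
    · rw [List.filter_cons_of_neg, List.filter_cons_of_neg, ih]
      · simpa only [decide_eq_true_eq] using
          not_samePair_of_owner hm (hp' b (by simp)) hSR ⟨h2.1, h2.2.1⟩
      · simpa only [decide_eq_true_eq] using
          not_samePair_of_owner hm (hp a (by simp)) hSR ⟨h1.1, h1.2.1⟩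

/-- Earlier messages with the same two keys also go from `S` to `R`, so they are all timely, and no
gap in the counters can stop `R`. -/
theorem retrieved_iff_awaits {past : List (RawSend n L)}
    (hp : ∀ m ∈ past, SoundPost E lifetime S R m) {m : RawSend n L}
    (hm : SoundPost E lifetime S R m) (hS : m.sender = S) (hR : m.receiver = R) :
    Retrieved E lifetime past m ↔ E.awaits m.recvKey m.sendKey := by
  refine ⟨fun h => h.1, fun h => ⟨h, hm.timely hS hR, fun m' hm' => ?_⟩⟩
  rw [samePair, List.mem_filter, decide_eq_true_eq] at hm'
  have hk := (hp m' hm'.1).keys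
  refine (hp m' hm'.1).timely ?_ ?_
  · rw [← hk.send, hm'.2.1, hm.keys.send, hS]
  · rw [← hk.recv, hm'.2.2, hm.keys.recv, hR]

theorem retrievalTime_congr {past past' : List (RawSend n L)}
    (h : List.Forall₂ (SamePost E S R) past past') (hp : ∀ m ∈ past, SoundPost E lifetime S R m)
    (hp' : ∀ m ∈ past', SoundPost E lifetime S R m) {m m' : RawSend n L}
    (hmm : SamePost E S R m m') (hm : SoundPost E lifetime S R m)
    (hm' : SoundPost E lifetime S R m') :
    retrievalTime E lifetime past m = retrievalTime E lifetime past' m' := by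
  rcases hmm with rfl | ⟨h1, h2, h3⟩
  · have : Retrieved E lifetime past m ↔ Retrieved E lifetime past' m := by
      -- Even an unchanged message from `S` to `R`, such as a reply, may share its two keys with
      -- conversation messages, so its predecessors may differ in the two scenarios. Retrieval then
      -- depends only on whether the pair of keys is awaited.
      by_cases hSR : m.sender = S ∧ m.receiver = R
      · rw [retrieved_iff_awaits E hp hm hSR.1 hSR.2, retrieved_iff_awaits E hp' hm hSR.1 hSR.2]
      · rw [Retrieved, Retrieved, samePair_congr E h (fun x hx => (hp x hx).keys)
          (fun x hx => (hp' x hx).keys) hm.keys hSR]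
    classical
    unfold retrievalTime
    exact if_congr this rfl rfl
  · have e0 := (retrieved_iff_awaits E hp hm h1.1 h1.2.1).2 h1.2.2
    have e1 := (retrieved_iff_awaits E hp' hm' h2.1 h2.2.1).2 h2.2.2
    rw [retrievalTime, retrievalTime, if_pos e0, if_pos e1, h1.2.1, h2.2.1, h3]

end Traffic

/-- A special message contributes a fresh address and an encryption of the dummy message under a
fresh key, both indexed by its position. Its own keys, counter and contents do not enter, apart from
the fact that it is special. -/
theorem Game.idealProb_congr {sys : System} {ℓ : ℕ} {G G' : Game sys ℓ} (S R : Fin sys.n)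
    (hm : G.m = G'.m) (hview : G.view = G'.view)
    (hsp : ∀ i < G.m, sys.Special S R (G.sk i) (G.rk i) ↔ sys.Special S R (G'.sk i) (G'.rk i))
    (hsame : ∀ i < G.m, ¬sys.Special S R (G.sk i) (G.rk i) →
      G.sk i = G'.sk i ∧ G.rk i = G'.rk i ∧ G.ns i = G'.ns i ∧ G.msg i = G'.msg i)
    (C : Circuit) (sX : Finset sys.Key) (sρ : Finset ℕ) (sH : Finset (List Bool)) :
    G.idealProb S R C sX sρ sH = G'.idealProb S R C sX sρ sH := by
  classical
  have hord : G.ordinary S R = G'.ordinary S R := by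
    rw [ordinary, ordinary, indices, indices, ← hm]
    refine List.filter_congr fun j hj => ?_
    have hj : j.1 < G.m := G.mem_indices.1 hj
    simp only [hsp j.1 hj]
  have htab : ∀ x Y, G.table x Y (G.ordinary S R) = G'.table x Y (G'.ordinary S R) := by
    intro x Y
    rw [table, table, ← hord]
    refine List.map_congr_left fun j hj => ?_
    obtain ⟨h1, h2⟩ := (G.mem_ordinary S R).1 hj
    obtain ⟨h3, h4, h5, -⟩ := hsame j.1 h1 h2
    rw [point, point, h3, h4, h5]
  have hin : ∀ x Y ρ, G.input S R x Y ρ (G.hybridMsg S R G.m) =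
      G'.input S R x Y ρ (G'.hybridMsg S R G'.m) := by
    intro x Y ρ
    rw [input, input, hview]
    congr 1
    funext i
    rw [posted, posted, ← hm]
    refine if_ctx_congr Iff.rfl (fun hi => ?_) fun _ => rfl
    have : G.hybridMsg S R G.m i = G'.hybridMsg S R G.m i := by
      by_cases hs : sys.Special S R (G.sk i) (G.rk i)
      · rw [hybridMsg, hybridMsg, if_pos ⟨hi, hs⟩, if_pos ⟨hi, (hsp i hi).1 hs⟩]
      · rw [hybridMsg, hybridMsg, if_neg fun h => hs h.2,
          if_neg fun h => hs ((hsp i hi).2 h.2), (hsame i hi hs).2.2.2]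
    rw [this]
  simp only [idealProb, hybrid, htab, hin, ← hm]

/-! ### The view of the server as a game. -/

section EventGame

variable {n L : ℕ}

/-- The messages among a list of events. -/
def postsOf : List (Event n L) → List (RawSend n L)
  | [] => []
  | .upload _ _ _ _ :: es => postsOf es
  | .post m :: es => m :: postsOf es

theorem length_postsOf_le : ∀ es : List (Event n L), (postsOf es).length ≤ es.length
  | [] => le_rfl
  | .upload _ _ _ _ :: es => (length_postsOf_le es).trans (by simp)
  | .post m :: es => by simpa [postsOf] using length_postsOf_le es

theorem mem_postsOf {m : RawSend n L} : ∀ {es : List (Event n L)}, m ∈ postsOf es ↔ .post m ∈ es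
  | [] => by simp [postsOf]
  | .upload _ _ _ _ :: es => by simp [postsOf, mem_postsOf (es := es)]
  | .post m' :: es => by simp [postsOf, mem_postsOf (es := es)]

theorem forall₂_postsOf {E : Activity n L} {S R : Fin n} {es es' : List (Event n L)}
    (h : List.Forall₂ (SameEvent E S R) es es') :
    List.Forall₂ (SamePost E S R) (postsOf es) (postsOf es') := by
  induction h with
  | nil => exact .nil
  | @cons e e' _ _ hab _ ih =>
    cases hab with
    | refl =>
      cases e with
      | upload => exact ih
      | post m => exact .cons (Or.inl rfl) ih
    | post h => exact .cons h ih

variable (sys : System) {ℓ : ℕ} (torBroken : Bool) (S R : Fin sys.n) (τ : ℕ)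
  (E : Activity sys.n (sys.ae.msgLen ℓ))

namespace System

/-- The time of retrieval, as far as visible. -/
def retrievalBits (past : List (RawSend sys.n (sys.ae.msgLen ℓ)))
    (m : RawSend sys.n (sys.ae.msgLen ℓ)) : List Bool :=
  match retrievalTime E sys.lifetime past m with
  | some t => true :: stamp τ t
  | none => [false]

/-- The transcript with information `kb` on keys and addresses and ciphertexts `ac`. -/
def transcriptWith (kb : sys.Key → List Bool) (ac : ℕ → List Bool) :
    List (RawSend sys.n (sys.ae.msgLen ℓ)) → List (Event sys.n (sys.ae.msgLen ℓ)) → List Bool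
  | _, [] => []
  | past, .upload t j s k :: rest =>
      (false :: (stamp τ t ++ sys.identity torBroken j ++ kb (.cover j s k))) ++
        transcriptWith kb ac past rest
  | past, .post m :: rest =>
      (true :: (stamp τ m.time ++ sys.identity torBroken m.sender ++
        sys.identity torBroken m.receiver ++ ac past.length ++ sys.retrievalBits τ E past m)) ++
        transcriptWith kb ac (past ++ [m]) rest

/-- The public keys on the bulletin board from the start, with information `kb` on keys. -/
def boardWith (kb : sys.Key → List Bool) : List Bool :=
  (List.finRange sys.n).flatMap fun j =>
    kb (.medium j) ++ (List.range (E.queries j)).flatMap fun q => kb (.query j q)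

end System

/-- The `i`-th message, or a default. -/
def System.postAt (ps : List (RawSend sys.n (sys.ae.msgLen ℓ))) (i : ℕ) :
    RawSend sys.n (sys.ae.msgLen ℓ) :=
  ps.getD i ⟨0, S, S, .medium S, .medium S, sys.dummy ℓ⟩

/-- The view of a list of events. -/
def System.eventGame (es : List (Event sys.n (sys.ae.msgLen ℓ))) : Game sys ℓ where
  m := (postsOf es).length
  sk i := (sys.postAt S (postsOf es) i).sendKey
  rk i := (sys.postAt S (postsOf es) i).recvKey
  ns i := (samePair ((postsOf es).take i) (sys.postAt S (postsOf es) i)).length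
  msg i := pad (sys.postAt S (postsOf es) i).msg
  view kb ac := sys.boardWith E kb ++ sys.transcriptWith torBroken τ E kb ac [] es

namespace System

variable {sys}

theorem postAt_eq_getElem {ps : List (RawSend sys.n (sys.ae.msgLen ℓ))} {i : ℕ}
    (hi : i < ps.length) : sys.postAt S ps i = ps[i] := by
  simp [postAt, hi]

theorem postAt_mem {ps : List (RawSend sys.n (sys.ae.msgLen ℓ))} {i : ℕ}
    (hi : i < ps.length) : sys.postAt S ps i ∈ ps := by
  rw [postAt_eq_getElem S hi]
  exact List.getElem_mem hi

/-- The earlier message is itself one of the predecessors of the later one, so counters increase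
strictly along a pair of keys. This makes the points of different messages different. -/
theorem length_samePair_lt {n L : ℕ} {ps : List (RawSend n L)} {i j : ℕ} (hij : i < j)
    (hj : j < ps.length)
    (h : ps[i].sendKey = ps[j].sendKey ∧ ps[i].recvKey = ps[j].recvKey) :
    (samePair (ps.take i) ps[i]).length < (samePair (ps.take j) ps[j]).length := by
  classical
  have h1 : (samePair (ps.take (i + 1)) ps[j]).length = (samePair (ps.take i) ps[i]).length + 1 := by
    rw [List.take_succ_eq_append_getElem (by omega)]
    rw [samePair, samePair, List.filter_append, List.length_append, h.1, h.2]
    congr 1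
    simp [h.1, h.2]
  have h2 : (samePair (ps.take (i + 1)) ps[j]).Sublist (samePair (ps.take j) ps[j]) :=
    (List.take_sublist_take_left (by omega)).filter _
  have := h2.length_le
  omega

theorem assembled_transcriptWith {α : Type} {A : Set (α → Bool)} (hA : ∀ b, (fun _ => b) ∈ A)
    {kb : α → sys.Key → List Bool} {ac : α → ℕ → List Bool}
    (hk : ∀ u, Assembled A fun a => kb a u) (hac : ∀ i, Assembled A fun a => ac a i) :
    ∀ (es : List (Event sys.n (sys.ae.msgLen ℓ))) (past : List (RawSend sys.n (sys.ae.msgLen ℓ))),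
    Assembled A fun a => sys.transcriptWith torBroken τ E (kb a) (ac a) past es
  | [], _ => .const hA []
  | .upload _ _ _ _ :: es, past =>
      .append (.cons hA false (.append (.const hA _) (hk _)))
        (assembled_transcriptWith hA hk hac es past)
  | .post m :: es, past =>
      .append (.cons hA true (.append (.append (.const hA _) (hac _)) (.const hA _)))
        (assembled_transcriptWith hA hk hac es (past ++ [m]))

theorem eventGame_proper {es : List (Event sys.n (sys.ae.msgLen ℓ))}
    (hs : ∀ m ∈ postsOf es, m.UsesOwnKeys) : (sys.eventGame torBroken S τ E es).Proper where
  ne i hi := (hs _ (postAt_mem S hi)).ne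
  inj i hi j hj h1 h2 h3 := by
    simp only [eventGame] at hi hj h1 h2 h3
    rw [postAt_eq_getElem S hi, postAt_eq_getElem S hj] at h1 h2 h3
    rcases lt_trichotomy i j with h | h | h
    · exact absurd h3 (length_samePair_lt h hj ⟨h1, h2⟩).ne
    · exact h
    · exact absurd h3 (length_samePair_lt h hi ⟨h1.symm, h2.symm⟩).ne'
  ns_le i hi := (List.length_filter_le _ _).trans (by simp [eventGame])
  assembled A hA kb ac hk hac :=
    .append (.flatMap _ _ fun _ => .append (hk _) (.flatMap _ _ fun _ => hk _))
      (assembled_transcriptWith torBroken τ E hA hk hac es [])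

/-! ### The view of the server -/

/-- The full list `ps` of messages stays fixed in the induction, while `past` grows along it; the
position of a message in `ps` is the index of its address, ciphertext and coins. -/
theorem transcript_eq (ω : sys.Secrets ℓ) {kb : sys.Key → List Bool} {ac : ℕ → List Bool}
    (hkb : ∀ u, kb u = sys.keyBits ω S R u.owner u)
    (ps : List (RawSend sys.n (sys.ae.msgLen ℓ)))
    (hac : ∀ past m rest, ps = past ++ m :: rest → ac past.length =
      List.ofFn (sys.hash ω addrTag m.sendKey m.recvKey (samePair past m).length) ++
      List.ofFn (sys.ae.enc ℓ (sys.hash ω keyTag m.sendKey m.recvKey (samePair past m).length)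
        (pad m.msg) (ω.2.1 past.length))) :
    ∀ (es : List (Event sys.n (sys.ae.msgLen ℓ))) (past : List (RawSend sys.n (sys.ae.msgLen ℓ))),
    ps = past ++ postsOf es →
    sys.transcript ω torBroken S R τ E past es = sys.transcriptWith torBroken τ E kb ac past es
  | [], _, _ => rfl
  | .upload t j s k :: es, past, h => by
      rw [transcript, transcriptWith, hkb, transcript_eq ω hkb ps hac es past h]
      rfl
  | .post m :: es, past, h => by
      rw [transcript, transcriptWith, hac past m _ h,
        transcript_eq ω hkb ps hac es (past ++ [m]) (by rw [h]; simp [postsOf])]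
      simp only [postBits, retrievalBits, List.append_assoc]

theorem view_eq_input (ω : sys.Secrets ℓ) (es : List (Event sys.n (sys.ae.msgLen ℓ))) :
    ((List.finRange sys.n).flatMap fun j =>
      sys.keyBits ω S R j (.medium j) ++
        (List.range (E.queries j)).flatMap fun q => sys.keyBits ω S R j (.query j q)) ++
    sys.transcript ω torBroken S R τ E [] es =
    (sys.eventGame torBroken S τ E es).input S R ω.1
      (fun j => ω.2.2 ((sys.eventGame torBroken S τ E es).point ω.1 j)) ω.2.1
      (sys.eventGame torBroken S τ E es).msg := by
  have hkb : ∀ u, Game.keys S R ω.1 u = sys.keyBits ω S R u.owner u := fun u => rfl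
  rw [Game.input]
  refine congrArg₂ _ rfl ?_
  refine transcript_eq torBroken S R τ E ω hkb (postsOf es) (fun past m rest h => ?_) es [] rfl
  have h1 : past.length < (postsOf es).length := by simp [h]
  have h2 : sys.postAt S (postsOf es) past.length = m := by simp [postAt, h]
  have h3 : (postsOf es).take past.length = past := by simp [h]
  rw [Game.posted, if_pos (show past.length < (sys.eventGame torBroken S τ E es).m from h1)]
  simp only [Game.point, eventGame, h2, h3]
  rfl

/-- Every event begins with a bit that tells uploads from messages, so it contributes at least one
bit, and `N` bits are exhausted after at most `N` events. -/
theorem transcript_take (ω : sys.Secrets ℓ) :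
    ∀ (N : ℕ) (es : List (Event sys.n (sys.ae.msgLen ℓ)))
      (past : List (RawSend sys.n (sys.ae.msgLen ℓ))),
    (sys.transcript ω torBroken S R τ E past es).take N =
      (sys.transcript ω torBroken S R τ E past (es.take N)).take N := by
  have key : ∀ (N : ℕ) (b : Bool) (l t t' : List Bool), t.take N = t'.take N →
      ((b :: l) ++ t).take (N + 1) = ((b :: l) ++ t').take (N + 1) := by
    intro N b l t t' h
    rw [List.cons_append, List.cons_append, List.take_succ_cons, List.take_succ_cons,
      List.take_append, List.take_append]
    congr 2
    have := congrArg (List.take (N - l.length)) h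
    simpa [List.take_take] using this
  intro N
  induction N with
  | zero => intros; simp
  | succ N ih =>
    intro es past
    cases es with
    | nil => rfl
    | cons e es =>
      cases e with
      | upload t j s k => exact key _ _ _ _ _ (ih es past)
      | post m => exact key _ _ _ _ _ (ih es (past ++ [m]))

end System

theorem toBits_eq_of_take {N : ℕ} {l l' : List Bool} (h : l.take N = l'.take N) :
    toBits N l = toBits N l' := by
  funext i
  have := congrArg (fun l => l.getD i false) h
  simpa [toBits, List.getD_eq_getElem?_getD, List.getElem?_take] using this

theorem Circuit.accepts_congr (C : Circuit) (O : Oracle) {x x' : List Bool}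
    (h : x.take C.inputs = x'.take C.inputs) (r : Bits C.coins) :
    C.Accepts O x r ↔ C.Accepts O x' r := by
  rw [Circuit.Accepts, Circuit.Accepts, Circuit.run, Circuit.run, Circuit.exec, Circuit.exec,
    toBits_eq_of_take h]

namespace System

variable {sys}

/-- Only `C.inputs` bits are read, so the list of events may be cut off at that length. The number
of messages in the game is thereby bounded by the size of the circuit, for all delays. -/
theorem accepts_view_iff (ω : sys.Secrets ℓ) (choice : KeyChoice)
    (d : KeyDelays sys.n × SendDelays sys.n) (C : Circuit) (r : Bits C.coins)
    {G : Game sys ℓ} (hG : G = sys.eventGame torBroken S τ E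
      ((events E d choice (sys.dummy ℓ)).take C.inputs)) :
    C.Accepts (fun _ q => List.ofFn (ω.2.2 q)) (sys.view ω torBroken S R τ E choice d) r ↔
      C.AcceptsWires (C.hashRun r ω.2.2 (G.input S R ω.1 (fun j => ω.2.2 (G.point ω.1 j)) ω.2.1
        G.msg)).1 := by
  rw [← Circuit.accepts_iff, hG, ← view_eq_input, view]
  refine C.accepts_congr _ ?_ r
  rw [List.take_append, List.take_append]
  congr 1
  have := congrArg (List.take (C.inputs - ((List.finRange sys.n).flatMap fun j =>
    sys.keyBits ω S R j (.medium j) ++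
      (List.range (E.queries j)).flatMap fun q => sys.keyBits ω S R j (.query j q)).length))
    (transcript_take torBroken S R τ E ω C.inputs (events E d choice (sys.dummy ℓ)) [])
  simpa [List.take_take] using this

/-! ### The ideal view does not depend on the messages from `S` to `R` -/

variable {torBroken S R τ E}

/-- Apart from addresses and ciphertexts, a message shows its times of posting and retrieval and the
identities of its parties; these agree for corresponding messages. -/
theorem transcriptWith_congr (kb : sys.Key → List Bool) (ac : ℕ → List Bool)
    {es es' : List (Event sys.n (sys.ae.msgLen ℓ))} (h : List.Forall₂ (SameEvent E S R) es es') :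
    ∀ {past past' : List (RawSend sys.n (sys.ae.msgLen ℓ))},
    List.Forall₂ (SamePost E S R) past past' →
    (∀ m ∈ past, SoundPost E sys.lifetime S R m) → (∀ m ∈ past', SoundPost E sys.lifetime S R m) →
    (∀ m ∈ postsOf es, SoundPost E sys.lifetime S R m) →
    (∀ m ∈ postsOf es', SoundPost E sys.lifetime S R m) →
    sys.transcriptWith torBroken τ E kb ac past es =
      sys.transcriptWith torBroken τ E kb ac past' es' := by
  induction h with
  | nil => intros; rfl
  | @cons e e' es es' hab _ ih =>
    intro past past' hp h1 h2 h3 h4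
    have step : ∀ m m', SamePost E S R m m' →
        (∀ a ∈ m :: postsOf es, SoundPost E sys.lifetime S R a) →
        (∀ a ∈ m' :: postsOf es', SoundPost E sys.lifetime S R a) →
        sys.transcriptWith torBroken τ E kb ac past (.post m :: es) =
          sys.transcriptWith torBroken τ E kb ac past' (.post m' :: es') := by
      intro m m' hmm h3 h4
      have hm := h3 m (by simp)
      have hm' := h4 m' (by simp)
      rw [transcriptWith, transcriptWith, retrievalBits, retrievalBits,
        retrievalTime_congr E hp h1 h2 hmm hm hm', hp.length_eq,
        ih (List.rel_append hp (.cons hmm .nil))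
          (fun a ha => (List.mem_append.1 ha).elim (h1 a) fun ha => by
            rw [List.mem_singleton.1 ha]; exact hm)
          (fun a ha => (List.mem_append.1 ha).elim (h2 a) fun ha => by
            rw [List.mem_singleton.1 ha]; exact hm')
          (fun a ha => h3 a (by simp [ha])) fun a ha => h4 a (by simp [ha])]
      rcases hmm with rfl | ⟨e1, e2, e3⟩
      · rfl
      · rw [e1.1, e1.2.1, e2.1, e2.2.1, e3]
    cases hab with
    | refl =>
      cases e with
      | upload t j s k =>
        rw [transcriptWith, transcriptWith, ih hp h1 h2 h3 h4]
      | post m => exact step m m (Or.inl rfl) h3 h4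
    | @post m m' hmm => exact step m m' hmm h3 h4

theorem idealProb_eventGame_congr {es es' : List (Event sys.n (sys.ae.msgLen ℓ))}
    (h : List.Forall₂ (SameEvent E S R) es es')
    (hs : ∀ m ∈ postsOf es, SoundPost E sys.lifetime S R m)
    (hs' : ∀ m ∈ postsOf es', SoundPost E sys.lifetime S R m)
    (C : Circuit) (sX : Finset sys.Key) (sρ : Finset ℕ) (sH : Finset (List Bool)) :
    (sys.eventGame torBroken S τ E es).idealProb S R C sX sρ sH =
      (sys.eventGame torBroken S τ E es').idealProb S R C sX sρ sH := by
  have hp := forall₂_postsOf h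
  have hlen := hp.length_eq
  have hpost : ∀ i < (postsOf es).length,
      SamePost E S R (sys.postAt S (postsOf es) i) (sys.postAt S (postsOf es') i) := by
    intro i hi
    rw [postAt_eq_getElem S hi, postAt_eq_getElem S (hlen ▸ hi)]
    exact (List.forall₂_iff_get.1 hp).2 i hi (hlen ▸ hi)
  have hkeys : ∀ i < (postsOf es).length, (sys.postAt S (postsOf es) i).UsesOwnKeys :=
    fun i hi => (hs _ (postAt_mem S hi)).keys
  have hkeys' : ∀ i < (postsOf es).length, (sys.postAt S (postsOf es') i).UsesOwnKeys :=
    fun i hi => (hs' _ (postAt_mem S (hlen ▸ hi))).keys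
  have hspecial : ∀ m : RawSend sys.n (sys.ae.msgLen ℓ), m.UsesOwnKeys →
      m.sender = S → m.receiver = R → sys.Special S R m.sendKey m.recvKey :=
    fun m hm h1 h2 => Or.inl ⟨hm.send.trans h1, hm.recv.trans h2⟩
  refine Game.idealProb_congr S R hlen ?_ (fun i hi => ?_) (fun i hi hns => ?_) C sX sρ sH
  · funext kb ac
    exact congrArg _ (transcriptWith_congr kb ac h .nil (by simp) (by simp) hs hs')
  · change sys.Special S R (sys.postAt S (postsOf es) i).sendKey _ ↔
      sys.Special S R (sys.postAt S (postsOf es') i).sendKey _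
    rcases hpost i hi with e | ⟨e1, e2, -⟩
    · change sys.Special S R _ (sys.postAt S (postsOf es) i).recvKey ↔
        sys.Special S R _ (sys.postAt S (postsOf es') i).recvKey
      rw [e]
    · exact iff_of_true (hspecial _ (hkeys i hi) e1.1 e1.2.1) (hspecial _ (hkeys' i hi) e2.1 e2.2.1)
  · change ¬sys.Special S R (sys.postAt S (postsOf es) i).sendKey
      (sys.postAt S (postsOf es) i).recvKey at hns
    simp only [eventGame]
    rcases hpost i hi with e | ⟨e1, -⟩
    · have hSR : ¬((sys.postAt S (postsOf es) i).sender = S ∧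
          (sys.postAt S (postsOf es) i).receiver = R) :=
        fun h => hns (hspecial _ (hkeys i hi) h.1 h.2)
      rw [← e, samePair_congr E (List.forall₂_take i hp)
        (fun a ha => (hs a (List.mem_of_mem_take ha)).keys)
        (fun a ha => (hs' a (List.mem_of_mem_take ha)).keys) (hkeys i hi) hSR]
      exact ⟨rfl, rfl, rfl, rfl⟩
    · exact absurd (hspecial _ (hkeys i hi) e1.1 e1.2.1) hns

end System

end EventGame

/-! ### From measures to finite averages -/

/-- An event that depends on finitely many coordinates only. -/
theorem toReal_measure_eq_Ex {I J K Ω β γ δ : Type} [DecidableEq I] [DecidableEq J] [DecidableEq K]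
    [Fintype β] [Nonempty β] [MeasurableSpace β] [MeasurableSingletonClass β]
    [Fintype γ] [Nonempty γ] [MeasurableSpace γ] [MeasurableSingletonClass γ]
    [Fintype δ] [Nonempty δ] [MeasurableSpace δ] [MeasurableSingletonClass δ]
    [Fintype Ω] [Nonempty Ω] [MeasurableSpace Ω] [MeasurableSingletonClass Ω]
    (s : Finset I) (t : Finset J) (u : Finset K)
    (p : ((I → β) × (J → γ) × (K → δ)) × Ω → Prop)
    (hp : ∀ x x' y y' z z' r, (∀ i ∈ s, x i = x' i) → (∀ j ∈ t, y j = y' j) →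
      (∀ k ∈ u, z k = z' k) → (p ((x, y, z), r) ↔ p ((x', y', z'), r))) :
    ((((Measure.infinitePi fun _ : I => uniform β).prod
      ((Measure.infinitePi fun _ : J => uniform γ).prod
        (Measure.infinitePi fun _ : K => uniform δ))).prod (uniform Ω)) {w | p w}).toReal =
    Ex s fun x => avg fun r => Ex t fun y => Ex u fun z => ind (p ((x, y, z), r)) := by
  have hext : ∀ {A B : Type} [DecidableEq A] [Nonempty B] (s : Finset A) (x : A → B), ∀ i ∈ s,
      x i = extendBy s (s.restrict x) i := by
    intro A B _ _ s x i hi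
    simp [extendBy, hi]
  -- Restriction to the relevant coordinates carries the infinite product to a uniform distribution
  -- on a finite type. The event is a preimage under it, and measurability comes for free.
  let f : ((I → β) × (J → γ) × (K → δ)) × Ω → ((s → β) × (t → γ) × (u → δ)) × Ω :=
    Prod.map (Prod.map s.restrict (Prod.map t.restrict u.restrict)) _root_.id
  have hf1 : Measurable (Prod.map (Finset.restrict (π := fun _ => γ) t)
    (Finset.restrict (π := fun _ => δ) u)) :=
    (Finset.measurable_restrict t).prodMap (Finset.measurable_restrict u)
  have hf2 : Measurable (Prod.map (Finset.restrict (π := fun _ => β) s) (Prod.map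
    (Finset.restrict (π := fun _ => γ) t) (Finset.restrict (π := fun _ => δ) u))) :=
    (Finset.measurable_restrict s).prodMap hf1
  have hf : Measurable f := hf2.prodMap measurable_id
  let q : ((s → β) × (t → γ) × (u → δ)) × Ω → Prop := fun v =>
    p ((extendBy s v.1.1, extendBy t v.1.2.1, extendBy u v.1.2.2), v.2)
  have hpre : {w | p w} = f ⁻¹' {v | q v} := by
    ext ⟨⟨x, y, z⟩, r⟩
    exact hp _ _ _ _ _ _ r (hext s x) (hext t y) (hext u z)
  rw [hpre, ← Measure.map_apply hf (Set.toFinite _).measurableSet,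
    ← Measure.map_prod_map _ _ hf2 measurable_id,
    ← Measure.map_prod_map _ _ (Finset.measurable_restrict s) hf1,
    ← Measure.map_prod_map _ _ (Finset.measurable_restrict t) (Finset.measurable_restrict u),
    map_restrict_uniform, map_restrict_uniform, map_restrict_uniform, Measure.map_id,
    uniform_prod, uniform_prod, uniform_prod, uniform_real_eq_avg, avg_prod, avg_prod]
  simp only [Ex_eq_avg]
  congr 1
  funext x
  rw [avg_comm]
  congr 1
  funext r
  rw [avg_prod]

/-- The functions need not be measurable: the lower integral is monotone, and additive as soon as
one summand, here the constant `ε`, is measurable. So no measurability of the view in the delays has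
to be shown. -/
theorem abs_toReal_lintegral_sub_le {α : Type} [MeasurableSpace α] {μ : Measure α}
    [IsProbabilityMeasure μ] {f g : α → ENNReal} (hf : ∀ a, f a ≤ 1) (hg : ∀ a, g a ≤ 1) {ε : ℝ}
    (h0 : 0 ≤ ε) (h : ∀ᵐ a ∂μ, |(f a).toReal - (g a).toReal| ≤ ε) :
    |(∫⁻ a, f a ∂μ).toReal - (∫⁻ a, g a ∂μ).toReal| ≤ ε := by
  have key : ∀ {f g : α → ENNReal}, (∀ a, f a ≤ 1) → (∀ a, g a ≤ 1) →
      (∀ᵐ a ∂μ, |(f a).toReal - (g a).toReal| ≤ ε) →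
      (∫⁻ a, f a ∂μ).toReal ≤ (∫⁻ a, g a ∂μ).toReal + ε := by
    intro f g hf hg h
    have hgi : ∫⁻ a, g a ∂μ ≤ 1 := (lintegral_mono hg).trans (by simp)
    have h1 : ∫⁻ a, f a ∂μ ≤ ∫⁻ a, g a ∂μ + ENNReal.ofReal ε := by
      have : ∫⁻ a, g a + ENNReal.ofReal ε ∂μ = ∫⁻ a, g a ∂μ + ENNReal.ofReal ε := by
        rw [lintegral_add_right _ measurable_const]; simp
      rw [← this]
      refine lintegral_mono_ae (h.mono fun a ha => ?_)
      have hfa := ((hf a).trans_lt ENNReal.one_lt_top).ne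
      have hga := ((hg a).trans_lt ENNReal.one_lt_top).ne
      rw [← ENNReal.ofReal_toReal hfa, ← ENNReal.ofReal_toReal hga,
        ← ENNReal.ofReal_add ENNReal.toReal_nonneg h0]
      exact ENNReal.ofReal_le_ofReal (by linarith [(abs_le.1 ha).2])
    have hfin := (hgi.trans_lt ENNReal.one_lt_top).ne
    have := ENNReal.toReal_mono (ENNReal.add_ne_top.2 ⟨hfin, ENNReal.ofReal_ne_top⟩) h1
    rwa [ENNReal.toReal_add hfin ENNReal.ofReal_ne_top, ENNReal.toReal_ofReal h0] at this
  rw [abs_le]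
  constructor
  · linarith [key hg hf (h.mono fun a ha => by rwa [abs_sub_comm])]
  · linarith [key hf hg h]

theorem ae_expMeasure_nonneg (r : ℝ) : ∀ᵐ x ∂expMeasure r, 0 ≤ x := by
  rw [ae_iff]
  have : {x : ℝ | ¬0 ≤ x} = Set.Iio 0 := by ext; simp
  rw [this, expMeasure, gammaMeasure, withDensity_apply _ measurableSet_Iio]
  exact lintegral_gammaPDF_of_nonpos le_rfl

theorem ae_infinitePi_nonneg {I : Type} [Countable I] {r : ℝ}
    [IsProbabilityMeasure (expMeasure r)] :
    ∀ᵐ x ∂Measure.infinitePi fun _ : I => expMeasure r, ∀ i, 0 ≤ x i :=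
  ae_all_iff.2 fun i => (measurePreserving_eval_infinitePi (fun _ : I => expMeasure r)
    i).quasiMeasurePreserving.ae (ae_expMeasure_nonneg r)

instance (sys : System) (ℓ : ℕ) : IsProbabilityMeasure (sys.secretLaw ℓ) := by
  unfold System.secretLaw
  infer_instance

instance (sys : System) : IsProbabilityMeasure sys.delayLaw := by
  have := isProbabilityMeasure_expMeasure sys.rateKey_pos
  have := isProbabilityMeasure_expMeasure sys.rateSend_pos
  unfold System.delayLaw
  infer_instance

theorem System.ae_delayLaw_nonneg (sys : System) :
    ∀ᵐ d ∂sys.delayLaw, (∀ i, 0 ≤ d.1 i) ∧ ∀ i, 0 ≤ d.2 i := by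
  have := isProbabilityMeasure_expMeasure sys.rateKey_pos
  have := isProbabilityMeasure_expMeasure sys.rateSend_pos
  exact (Measure.quasiMeasurePreserving_fst.ae ae_infinitePi_nonneg).and
    (Measure.quasiMeasurePreserving_snd.ae ae_infinitePi_nonneg)

/-! ### The view depends on finitely many keys -/

/-- `F` depends on finitely many values of its argument. -/
def FinitelyDetermined {A B X : Type} (F : (A → B) → X) : Prop :=
  ∃ s : Finset A, ∀ f g : A → B, (∀ a ∈ s, f a = g a) → F f = F g

namespace FinitelyDetermined

variable {A B X Y Z : Type}

theorem const (x : X) : FinitelyDetermined fun _ : A → B => x := ⟨∅, fun _ _ _ => rfl⟩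

theorem apply (a : A) : FinitelyDetermined fun f : A → B => f a :=
  ⟨{a}, fun _ _ h => h a (by simp)⟩

theorem map₂ {F : (A → B) → X} {G : (A → B) → Y} (hF : FinitelyDetermined F)
    (hG : FinitelyDetermined G) (op : X → Y → Z) : FinitelyDetermined fun f => op (F f) (G f) := by
  classical
  obtain ⟨s, hs⟩ := hF
  obtain ⟨t, ht⟩ := hG
  refine ⟨s ∪ t, fun f g h => ?_⟩
  beta_reduce
  rw [hs f g fun a ha => h a (by simp [ha]), ht f g fun a ha => h a (by simp [ha])]

theorem flatMap {ι : Type} (l : List ι) {F : ι → (A → B) → List X}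
    (h : ∀ i, FinitelyDetermined (F i)) : FinitelyDetermined fun f => l.flatMap fun i => F i f := by
  induction l with
  | nil => exact const []
  | cons i l ih =>
    simp only [List.flatMap_cons]
    exact (h i).map₂ ih _

end FinitelyDetermined

section Unobservability

variable {sys : System} {ℓ : ℕ} (torBroken : Bool) (S R : Fin sys.n) (τ : ℕ)
  (E : Activity sys.n (sys.ae.msgLen ℓ))

namespace System

/-- Finitely many events upload finitely many cover keys. Addresses and ciphertexts are kept as an
argument of the value, since only the dependence on key information is at issue. -/
theorem finitelyDetermined_transcriptWith :
    ∀ (es : List (Event sys.n (sys.ae.msgLen ℓ))) (past : List (RawSend sys.n (sys.ae.msgLen ℓ))),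
    FinitelyDetermined fun (kb : sys.Key → List Bool) (ac : ℕ → List Bool) =>
      sys.transcriptWith torBroken τ E kb ac past es
  | [], _ => .const fun _ => []
  | .upload t j s k :: es, past =>
      (FinitelyDetermined.apply (KeyId.cover j s k)).map₂
        (finitelyDetermined_transcriptWith es past) fun l T ac =>
          (false :: (stamp τ t ++ sys.identity torBroken j ++ l)) ++ T ac
  | .post m :: es, past =>
      (FinitelyDetermined.const ()).map₂ (finitelyDetermined_transcriptWith es (past ++ [m]))
        fun _ T ac => (true :: (stamp τ m.time ++ sys.identity torBroken m.sender ++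
          sys.identity torBroken m.receiver ++ ac past.length ++
          sys.retrievalBits τ E past m)) ++ T ac

theorem finitelyDetermined_eventGame (es : List (Event sys.n (sys.ae.msgLen ℓ))) :
    FinitelyDetermined (sys.eventGame torBroken S τ E es).view :=
  (FinitelyDetermined.flatMap (List.finRange sys.n) fun j =>
    (FinitelyDetermined.apply (KeyId.medium j)).map₂ (FinitelyDetermined.flatMap
      (List.range (E.queries j)) fun q => FinitelyDetermined.apply (KeyId.query j q))
      fun k l => k ++ l).map₂
    (finitelyDetermined_transcriptWith torBroken τ E es []) fun l T ac => l ++ T ac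

end System

theorem mem_oracleExec {h : List Bool → Bits ℓ} {q : List Bool} : ∀ {gs : List Gate}
    {w : List Bool} {Q : List (List Bool)}, q ∈ (oracleExec h gs w Q).2 →
    q ∈ Q ∨ ∃ args out, Gate.oracle args out ∈ gs ∧ q.length = args.length
  | [], _, _, hq => Or.inl hq
  | .const _ :: gs, _, _, hq => (mem_oracleExec (gs := gs) hq).imp_right
      fun ⟨a, o, h1, h2⟩ => ⟨a, o, by simp [h1], h2⟩
  | .nand _ _ :: gs, _, _, hq => (mem_oracleExec (gs := gs) hq).imp_right
      fun ⟨a, o, h1, h2⟩ => ⟨a, o, by simp [h1], h2⟩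
  | .oracle args out :: gs, _, _, hq => by
      rcases mem_oracleExec (gs := gs) hq with hq | ⟨a, o, h1, h2⟩
      · rcases List.mem_append.1 hq with hq | hq
        · exact Or.inl hq
        · refine Or.inr ⟨args, out, by simp, ?_⟩
          rw [List.mem_singleton.1 hq, List.length_map]
      · exact Or.inr ⟨a, o, by simp [h1], h2⟩

theorem Circuit.hashRun_congr (C : Circuit) (r : Bits C.coins) {h h' : List Bool → Bits ℓ}
    (x : List Bool) (hh : ∀ q : List Bool, q.length ≤ C.size → h q = h' q) :
    C.hashRun r h x = C.hashRun r h' x := by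
  refine (oracleExec_congr _ _ _ _ _ fun q hq => ?_).symm
  rcases mem_oracleExec hq with hq | ⟨args, out, h1, h2⟩
  · simp at hq
  · have := C.cost_le_size h1
    simp only [Gate.cost] at this
    exact (hh q (by omega)).symm

namespace Game

variable {S R} (G : Game sys ℓ)

theorem keys_congr {x x' : sys.Priv ℓ} {u : sys.Key} (h : x u = x' u) :
    keys S R x u = keys S R x' u := by
  rw [keys, keys, System.keyInfo, System.keyInfo, System.pub, System.pub, h]

theorem point_congr {x x' : sys.Priv ℓ} {j : ℕ × Bool} (h1 : x (G.sk j.1) = x' (G.sk j.1))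
    (h2 : x (G.rk j.1) = x' (G.rk j.1)) : G.point x j = G.point x' j := by
  simp only [point, System.shared, System.pub, h1, h2]

theorem posted_congr {Y Y' : HashValues ℓ} {ρ ρ' : ℕ → Bits (sys.ae.coinLen ℓ)}
    (hY : ∀ j ∈ G.indices, Y j = Y' j) (hρ : ∀ i < G.m, ρ i = ρ' i)
    (μ : ℕ → Bits (sys.ae.msgLen ℓ)) : G.posted Y ρ μ = G.posted Y' ρ' μ := by
  funext i
  refine if_ctx_congr Iff.rfl (fun hi => ?_) fun _ => rfl
  rw [hY (i, true) (G.mem_indices.2 hi), hY (i, false) (G.mem_indices.2 hi), hρ i hi]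

/-- Hash values are used in two places, at the points of the messages and at the queries of the
circuit. The set `sH` must contain the points for all private keys, since it is fixed before these
are drawn. -/
theorem acceptsWires_congr {s : Finset sys.Key}
    (hs : ∀ kb kb' : sys.Key → List Bool, (∀ u ∈ s, kb u = kb' u) → G.view kb = G.view kb')
    (hu : G.usedKeys ⊆ s) {sρ : Finset ℕ} (hρ : ∀ i < G.m, i ∈ sρ) {sH : Finset (List Bool)}
    (C : Circuit) (hH : ∀ q : List Bool, q.length ≤ C.size → q ∈ sH)
    (hP : ∀ x, ∀ j ∈ G.indices, G.point x j ∈ sH)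
    {x x' : sys.Priv ℓ} {ρ ρ' : ℕ → Bits (sys.ae.coinLen ℓ)} {H H' : List Bool → Bits ℓ}
    (r : Bits C.coins) (h1 : ∀ u ∈ s, x u = x' u) (h2 : ∀ i ∈ sρ, ρ i = ρ' i)
    (h3 : ∀ q ∈ sH, H q = H' q) :
    C.hashRun r H (G.input S R x (fun j => H (G.point x j)) ρ G.msg) =
      C.hashRun r H' (G.input S R x' (fun j => H' (G.point x' j)) ρ' G.msg) := by
  have hin : G.input S R x (fun j => H (G.point x j)) ρ G.msg =
      G.input S R x' (fun j => H' (G.point x' j)) ρ' G.msg := by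
    rw [input, input, hs _ _ fun u hu => keys_congr (h1 u hu)]
    congr 1
    refine G.posted_congr (fun j hj => ?_) (fun i hi => h2 i (hρ i hi)) _
    have hj' := G.mem_indices.1 hj
    rw [← G.point_congr (h1 _ (hu (G.sk_mem_usedKeys hj'))) (h1 _ (hu (G.rk_mem_usedKeys hj'))),
      h3 _ (hP x j hj)]
  rw [hin]
  exact C.hashRun_congr r _ fun q hq => h3 q (hH q hq)

end Game

namespace System

/-- The probability that `C` accepts for given delays is that of the real view. -/
theorem toReal_accepts_eq_realProb (choice : KeyChoice) (d : KeyDelays sys.n × SendDelays sys.n)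
    (C : Circuit) {G : Game sys ℓ} (hG : G = sys.eventGame torBroken S τ E
      ((events E d choice (sys.dummy ℓ)).take C.inputs)) {s : Finset sys.Key}
    (hs : ∀ kb kb' : sys.Key → List Bool, (∀ u ∈ s, kb u = kb' u) → G.view kb = G.view kb')
    (hu : G.usedKeys ⊆ s) {sρ : Finset ℕ} (hρ : ∀ i < G.m, i ∈ sρ) {sH : Finset (List Bool)}
    (hH : ∀ q : List Bool, q.length ≤ C.size → q ∈ sH)
    (hP : ∀ x, ∀ j ∈ G.indices, G.point x j ∈ sH) :
    (((sys.secretLaw ℓ).prod (uniform (Bits C.coins))) {w |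
      C.Accepts (fun _ q => List.ofFn (w.1.2.2 q))
        (sys.view w.1 torBroken S R τ E choice d) w.2}).toReal = G.realProb S R C s sρ sH := by
  have hset : {w : sys.Secrets ℓ × Bits C.coins | C.Accepts (fun _ q => List.ofFn (w.1.2.2 q))
      (sys.view w.1 torBroken S R τ E choice d) w.2} =
      {w | C.AcceptsWires (C.hashRun w.2 w.1.2.2 (G.input S R w.1.1
        (fun j => w.1.2.2 (G.point w.1.1 j)) w.1.2.1 G.msg)).1} :=
    Set.ext fun w => accepts_view_iff torBroken S R τ E w.1 choice d C w.2 hG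
  rw [hset]
  exact toReal_measure_eq_Ex s sρ sH (fun w : sys.Secrets ℓ × Bits C.coins =>
    C.AcceptsWires (C.hashRun w.2 w.1.2.2 (G.input S R w.1.1
        (fun j => w.1.2.2 (G.point w.1.1 j)) w.1.2.1 G.msg)).1)
    fun x x' y y' z z' r h1 h2 h3 => by
      simp only
      rw [G.acceptsWires_congr hs hu hρ C hH hP r h1 h2 h3]

theorem transcriptWith_addCall (c : HiddenSend sys.n (sys.ae.msgLen ℓ)) (kb : sys.Key → List Bool)
    (ac : ℕ → List Bool) :
    ∀ (es : List (Event sys.n (sys.ae.msgLen ℓ))) (past : List (RawSend sys.n (sys.ae.msgLen ℓ))),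
    sys.transcriptWith torBroken τ (E.addCall c) kb ac past es =
      sys.transcriptWith torBroken τ E kb ac past es
  | [], _ => rfl
  | .upload _ _ _ _ :: es, past => by
      rw [transcriptWith, transcriptWith, transcriptWith_addCall c kb ac es past]
  | .post m :: es, past => by
      rw [transcriptWith, transcriptWith, transcriptWith_addCall c kb ac es (past ++ [m])]
      rfl

theorem eventGame_addCall (c : HiddenSend sys.n (sys.ae.msgLen ℓ))
    (es : List (Event sys.n (sys.ae.msgLen ℓ))) :
    sys.eventGame torBroken S τ (E.addCall c) es = sys.eventGame torBroken S τ E es := by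
  simp only [eventGame, transcriptWith_addCall]
  rfl

/-- The bound for one security parameter and given delays. -/
theorem abs_toReal_accepts_sub_le {c : HiddenSend sys.n (sys.ae.msgLen ℓ)}
    (hcS : c.sender = S) (hcR : c.receiver = R) (hawait : sys.AwaitsBoth S R E c)
    (choice : KeyChoice) {d : KeyDelays sys.n × SendDelays sys.n}
    (hd : (∀ i, 0 ≤ d.1 i) ∧ ∀ i, 0 ≤ d.2 i) (C : Circuit) {sM : ℕ}
    (hM : sys.grp.MulCircuit ℓ sM) {εD εC : ℝ}
    (hεD : ∀ acc : sys.grp.Triple ℓ → Bool, Reach {f | f ∈ sys.grp.tripleBits ℓ}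
      (Game.ddhCost C.size C.size (sys.grp.len ℓ) sM) {acc} →
      |sys.grp.avgReal acc - sys.grp.avgRandom acc| ≤ εD) (hεD0 : 0 ≤ εD)
    (hεC0 : 0 ≤ εC)
    (hεC : ∀ (m₀ m₁ : Bits (sys.ae.msgLen ℓ)) (acc : Bits (sys.ae.ctLen ℓ) → Bool),
      Reach {f | f ∈ sys.ae.ctBits ℓ} (2 + Game.lazyCost (2 * C.size) C.size) {acc} →
      |sys.ae.avgEnc m₁ acc - sys.ae.avgEnc m₀ acc| ≤ εC) :
    |(((sys.secretLaw ℓ).prod (uniform (Bits C.coins))) {w |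
        C.Accepts (fun _ q => List.ofFn (w.1.2.2 q))
          (sys.view w.1 torBroken S R τ (E.addCall c) choice d) w.2}).toReal -
      (((sys.secretLaw ℓ).prod (uniform (Bits C.coins))) {w |
        C.Accepts (fun _ q => List.ofFn (w.1.2.2 q))
          (sys.view w.1 torBroken S R τ E choice d) w.2}).toReal| ≤
    2 * (4 * (C.size : ℝ) ^ 2 * (1 / sys.grp.p ℓ) +
      C.size * (εD + 2 * C.size * (1 / sys.grp.p ℓ)) + C.size * εC) := by
  classical
  obtain ⟨ha1, ha2, ha3⟩ := hawait
  set es := (events E d choice (sys.dummy ℓ)).take C.inputs with hes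
  set es' := (events (E.addCall c) d choice (sys.dummy ℓ)).take C.inputs with hes'
  have hsound : ∀ m ∈ postsOf es, SoundPost E sys.lifetime S R m := fun m hm =>
    soundPost_of_mem_events E hd choice (sys.dummy ℓ)
      (fun a ha => ha1 a (List.mem_cons_of_mem _ ha)) ha2 ha3
      (List.mem_of_mem_take (mem_postsOf.1 hm))
  have hsound' : ∀ m ∈ postsOf es', SoundPost E sys.lifetime S R m := fun m hm =>
    have h := soundPost_of_mem_events (E.addCall c) hd choice (sys.dummy ℓ) ha1 ha2 ha3
      (List.mem_of_mem_take (mem_postsOf.1 hm))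
    ⟨h.keys, h.timely⟩
  have hforall : List.Forall₂ (SameEvent E S R) es es' :=
    List.forall₂_take _ (forall₂_events_addCall E hd choice (sys.dummy ℓ) c hcS hcR ha1 ha2)
  set G := sys.eventGame torBroken S τ E es with hG
  set G' := sys.eventGame torBroken S τ E es' with hG'
  have hGp : G.Proper := eventGame_proper torBroken S τ E fun m hm => (hsound m hm).keys
  have hGp' : G'.Proper := eventGame_proper torBroken S τ E fun m hm => (hsound' m hm).keys
  have hin : C.inputs ≤ C.size := by unfold Circuit.size; omega
  have hm : G.m ≤ C.size :=
    (length_postsOf_le es).trans ((List.length_take_le _ _).trans hin)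
  have hm' : G'.m ≤ C.size :=
    (length_postsOf_le es').trans ((List.length_take_le _ _).trans hin)
  obtain ⟨s₁, hs₁⟩ := finitelyDetermined_eventGame torBroken S τ E es
  obtain ⟨s₂, hs₂⟩ := finitelyDetermined_eventGame torBroken S τ E es'
  -- The coordinates are chosen jointly for both scenarios, so that the two ideal probabilities are
  -- averages over the same space.
  let sX : Finset sys.Key := (s₁ ∪ s₂) ∪ (G.usedKeys ∪ G'.usedKeys)
  -- This length covers the points, whose counters are at most `C.size`, as well as all queries.
  let sH : Finset (List Bool) :=
    (List.finite_length_le Bool (32 + 2 * sys.grp.len ℓ + C.size)).toFinset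
  have hsH : ∀ q : List Bool, q.length ≤ C.size → q ∈ sH := fun q hq => by
    simp only [sH, Set.Finite.mem_toFinset, Set.mem_ofPred_eq]; omega
  have hρ : ∀ k ≤ C.size, ∀ i < k, i ∈ Finset.range C.size := fun k hk i hi =>
    Finset.mem_range.2 (hi.trans_le hk)
  have hpoint : ∀ {G : Game sys ℓ}, G.Proper → G.m ≤ C.size → ∀ x, ∀ j ∈ G.indices,
      G.point x j ∈ sH := by
    intro G hG hm x j hj
    have h1 := sys.length_hashInput_le j.2 (sys.shared x (G.sk j.1) (G.rk j.1))
      (sys.pub x (G.sk j.1)) (G.ns j.1)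
    have h2 := hG.ns_le j.1 (G.mem_indices.1 hj)
    simp only [sH, Set.Finite.mem_toFinset, Set.mem_ofPred_eq, Game.point]
    omega
  have hu : G.usedKeys ⊆ sX := Finset.subset_union_left.trans Finset.subset_union_right
  have hu' : G'.usedKeys ⊆ sX := Finset.subset_union_right.trans Finset.subset_union_right
  have e : _ = G.realProb S R C sX (Finset.range C.size) sH :=
    toReal_accepts_eq_realProb torBroken S R τ E choice d C hG
    (fun kb kb' h => hs₁ kb kb' fun u hu => h u (by simp [sX, hu])) hu (hρ _ hm) hsH
    (hpoint hGp hm)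
  have e' : _ = G'.realProb S R C sX (Finset.range C.size) sH :=
    toReal_accepts_eq_realProb torBroken S R τ (E.addCall c) choice d C
    (hG'.trans (eventGame_addCall torBroken S τ E c es').symm)
    (fun kb kb' h => hs₂ kb kb' fun u hu => h u (by simp [sX, hu])) hu' (hρ _ hm') hsH
    (hpoint hGp' hm')
  have hbound : ∀ {G : Game sys ℓ}, G.Proper → G.m ≤ C.size → G.usedKeys ⊆ sX →
      |G.realProb S R C sX (Finset.range C.size) sH -
        G.idealProb S R C sX (Finset.range C.size) sH| ≤
      4 * (C.size : ℝ) ^ 2 * (1 / sys.grp.p ℓ) +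
        C.size * (εD + 2 * C.size * (1 / sys.grp.p ℓ)) + C.size * εC := by
    intro G hG hm hu
    refine (G.abs_realProb_sub_idealProb_le S R hG C hu (hρ _ hm) hsH (hpoint hG hm) hm hM hεD
      hεC0 hεC).trans ?_
    have hm : (G.m : ℝ) ≤ C.size := by exact_mod_cast hm
    gcongr
  -- The two scenarios meet here: their ideal probabilities are equal. The distance between real and
  -- ideal is paid twice.
  have hid := idealProb_eventGame_congr (torBroken := torBroken) (τ := τ) hforall hsound hsound'
    C sX (Finset.range C.size) sH
  rw [e, e']
  have b := hbound hGp hm hu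
  have b' := hbound hGp' hm' hu'
  rw [← hid, abs_le] at b'
  rw [abs_le] at b ⊢
  constructor <;> linarith [b.1, b.2, b'.1, b'.2]

end System

end Unobservability

/-! ### Unobservability -/

/-- The bound for given delays involves only the size of the circuit, `p` and the two advantages. It
therefore holds for almost all delays with the same right-hand side and passes to the integral. -/
theorem System.unobservable (sys : System)
    (hgrp : sys.grp.Efficient) (hddh : sys.grp.DDH)
    (haeEff : sys.ae.Efficient) (hae : sys.ae.Secure)
    (S R : Fin sys.n)
    (E : ∀ ℓ, Activity sys.n (sys.ae.msgLen ℓ))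
    (c : ∀ ℓ, HiddenSend sys.n (sys.ae.msgLen ℓ))
    (hc : ∀ ℓ, (c ℓ).sender = S ∧ (c ℓ).receiver = R)
    (hawait : ∀ ℓ, sys.AwaitsBoth S R (E ℓ) (c ℓ))
    (choice : KeyChoice) (torBroken : Bool) :
    sys.Unobservable choice torBroken S R E c := by
  intro C τ hC
  have hs := PolyBounded.size hC
  have hlen := sys.grp.polyBounded_len hgrp
  obtain ⟨M, hMs, hM⟩ := hgrp
  have hlazy : ∀ {k : ℕ → ℕ}, PolyBounded k →
      PolyBounded fun ℓ => Game.lazyCost (k ℓ) (C ℓ).size := fun hk =>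
    hs.mul (hs.mul (((hk.add hs).mul (((PolyBounded.const 22).mul hs).add (.const 7))).add
      (.const 1)))
  have h2s := (PolyBounded.const 2).mul hs
  obtain ⟨εD, hεD, hD⟩ := sys.grp.exists_ddh_bound hddh hlen
    (b := fun ℓ => Game.ddhCost (C ℓ).size (C ℓ).size (sys.grp.len ℓ) (M ℓ).size)
    ((PolyBounded.const 2).add ((h2s.mul (hlen.mul ((PolyBounded.const 2).mul
      (PolyBounded.size hMs).runCost))).add ((hlazy h2s).add ((h2s.mul
        (((PolyBounded.const 11).mul hlen).add (.const 4))).add (.const 1)))))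
  obtain ⟨εC, hεC, hC'⟩ := sys.ae.exists_cpa_bound hae.1 (sys.ae.polyBounded_ctLen haeEff)
    (sys.ae.polyBounded_msgLen haeEff) ((PolyBounded.const 2).add (hlazy h2s))
  have hp := sys.grp.negligible_inv_p hddh hlen
  have hD0 : ∀ ℓ, 0 ≤ εD ℓ := fun ℓ => (abs_nonneg _).trans (hD ℓ (fun _ => false)
    ((Reach.const_fn false).mono_cost (by unfold Game.ddhCost; omega)))
  have hC0 : ∀ ℓ, 0 ≤ εC ℓ := fun ℓ => (abs_nonneg _).trans
    (hC' ℓ (pad (sys.dummy ℓ)) (pad (sys.dummy ℓ)) (fun _ => false)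
      ((Reach.const_fn false).mono_cost (by omega)))
  have hbound : Negligible fun ℓ => 2 * (4 * ((C ℓ).size : ℝ) ^ 2 * (1 / sys.grp.p ℓ) +
      (C ℓ).size * (εD ℓ + 2 * (C ℓ).size * (1 / sys.grp.p ℓ)) + (C ℓ).size * εC ℓ) := by
    -- The coefficient 6 collects the terms in `size ^ 2 / p`: 4 from collisions of private keys and
    -- 2 from queries that hit a random third component.
    have h := (((((hp.poly_mul hs).poly_mul hs).const_mul 6).add (hεD.poly_mul hs)).add
      (hεC.poly_mul hs)).const_mul 2
    convert h using 2 with ℓ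
    ring
  refine hbound.mono fun ℓ => ?_
  rw [abs_abs]
  refine abs_toReal_lintegral_sub_le (fun _ => MeasureTheory.prob_le_one) (fun _ => MeasureTheory.prob_le_one) ?_
    (sys.ae_delayLaw_nonneg.mono fun d hd =>
      System.abs_toReal_accepts_sub_le torBroken S R (τ ℓ) (E ℓ) (hc ℓ).1 (hc ℓ).2 (hawait ℓ)
        choice hd (C ℓ) ⟨M ℓ, le_rfl, hM ℓ⟩ (hD ℓ) (hD0 ℓ) (hC0 ℓ) (hC' ℓ))
  have h1 := hD0 ℓ
  have h2 := hC0 ℓ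
  positivity

end Pigeonhole

end

theorem theorem2 (sys : Pigeonhole.System)
    (hgrp : sys.grp.Efficient) (hddh : sys.grp.DDH)
    (haeEff : sys.ae.Efficient) (hae : sys.ae.Secure)
    (S R : Fin sys.n) (hSR : S ≠ R)
    (E : ∀ ℓ, Pigeonhole.Activity sys.n (sys.ae.msgLen ℓ))
    (c : ∀ ℓ, Pigeonhole.HiddenSend sys.n (sys.ae.msgLen ℓ))
    (hc : ∀ ℓ, (c ℓ).sender = S ∧ (c ℓ).receiver = R)
    (hawait : ∀ ℓ, sys.AwaitsBoth S R (E ℓ) (c ℓ))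
    (choice : Pigeonhole.KeyChoice) (torBroken : Bool) :
    sys.Unobservable choice torBroken S R E c :=
  sys.unobservable hgrp hddh haeEff hae S R E c hc hawait choice torBroken
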